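/- **Setting.** A Markov chain with rewards $(S,\partial S,p,r)$ consists of a measurable space $S$, a measurable set $\partial S\subseteq S$ of terminal states, a transition kernel $p:S\to\mathcal P(S)$ and a measurable reward function $r:S\to\mathbb R$, such that $p(s)=\delta_s$ and $r(s)=0$ for $s\in\partial S$. Let $(S_i,\partial S_i,p_i,r_i)$, $i=1,\dots,n$, be such chains, and assume that from every initial state each chain reaches a terminal state in finite time with probability one and that the sum of the absolute values of its rewards has finite expectation. Let $1\le k\le n$. *MCS-$k$.* Undiscounted $k$-finish Markov chain selection is the Markov decision process with states $s=(s_1,\dots,s_n)\in S_1\times\dots\times S_n$ in which one repeatedly plays some chain $a$ with $s_a\notin\partial S_a$ (chains in terminal states cannot be played), receives $r_a(s_a)$, and replaces $s_a$ by a sample of $p_a(s_a)$, the other components being unchanged. The process ends as soon as at least $k$ of the components are terminal. The value of a policy (possibly randomized and history-dependent) from an initial state is its expected total reward until the process ends. A policy is optimal if, from every initial state, its value is at least that of every other policy. *Gittins index.* For a chain $(S,\partial S,p,r)$, $s\in S$ and $\alpha\in\mathbb R$, let $V_{\mathrm{loc}}^*(s;\alpha)$ be the optimal value of the problem in which, starting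 from $s$, at each step before the chain is terminal one either advances the chain and receives the reward $r$ of its current state, or stops for good and receives $\alpha$; that is, $$V_{\mathrm{loc}}^*(s;\alpha)=\sup_{B\subseteq S\ \text{measurable}}\mathbb E_s\Big[\sum_{0\le t<\min(\tau_B,\tau)}r(s(t))+\alpha\,\mathbf 1\{\tau_B<\tau\}\Big],$$ where $s(0)=s,s(1),\dots$ is the trajectory of the chain and $\tau_B,\tau$ are the hitting times of $B$ and $\partial S$. The Gittins index is $G(s)=\sup\{g\in\mathbb R:V_{\mathrm{loc}}^*(s;g)>g\}\in\mathbb R\cup\{\infty\}$. For $s\notin\partial S$, the surrogate value is the random variable $\Gamma(s)=\min_{0\le t<\tau}G(s(t))$. A non-terminal state $s$ is called free if $r(s)\ge 0$ and $p(s)(\partial S)=0$. A *Gittins policy* is a policy that, until the process ends, always plays a non-terminated chain $a$ of greatest Gittins index, i.e. $s_a\notin\partial S_a$ and $G_a(s_a)\ge G_j(s_j)$ for all $j$ with $s_j\notin\partial S_j$ (ties are broken arbitrarily). **Theorem.** Under every policy and from every initial state, MCS-$k$ ends almost surely and the sum of the absolute values of the rewards received has finite expectation. There is a Gittins policy, even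 a deterministic stationary one, and every Gittins policy is optimal. If moreover none of the chains has a free state, then for every initial state $(s_1,\dots,s_n)$ the value of every Gittins policy is $$\mathbb E\Big[\max_{I\subseteq\{i:\,s_i\notin\partial S_i\},\ |I|=\max(k-\ell,0)}\ \sum_{i\in I}\Gamma_i(s_i)\Big],\qquad \ell=\#\{i:s_i\in\partial S_i\},$$ where the surrogate values $\Gamma_i(s_i)$ of the different chains are independent; they are almost surely finite, and the maximum is integrable. In particular, if no $s_i$ is terminal, the value is the expected sum of the $k$ largest surrogate values. -/

import Mathlib

open MeasureTheory ProbabilityTheory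
open scoped ENNReal

universe u

noncomputable section

/-- A Markov chain with rewards: a measurable state space `S`, terminal states, a transition
kernel and a reward function. Terminal states are absorbing and carry zero reward. -/
structure RewardChain (S : Type u) [MeasurableSpace S] where
  /-- the terminal states -/
  terminal : Set S
  measurableSet_terminal : MeasurableSet terminal
  /-- the transition kernel -/
  step : Kernel S S
  isMarkov : IsMarkovKernel step
  /-- the reward received when the chain is advanced from a given state -/
  reward : S → ℝ
  measurable_reward : Measurable reward
  absorbing : ∀ s ∈ terminal, step s = Measure.dirac s
  reward_terminal : ∀ s ∈ terminal, reward s = 0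

attribute [instance] RewardChain.isMarkov

namespace RewardChain

variable {S : Type u} [MeasurableSpace S] (C : RewardChain S)

/-- The law on `ℕ → S` of the trajectory of the Markov chain started at `s`. -/
def traj (s : S) : Measure (ℕ → S) :=
  Kernel.traj (X := fun _ => S)
    (fun t => C.step.comap (fun h : (Finset.Iic t → S) => h ⟨t, Finset.mem_Iic.2 le_rfl⟩)
      (measurable_pi_apply _)) 0 (fun _ => s)

instance (s : S) : IsProbabilityMeasure (C.traj s) := by
  unfold traj; infer_instance

/-- The standing assumption of the undiscounted setting: from every initial state, the chain
reaches a terminal state in finite time with probability one, and the sum of the absolute values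
of the rewards has finite expectation. -/
def Admissible : Prop :=
  ∀ s, (∀ᵐ ω ∂C.traj s, ∃ t, ω t ∈ C.terminal) ∧
    ∫⁻ ω, ∑' t, ‖C.reward (ω t)‖ₑ ∂C.traj s < ∞

/-- A state is free if it is non-terminal, has non-negative reward, and has zero probability of
transitioning directly into a terminal state. -/
def IsFree (s : S) : Prop :=
  s ∉ C.terminal ∧ 0 ≤ C.reward s ∧ C.step s C.terminal = 0

open Classical in
/-- The total reward in the local MDP with alternative `α` along the trajectory `ω`, under the
stationary policy which stops exactly in the states of `B`: the rewards of the chain are collected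
until stopping, and `α` is collected on stopping. The local MDP also ends when the chain reaches a
terminal state, after which `α` is no longer available. -/
def localReturn (α : ℝ) (B : Set S) (ω : ℕ → S) : ℝ :=
  (∑' t, if ∀ v ≤ t, ω v ∉ B then C.reward (ω t) else 0) +
    if ∃ t, ω t ∈ B ∧ ∀ v ≤ t, ω v ∉ C.terminal then α else 0

/-- The optimal value of the `(s, α)`-local MDP: the supremum, over all stationary policies
(given by their measurable stopping sets), of the expected total reward. -/
def localValue (s : S) (α : ℝ) : ℝ :=
  ⨆ B : {B : Set S // MeasurableSet B}, ∫ ω, C.localReturn α B ω ∂C.traj s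

/-- The Gittins index `sup {g : V(s; g) > g}`, with value in `ℝ ∪ {∞}` for admissible chains. -/
def gittins (s : S) : EReal :=
  sSup ((fun g : ℝ => (g : EReal)) '' {g : ℝ | g < C.localValue s g})

/-- The surrogate value along a trajectory: the minimal Gittins index among the states visited
strictly before the terminal states are reached. -/
def surrogate (ω : ℕ → S) : EReal :=
  ⨅ t : {t : ℕ // ∀ v ≤ t, ω v ∉ C.terminal}, C.gittins (ω t)

end RewardChain

namespace MCS

variable {n : ℕ} {S : Fin n → Type u} [∀ i, MeasurableSpace (S i)] (C : ∀ i, RewardChain (S i))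

open Classical in
/-- The chains that are not in a terminal state; these are the allowed actions. -/
def active (x : ∀ i, S i) : Finset (Fin n) :=
  Finset.univ.filter fun i => x i ∉ (C i).terminal

open Classical in
/-- The chains that are in a terminal state. -/
def finished (x : ∀ i, S i) : Finset (Fin n) :=
  Finset.univ.filter fun i => x i ∈ (C i).terminal

/-- The terminal states of `k`-finish Markov chain selection: `k` distinct chains have reached
terminal states. -/
def Ended (k : ℕ) (x : ∀ i, S i) : Prop := k ≤ (finished C x).card

/-- The transition kernel: action `a` replaces the component `x a` by a sample of the transition
kernel of chain `a` at `x a`, and leaves the other components unchanged. -/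
def step : Kernel ((∀ i, S i) × Fin n) (∀ i, S i) where
  toFun y := ((C y.2).step (y.1 y.2)).map (Function.update y.1 y.2)
  measurable' := by
    refine measurable_from_prod_countable_left fun a => ?_
    have hm : Measurable fun q : (∀ i, S i) × S a => Function.update q.1 a q.2 :=
      measurable_pi_iff.2 fun j => by
        by_cases hj : j = a
        · subst hj; simpa using measurable_snd
        · simp only [Function.update_of_ne hj]; fun_prop
    have h := (((Kernel.id : Kernel (∀ i, S i) (∀ i, S i)) ×ₖ
      ((C a).step.comap (fun x : ∀ i, S i => x a) (measurable_pi_apply a))).map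
        (fun q : (∀ i, S i) × S a => Function.update q.1 a q.2)).measurable
    convert h using 2 with x
    rw [Kernel.map_apply _ hm, Kernel.prod_apply, Kernel.id_apply, Kernel.comap_apply,
      Measure.dirac_prod, Measure.map_map hm measurable_prodMk_left]
    rfl

instance : IsMarkovKernel (step C) where
  isProbabilityMeasure y := by
    have : Measurable (Function.update y.1 y.2) := measurable_update y.1
    exact Measure.isProbabilityMeasure_map this.aemeasurable

/-- A (randomized, history-dependent) policy for `k`-finish Markov chain selection. At time `0` it
draws an action given the initial state; at time `t + 1` it draws an action given the states and
actions at times `0, …, t` and the state at time `t + 1`. As long as the process has not ended, it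
plays only chains that are not in a terminal state. -/
structure Policy (k : ℕ) where
  first : Kernel (∀ i, S i) (Fin n)
  next : ∀ t : ℕ, Kernel ((Finset.Iic t → (∀ i, S i) × Fin n) × (∀ i, S i)) (Fin n)
  isMarkov_first : IsMarkovKernel first
  isMarkov_next : ∀ t, IsMarkovKernel (next t)
  first_allowed : ∀ x, ¬ Ended C k x → ∀ᵐ a ∂first x, a ∈ active C x
  next_allowed : ∀ t h x, ¬ Ended C k x → ∀ᵐ a ∂next t (h, x), a ∈ active C x

attribute [instance] Policy.isMarkov_first Policy.isMarkov_next

/-- Chain `a` is a non-terminated chain of greatest Gittins index. -/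
def IsGittinsAction (x : ∀ i, S i) (a : Fin n) : Prop :=
  a ∈ active C x ∧ ∀ j ∈ active C x, (C j).gittins (x j) ≤ (C a).gittins (x a)

open Classical in
/-- The reward for action `y.2` in state `y.1`; nothing is received once the process has ended. -/
def reward (k : ℕ) (y : (∀ i, S i) × Fin n) : ℝ :=
  if Ended C k y.1 then 0 else (C y.2).reward (y.1 y.2)

namespace Policy

variable {C} {k : ℕ} (π : Policy C k)

/-- The law of the sequence of state-action pairs under `π`, started at `x`. -/
def traj (x : ∀ i, S i) : Measure (ℕ → (∀ i, S i) × Fin n) :=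
  ((π.first x).map (fun a (_ : Finset.Iic 0) => (x, a))).bind
    (Kernel.traj (X := fun _ => (∀ i, S i) × Fin n)
      (fun t => ((step C).comap
        (fun h : (Finset.Iic t → (∀ i, S i) × Fin n) => h ⟨t, Finset.mem_Iic.2 le_rfl⟩)
        (measurable_pi_apply _)) ⊗ₖ π.next t) 0)

/-- The expected total reward of `π` from the initial state `x`, until the process ends. -/
def value (x : ∀ i, S i) : ℝ := ∫ ω, ∑' t, reward C k (ω t) ∂π.traj x

/-- `π` is optimal: from every initial state its value is greatest among all policies. -/
def IsOptimal : Prop := ∀ (x : ∀ i, S i) (ρ : Policy C k), ρ.value x ≤ π.value x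

/-- `π` always plays a non-terminated chain of greatest Gittins index (with any tie-breaking). -/
def IsGittins : Prop :=
  (∀ x, ¬ Ended C k x → ∀ᵐ a ∂π.first x, IsGittinsAction C x a) ∧
  ∀ t h x, ¬ Ended C k x → ∀ᵐ a ∂π.next t (h, x), IsGittinsAction C x a

/-- `π` is the deterministic stationary policy given by a function of the current state. -/
def IsStationary : Prop :=
  ∃ (σ : (∀ i, S i) → Fin n) (_ : Measurable σ),
    (∀ x, π.first x = Measure.dirac (σ x)) ∧ ∀ t h x, π.next t (h, x) = Measure.dirac (σ x)

end Policy

/-- The sum of the `m` largest of the numbers `v i`, `i ∈ J`. -/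
def topSum (J : Finset (Fin n)) (m : ℕ) (v : Fin n → ℝ) : ℝ :=
  ⨆ I : Finset.powersetCard m J, ∑ i ∈ I.1, v i

/-- The sum of the largest surrogate values, one for each chain that still has to finish, when the
chains, started at `x`, follow the trajectories `ω`. -/
def surrogateSum (k : ℕ) (x : ∀ i, S i) (ω : ∀ i, ℕ → S i) : ℝ :=
  topSum (active C x) (k - (finished C x).card) fun i => ((C i).surrogate (ω i)).toReal

end MCS

end

noncomputable section

open Filter Topology

/-! Let a policy play until the process ends, and then let all chains run on by themselves. Whatever
the policy, the full trajectories obtained in this way are independent and have the laws of the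
chains (`MCS.Policy.map_merged`, an optional stopping argument). Hence the value of a policy is the
sum of the expected total rewards of the chains, which no policy influences, minus the expected
rewards forgone, those that the chains would pay after the end.

The forgone rewards are bounded below chain by chain. For a fixed stopping set the value of the
local problem is affine in `α`, with slope the probability of stopping. So `V(s; α)` is convex in
`α`, and the optimal stopping set `{V ≤ α} = {G ≤ α}` provides the subgradient `P(Γ ≤ α)`. Thus `V`
is a primitive of the distribution function of `Γ`: `V(b) - V(a) = E (b - max Γ a)⁺`
(`integral_pos_part_sub_max`). With `a → -∞` and `b → ∞` this gives `E Γ ≤ E [total reward]`, with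
equality if `G(s) < ∞`. Given the history, an unfinished chain therefore forgoes on average at least
the surrogate value of its remaining trajectory, which is at least that of its full trajectory, a
minimum over more states. The chains that finish on the way are exactly `max (k - ℓ) 0` of the
initially active ones, so their surrogate values add up to at most the largest such sum. This bounds
every value by `upperValue`.

Under a Gittins policy all these inequalities are equalities. A chain whose index has risen above
the minimum of its past indices is played until this is no longer so
(`IsRegular.gittins_invariant`). Hence at the end the past of an unfinished chain does not lower its
surrogate value, and the finished chains have the largest ones. The remaining indices are finite,
because the last chain played had the greatest index and could terminate, which a state of infinite
index cannot do in one step. If the process has ended at the start, all values are zero.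

Without free states, a maximum principle shows that all indices are finite. Then `E Γ` equals the
expected total reward of every chain, and `upperValue` reduces to the expected sum of the largest
surrogate values. -/

/-- The sequence `ω` with `s` put in front. -/
def seqCons {α : Type*} (s : α) (ω : ℕ → α) (t : ℕ) : α := Nat.casesOn t s ω

@[simp] lemma seqCons_zero {α : Type*} (s : α) (ω : ℕ → α) : seqCons s ω 0 = s := rfl

@[simp] lemma seqCons_succ {α : Type*} (s : α) (ω : ℕ → α) (t : ℕ) :
    seqCons s ω (t + 1) = ω t := rfl

lemma measurable_seqCons_uncurry {α : Type*} [MeasurableSpace α] :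
    Measurable fun p : α × (ℕ → α) => seqCons p.1 p.2 := by
  refine measurable_pi_iff.2 fun t => ?_
  cases t with
  | zero => exact measurable_fst
  | succ t => exact (measurable_pi_apply t).comp measurable_snd

@[fun_prop]
lemma measurable_seqCons {α : Type*} [MeasurableSpace α] (s : α) : Measurable (seqCons s) :=
  measurable_seqCons_uncurry.comp (measurable_const.prodMk measurable_id)

/-! ### Uniqueness of the trajectory measure given its one-step transitions. -/

section Trajectories

variable {X : Type*} [MeasurableSpace X] (κ : ∀ t : ℕ, Kernel (Finset.Iic t → X) X)
  [∀ t, IsMarkovKernel (κ t)]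

lemma map_frestrictLe_compProd_traj (h : Finset.Iic 0 → X) (t : ℕ) :
    ((Kernel.traj (X := fun _ => X) κ 0 h).map (Preorder.frestrictLe t)) ⊗ₘ κ t =
      (Kernel.traj (X := fun _ => X) κ 0 h).map
        (fun ω => (Preorder.frestrictLe t ω, ω (t + 1))) := by
  rw [Kernel.traj_map_frestrictLe_apply]
  exact Kernel.partialTraj_compProd_eq_map_traj (X := fun _ => X) (κ := κ) (Nat.zero_le t)

/-- One step of the trajectory constructed from the kernels `κ`. -/
lemma lintegral_traj_next (h : Finset.Iic 0 → X) (t : ℕ)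
    {f : (Finset.Iic t → X) × X → ℝ≥0∞} (hf : Measurable f) :
    ∫⁻ ω, f (Preorder.frestrictLe t ω, ω (t + 1)) ∂Kernel.traj (X := fun _ => X) κ 0 h =
      ∫⁻ ω, ∫⁻ y, f (Preorder.frestrictLe t ω, y) ∂κ t (Preorder.frestrictLe t ω)
        ∂Kernel.traj (X := fun _ => X) κ 0 h := by
  have hm : Measurable fun ω : ℕ → X =>
      ((Preorder.frestrictLe t ω : Finset.Iic t → X), ω (t + 1)) := by fun_prop
  rw [← lintegral_map hf hm, ← map_frestrictLe_compProd_traj κ h t, Measure.lintegral_compProd hf,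
    lintegral_map (by fun_prop) (by fun_prop)]

/-- The one-step identities determine all finite-dimensional marginals by induction, and a
projective limit is unique. This reduces the Markov property to a check of single transitions. -/
lemma eq_traj_of_lintegral_next (h : Finset.Iic 0 → X) (ν : Measure (ℕ → X))
    (h0 : ν.map (Preorder.frestrictLe 0) = Measure.dirac h)
    (hν : ∀ (t : ℕ) (f : (Finset.Iic t → X) × X → ℝ≥0∞), Measurable f →
      ∫⁻ ω, f (Preorder.frestrictLe t ω, ω (t + 1)) ∂ν =
        ∫⁻ ω, ∫⁻ y, f (Preorder.frestrictLe t ω, y) ∂κ t (Preorder.frestrictLe t ω) ∂ν) :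
    ν = Kernel.traj (X := fun _ => X) κ 0 h := by
  have key : ∀ b, ν.map (Preorder.frestrictLe b) =
      (Kernel.traj (X := fun _ => X) κ 0 h).map (Preorder.frestrictLe b) := by
    intro b
    induction b with
    | zero =>
      rw [h0, Kernel.traj_map_frestrictLe_apply, Kernel.partialTraj_self, Kernel.id_apply]
    | succ b ih =>
      refine Measure.ext_of_lintegral _ fun f hf => ?_
      have hg : Measurable fun (p : (Finset.Iic b → X) × X) (i : Finset.Iic (b + 1)) =>
          if hi : i.1 ≤ b then p.1 ⟨i.1, Finset.mem_Iic.2 hi⟩ else p.2 := by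
        refine measurable_pi_iff.2 fun i => ?_
        by_cases hi : i.1 ≤ b
        · simp only [hi, dite_true]; fun_prop
        · simp only [hi, dite_false]; fun_prop
      have hfg := hf.comp hg
      have e : ∀ ω : ℕ → X, f (Preorder.frestrictLe (b + 1) ω) =
          (f ∘ fun (p : (Finset.Iic b → X) × X) (i : Finset.Iic (b + 1)) =>
          if hi : i.1 ≤ b then p.1 ⟨i.1, Finset.mem_Iic.2 hi⟩ else p.2)
            (Preorder.frestrictLe b ω, ω (b + 1)) := by
        intro ω
        simp only [Function.comp]
        congr 1
        ext i
        by_cases hi : i.1 ≤ b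
        · simp [hi]
        · have : i.1 = b + 1 := le_antisymm (Finset.mem_Iic.1 i.2) (by omega)
          simp [this]
      rw [lintegral_map hf (by fun_prop), lintegral_map hf (by fun_prop)]
      simp only [e]
      rw [hν b _ hfg, lintegral_traj_next κ h b hfg]
      have hm : Measurable fun q : Finset.Iic b → X => ∫⁻ y,
          (f ∘ fun (p : (Finset.Iic b → X) × X) (i : Finset.Iic (b + 1)) =>
          if hi : i.1 ≤ b then p.1 ⟨i.1, Finset.mem_Iic.2 hi⟩ else p.2) (q, y) ∂κ b q :=
        hfg.lintegral_kernel_prod_right'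
      rw [← lintegral_map (g := Preorder.frestrictLe (π := fun _ => X) b) hm (by fun_prop), ih,
        lintegral_map hm (by fun_prop)]
  have (I : Finset ℕ) : IsFiniteMeasure (inducedFamily (X := fun _ => X)
      (fun n => Kernel.partialTraj (X := fun _ => X) κ 0 n h) I) := by
    have (n : ℕ) : IsFiniteMeasure (Kernel.partialTraj (X := fun _ => X) κ 0 n h) := inferInstance
    infer_instance
  refine ((Kernel.isProjectiveLimit_trajFun (X := fun _ => X) κ 0 h).unique ?_).symm
  refine (isProjectiveLimit_nat_iff (X := fun _ => X)
    (Kernel.isProjectiveMeasureFamily_partialTraj (X := fun _ => X) κ h) ν).2 fun b => ?_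
  rw [inducedFamily_Iic]
  exact (key b).trans (Kernel.traj_map_frestrictLe_apply (X := fun _ => X) (κ := κ) 0 b h)

end Trajectories

/-! ### The Markov property of one chain at its first step. -/

namespace RewardChain

variable {S : Type u} [MeasurableSpace S] (C : RewardChain S)

/-- The law of the trajectory as a kernel in the initial state. -/
def trajKernel : Kernel S (ℕ → S) :=
  (Kernel.traj (X := fun _ => S)
    (fun t => C.step.comap (fun h : (Finset.Iic t → S) => h ⟨t, Finset.mem_Iic.2 le_rfl⟩)
      (measurable_pi_apply _)) 0).comap (fun s _ => s)
      (measurable_pi_lambda _ fun _ => measurable_id)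

lemma trajKernel_apply (s : S) : C.trajKernel s = C.traj s := rfl

instance : IsMarkovKernel C.trajKernel := by unfold trajKernel; infer_instance

@[fun_prop]
lemma measurable_traj : Measurable C.traj := C.trajKernel.measurable

/-- The Markov property at the first step. -/
lemma traj_eq_map_compProd (s : S) :
    C.traj s = ((C.step s) ⊗ₘ C.trajKernel).map fun p => seqCons s p.2 := by
  have hm : Measurable fun p : S × (ℕ → S) => seqCons s p.2 := by fun_prop
  symm
  refine eq_traj_of_lintegral_next _ _ _ ?_ fun t f hf => ?_
  · rw [Measure.map_map (by fun_prop) hm]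
    have : (Preorder.frestrictLe (π := fun _ => S) 0 ∘ fun p : S × (ℕ → S) => seqCons s p.2) =
        fun _ _ => s := by
      ext p i
      have : i.1 = 0 := Nat.le_zero.1 (Finset.mem_Iic.1 i.2)
      simp [this]
    rw [this, Measure.map_const]
    simp
  · have hf' : Measurable fun ω : ℕ → S =>
        ∫⁻ y, f (Preorder.frestrictLe t ω, y) ∂C.step (ω t) := by
      have : Measurable fun p : (ℕ → S) × S => f (Preorder.frestrictLe t p.1, p.2) := by fun_prop
      exact this.lintegral_kernel_prod_right' (κ := C.step.comap (fun ω : ℕ → S => ω t)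
        (measurable_pi_apply t))
    simp only [Kernel.comap_apply, Preorder.frestrictLe_apply]
    rw [lintegral_map (by fun_prop) hm, lintegral_map hf' hm,
      Measure.lintegral_compProd (by fun_prop), Measure.lintegral_compProd
        (f := fun p : S × (ℕ → S) => ∫⁻ y, f (Preorder.frestrictLe t (seqCons s p.2), y)
          ∂C.step (seqCons s p.2 t)) (hf'.comp hm)]
    simp only [trajKernel_apply, seqCons_succ]
    -- For `t = 0` the next state of the prefixed path is the starting point of the shifted path,
    -- which is almost surely `y`. For later times the transition is one of the shifted path, with
    -- `s` a constant part of the history.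
    cases t with
    | zero =>
      have e : ∀ ω : ℕ → S, (Preorder.frestrictLe 0 (seqCons s ω) : Finset.Iic 0 → S) =
          fun _ => s := by
        intro ω; ext i
        have : i.1 = 0 := Nat.le_zero.1 (Finset.mem_Iic.1 i.2)
        simp [this]
      simp only [e, seqCons_zero, lintegral_const, measure_univ, mul_one]
      refine lintegral_congr fun y => ?_
      have hd : (C.traj y).map (Preorder.frestrictLe (π := fun _ => S) 0) =
          Measure.dirac fun _ => y := by
        unfold traj
        rw [Kernel.traj_map_frestrictLe_apply, Kernel.partialTraj_self, Kernel.id_apply]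
      have := lintegral_map (μ := C.traj y) (f := fun h : Finset.Iic 0 → S =>
        f (fun _ => s, h ⟨0, by simp⟩)) (by fun_prop)
        (Preorder.measurable_frestrictLe (X := fun _ => S) 0)
      rw [hd, lintegral_dirac' _ (by fun_prop)] at this
      exact this.symm
    | succ t =>
      refine lintegral_congr fun y => ?_
      have hg : Measurable fun p : (Finset.Iic t → S) × S =>
          f (fun i : Finset.Iic (t + 1) => if hi : i.1 = 0 then s else
            p.1 ⟨i.1 - 1, Finset.mem_Iic.2 (by have := Finset.mem_Iic.1 i.2; omega)⟩, p.2) := by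
        refine hf.comp (Measurable.prodMk (measurable_pi_iff.2 fun i => ?_) measurable_snd)
        by_cases hi : i.1 = 0
        · simp only [hi, dite_true]; fun_prop
        · simp only [hi, dite_false]; fun_prop
      have e : ∀ ω : ℕ → S, (Preorder.frestrictLe (t + 1) (seqCons s ω) : Finset.Iic (t + 1) → S) =
          fun i : Finset.Iic (t + 1) => if hi : i.1 = 0 then s else
            (Preorder.frestrictLe t ω : Finset.Iic t → S)
              ⟨i.1 - 1, Finset.mem_Iic.2 (by have := Finset.mem_Iic.1 i.2; omega)⟩ := by
        intro ω; ext ⟨i, hi⟩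
        cases i <;> simp
      simp only [e, seqCons_succ]
      exact lintegral_traj_next _ _ t hg

lemma lintegral_traj_cons (s : S) {f : (ℕ → S) → ℝ≥0∞} (hf : Measurable f) :
    ∫⁻ ω, f ω ∂C.traj s = ∫⁻ y, ∫⁻ ω, f (seqCons s ω) ∂C.traj y ∂C.step s := by
  rw [traj_eq_map_compProd, lintegral_map hf (by fun_prop),
    Measure.lintegral_compProd (by fun_prop)]
  rfl

lemma integral_traj_cons (s : S) {f : (ℕ → S) → ℝ} (hf : Measurable f)
    (hi : Integrable f (C.traj s)) :
    ∫ ω, f ω ∂C.traj s = ∫ y, ∫ ω, f (seqCons s ω) ∂C.traj y ∂C.step s := by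
  have hm : Measurable fun p : S × (ℕ → S) => seqCons s p.2 := by fun_prop
  rw [traj_eq_map_compProd, integral_map hm.aemeasurable hf.aestronglyMeasurable,
    Measure.integral_compProd]
  · rfl
  · rw [traj_eq_map_compProd] at hi
    exact (integrable_map_measure hf.aestronglyMeasurable hm.aemeasurable).1 hi

lemma ae_traj_iff (s : S) {p : (ℕ → S) → Prop} (hp : MeasurableSet {ω | p ω}) :
    (∀ᵐ ω ∂C.traj s, p ω) ↔ ∀ᵐ y ∂C.step s, ∀ᵐ ω ∂C.traj y, p (seqCons s ω) := by
  have hm : Measurable fun p : S × (ℕ → S) => seqCons s p.2 := by fun_prop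
  rw [traj_eq_map_compProd, ae_map_iff hm.aemeasurable hp]
  exact Measure.ae_compProd_iff (hm hp)

lemma ae_traj_zero (s : S) {p : S → Prop} (hp : MeasurableSet {x | p x}) (h : p s) :
    ∀ᵐ ω ∂C.traj s, p (ω 0) :=
  (C.ae_traj_iff s (measurable_pi_apply 0 hp)).2 <| by simp [h]

end RewardChain

/-! ### Absorption, absolute rewards and the maximum principle. -/

namespace RewardChain

variable {S : Type u} [MeasurableSpace S] (C : RewardChain S)

lemma ae_terminal_succ (s : S) :
    ∀ᵐ ω ∂C.traj s, ∀ t, ω t ∈ C.terminal → ω (t + 1) ∈ C.terminal := by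
  refine ae_all_iff.2 fun t => ?_
  have hm (t : ℕ) : MeasurableSet {ω : ℕ → S | ω t ∈ C.terminal → ω (t + 1) ∈ C.terminal} :=
    (measurable_pi_apply t C.measurableSet_terminal).imp
      (measurable_pi_apply (t + 1) C.measurableSet_terminal)
  induction t generalizing s with
  | zero =>
    rw [C.ae_traj_iff s (hm 0)]
    by_cases hs : s ∈ C.terminal
    · rw [C.absorbing s hs]
      filter_upwards [(ae_dirac_iff (p := fun y => y ∈ C.terminal) C.measurableSet_terminal).2 hs]
        with y hy
      filter_upwards [C.ae_traj_zero y C.measurableSet_terminal hy] with ω h _ using h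
    · exact Eventually.of_forall fun y => Eventually.of_forall fun ω h => absurd h hs
  | succ t ih =>
    rw [C.ae_traj_iff s (hm _)]
    exact Eventually.of_forall fun y => ih y

lemma ae_terminal_mono (s : S) :
    ∀ᵐ ω ∂C.traj s, ∀ t, ω t ∈ C.terminal → ∀ v, t ≤ v → ω v ∈ C.terminal := by
  filter_upwards [C.ae_terminal_succ s] with ω h t ht v hv
  induction v, hv using Nat.le_induction with
  | base => exact ht
  | succ v _ ih => exact h v ih

lemma ae_terminal_of_mem {s : S} (hs : s ∈ C.terminal) :
    ∀ᵐ ω ∂C.traj s, ∀ t, ω t ∈ C.terminal := by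
  filter_upwards [C.ae_terminal_mono s, C.ae_traj_zero s C.measurableSet_terminal hs] with ω h h0 t
  exact h 0 h0 t (Nat.zero_le t)

/-- The sum of the absolute values of the rewards along a trajectory. -/
def absReward (ω : ℕ → S) : ℝ≥0∞ := ∑' t, ‖C.reward (ω t)‖ₑ

@[fun_prop]
lemma measurable_reward' : Measurable C.reward := C.measurable_reward

@[fun_prop]
lemma measurable_absReward : Measurable C.absReward := by unfold absReward; fun_prop

/-- The expected sum of the absolute values of the rewards. -/
def absValue (s : S) : ℝ≥0∞ := ∫⁻ ω, C.absReward ω ∂C.traj s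

@[fun_prop]
lemma measurable_absValue : Measurable C.absValue :=
  C.measurable_absReward.lintegral_kernel (κ := C.trajKernel)

lemma absReward_seqCons (s : S) (ω : ℕ → S) :
    C.absReward (seqCons s ω) = ‖C.reward s‖ₑ + C.absReward ω := by
  rw [absReward, tsum_eq_zero_add' ENNReal.summable]
  rfl

lemma absValue_eq (s : S) : C.absValue s = ‖C.reward s‖ₑ + ∫⁻ y, C.absValue y ∂C.step s := by
  rw [absValue, C.lintegral_traj_cons s (by fun_prop)]
  simp only [absReward_seqCons]
  have (y : S) : ∫⁻ ω, (‖C.reward s‖ₑ + C.absReward ω) ∂C.traj y =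
      ‖C.reward s‖ₑ + C.absValue y := by
    rw [lintegral_add_left measurable_const]; simp [absValue]
  simp only [this]
  rw [lintegral_add_left measurable_const]; simp

lemma lintegral_traj_eval_zero (s : S) {f : S → ℝ≥0∞} (hf : Measurable f) :
    ∫⁻ ω, f (ω 0) ∂C.traj s = f s := by
  rw [C.lintegral_traj_cons s (by fun_prop)]; simp

lemma lintegral_traj_eval_succ (s : S) {f : S → ℝ≥0∞} (hf : Measurable f) (t : ℕ) :
    ∫⁻ ω, f (ω (t + 1)) ∂C.traj s = ∫⁻ y, ∫⁻ ω, f (ω t) ∂C.traj y ∂C.step s := by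
  rw [C.lintegral_traj_cons s (by fun_prop)]; simp

/-- The Markov property at time `N`. The right side is the expected tail of a series with finite
expectation, so it tends to zero for admissible chains. -/
lemma lintegral_absValue_eval (s : S) (N : ℕ) :
    ∫⁻ ω, C.absValue (ω N) ∂C.traj s =
      ∫⁻ ω, ∑' t, ‖C.reward (ω (t + N))‖ₑ ∂C.traj s := by
  induction N generalizing s with
  | zero => rw [C.lintegral_traj_eval_zero s (by fun_prop)]; rfl
  | succ N ih =>
    rw [C.lintegral_traj_eval_succ s (by fun_prop), C.lintegral_traj_cons s (by fun_prop)]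
    simp only [ih, ← add_assoc, seqCons_succ]

variable {C}

lemma Admissible.absValue_lt_top (hC : C.Admissible) (s : S) : C.absValue s < ∞ := (hC s).2

lemma Admissible.ae_absReward_lt_top (hC : C.Admissible) (s : S) :
    ∀ᵐ ω ∂C.traj s, C.absReward ω < ∞ :=
  ae_lt_top (by fun_prop) (hC.absValue_lt_top s).ne

/-- The maximum principle: a subharmonic function bounded by a multiple of `W + 1` off the terminal
states, `W` being the expected sum of the absolute rewards, vanishes. -/
lemma Admissible.eq_zero_of_le_lintegral (hC : C.Admissible) {f : S → ℝ≥0∞} (hf : Measurable f)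
    {c : ℝ≥0∞} (hc : c ≠ ∞)
    (hle : ∀ s, f s ≤ c * (C.absValue s + C.terminalᶜ.indicator 1 s))
    (hsub : ∀ s, f s ≤ ∫⁻ y, f y ∂C.step s) (s : S) : f s = 0 := by
  -- Iterated subharmonicity. Together with `hle` it bounds `f s` by `c` times the expected tail of
  -- the absolute rewards plus the probability that the chain has not terminated at time `N`; both
  -- vanish as `N → ∞`.
  have h1 (N : ℕ) (s : S) : f s ≤ ∫⁻ ω, f (ω N) ∂C.traj s := by
    induction N generalizing s with
    | zero => rw [C.lintegral_traj_eval_zero s hf]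
    | succ N ih =>
      rw [C.lintegral_traj_eval_succ s hf]
      exact (hsub s).trans (lintegral_mono fun y => ih y)
  obtain ⟨g, hg⟩ : ∃ g : S → ℝ≥0∞, g = C.terminalᶜ.indicator 1 := ⟨_, rfl⟩
  have hind : Measurable g := hg ▸ measurable_one.indicator C.measurableSet_terminal.compl
  rw [← hg] at hle
  have m2 (N : ℕ) : Measurable fun ω : ℕ → S => g (ω N) := hind.comp (measurable_pi_apply N)
  have m3 (N : ℕ) : Measurable fun ω : ℕ → S => ∑' t, ‖C.reward (ω (t + N))‖ₑ := by fun_prop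
  have h2 (N : ℕ) : f s ≤ c * ∫⁻ ω, (∑' t, ‖C.reward (ω (t + N))‖ₑ) + g (ω N) ∂C.traj s := by
    have e0 : ∫⁻ ω, f (ω N) ∂C.traj s ≤ ∫⁻ ω, c * (C.absValue (ω N) + g (ω N)) ∂C.traj s :=
      lintegral_mono fun ω => hle (ω N)
    refine (h1 N s).trans (e0.trans (le_of_eq ?_))
    have m1 : Measurable fun ω : ℕ → S => C.absValue (ω N) := by fun_prop
    have e1 : ∫⁻ ω, c * (C.absValue (ω N) + g (ω N)) ∂C.traj s =
        c * ∫⁻ ω, (C.absValue (ω N) + g (ω N)) ∂C.traj s := lintegral_const_mul c (m1.add (m2 N))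
    have e2 : ∫⁻ ω, (C.absValue (ω N) + g (ω N)) ∂C.traj s =
        ∫⁻ ω, C.absValue (ω N) ∂C.traj s + ∫⁻ ω, g (ω N) ∂C.traj s := lintegral_add_left m1 _
    rw [e1, e2, lintegral_absValue_eval, lintegral_add_left (m3 N)]
  have h3 : Tendsto (fun N => ∫⁻ ω, (∑' t, ‖C.reward (ω (t + N))‖ₑ) + g (ω N) ∂C.traj s) atTop
      (𝓝 (∫⁻ ω, 0 ∂C.traj s)) := by
    refine tendsto_lintegral_of_dominated_convergence (fun ω => C.absReward ω + 1)
      (fun N => (m3 N).add (m2 N)) (fun N => ?_) ?_ ?_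
    · refine Eventually.of_forall fun ω => add_le_add ?_ ?_
      · exact ENNReal.tsum_comp_le_tsum_of_injective (add_left_injective N) _
      · rw [hg]; exact Set.indicator_le_self' (fun _ _ => zero_le_one) _
    · rw [lintegral_add_right _ measurable_const]
      simpa [absValue] using (hC.absValue_lt_top s).ne
    · filter_upwards [hC.ae_absReward_lt_top s, (hC s).1, C.ae_terminal_mono s] with ω hω ⟨T, hT⟩ hm
      have := (ENNReal.tendsto_sum_nat_add (fun t => ‖C.reward (ω t)‖ₑ) hω.ne).add
        (tendsto_const_nhds (x := (0 : ℝ≥0∞)))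
      rw [add_zero] at this
      refine this.congr' ?_
      filter_upwards [eventually_ge_atTop T] with N hN
      simp [hg, hm T hT N hN]
  have h4 := ENNReal.Tendsto.const_mul h3 (Or.inr hc)
  simp only [lintegral_zero, mul_zero] at h4
  exact le_antisymm (ge_of_tendsto' h4 h2) (zero_le)

end RewardChain

/-! ### The local problem with a fixed stopping set. -/

namespace RewardChain

variable {S : Type u} [MeasurableSpace S] (C : RewardChain S)

/-- The expected sum of the absolute values of the rewards, as a real number. -/
def bound (s : S) : ℝ := (C.absValue s).toReal

lemma bound_nonneg (s : S) : 0 ≤ C.bound s := ENNReal.toReal_nonneg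

lemma summable_reward {ω : ℕ → S} (h : C.absReward ω < ∞) : Summable fun t => C.reward (ω t) :=
  .of_enorm h.ne

lemma sum_abs_le_absReward {ω : ℕ → S} (h : C.absReward ω < ∞) {f : ℕ → ℝ}
    (hf : ∀ t, |f t| ≤ |C.reward (ω t)|) : |∑' t, f t| ≤ (C.absReward ω).toReal := by
  have h1 : ∑' t, ‖f t‖ₑ ≤ C.absReward ω :=
    ENNReal.tsum_le_tsum fun t => enorm_le_iff_norm_le.2 (by simpa using hf t)
  have h2 : ‖∑' t, f t‖ₑ ≤ C.absReward ω := enorm_tsum_le_tsum_enorm.trans h1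
  rw [← Real.norm_eq_abs, ← toReal_enorm]
  exact ENNReal.toReal_mono h.ne h2

variable {C}

lemma Admissible.ofReal_bound (hC : C.Admissible) (s : S) :
    ENNReal.ofReal (C.bound s) = C.absValue s :=
  ENNReal.ofReal_toReal (hC.absValue_lt_top s).ne

lemma Admissible.lintegral_absValue_lt_top (hC : C.Admissible) (s : S) :
    ∫⁻ y, C.absValue y ∂C.step s < ∞ :=
  lt_of_le_of_lt (le_trans le_add_self (C.absValue_eq s).ge) (hC.absValue_lt_top s)

lemma Admissible.integrable_bound (hC : C.Admissible) (s : S) :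
    Integrable C.bound (C.step s) :=
  integrable_toReal_of_lintegral_ne_top (by fun_prop) (hC.lintegral_absValue_lt_top s).ne

lemma Admissible.bound_eq (hC : C.Admissible) (s : S) :
    C.bound s = |C.reward s| + ∫ y, C.bound y ∂C.step s := by
  unfold bound
  rw [C.absValue_eq, ENNReal.toReal_add (by simp) (hC.lintegral_absValue_lt_top s).ne,
    integral_toReal (by fun_prop) (Eventually.of_forall hC.absValue_lt_top)]
  simp

lemma Admissible.integrable_absReward (hC : C.Admissible) (s : S) :
    Integrable (fun ω => (C.absReward ω).toReal) (C.traj s) :=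
  integrable_toReal_of_lintegral_ne_top (by fun_prop) (hC.absValue_lt_top s).ne

lemma Admissible.integral_absReward (hC : C.Admissible) (s : S) :
    ∫ ω, (C.absReward ω).toReal ∂C.traj s = C.bound s :=
  integral_toReal (by fun_prop) (hC.ae_absReward_lt_top s)

variable (C)

section LocalReturn

variable (α : ℝ) {B : Set S} (hB : MeasurableSet B)

lemma measurableSet_avoid (hB : MeasurableSet B) (t : ℕ) :
    MeasurableSet {ω : ℕ → S | ∀ v ≤ t, ω v ∉ B} := by
  simp only [Set.ofPred_forall]
  exact .iInter fun v => .iInter fun _ => (measurable_pi_apply v hB).compl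

lemma measurableSet_stopped (hB : MeasurableSet B) :
    MeasurableSet {ω : ℕ → S | ∃ t, ω t ∈ B ∧ ∀ v ≤ t, ω v ∉ C.terminal} := by
  simp only [Set.ofPred_exists]
  exact .iUnion fun t => (measurable_pi_apply t hB).inter
    (measurableSet_avoid C.measurableSet_terminal t)

include hB in
@[fun_prop]
lemma measurable_localReturn : Measurable (C.localReturn α B) := by
  unfold localReturn
  refine Measurable.add (Measurable.tsum fun t => ?_) ?_
  · exact Measurable.ite (measurableSet_avoid hB t) (by fun_prop) measurable_const
  · exact Measurable.ite (C.measurableSet_stopped hB) measurable_const measurable_const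

lemma abs_localReturn_le {ω : ℕ → S} (h : C.absReward ω < ∞) :
    |C.localReturn α B ω| ≤ (C.absReward ω).toReal + |α| := by
  unfold localReturn
  refine (abs_add_le _ _).trans (add_le_add (C.sum_abs_le_absReward h fun t => ?_) ?_)
  · split_ifs <;> simp
  · split_ifs <;> simp

lemma localReturn_seqCons_of_mem {s : S} (hs : s ∉ C.terminal) (hsB : s ∈ B) (ω : ℕ → S) :
    C.localReturn α B (seqCons s ω) = α := by
  unfold localReturn
  have h1 : ∀ t, ¬ ∀ v ≤ t, seqCons s ω v ∉ B := fun t h => h 0 (Nat.zero_le t) hsB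
  rw [if_pos ⟨0, hsB, fun v hv => by simpa [Nat.le_zero.1 hv] using hs⟩]
  simp [h1]

lemma localReturn_seqCons_of_notMem {s : S} (hs : s ∉ C.terminal) (hsB : s ∉ B) {ω : ℕ → S}
    (h : C.absReward ω < ∞) :
    C.localReturn α B (seqCons s ω) = C.reward s + C.localReturn α B ω := by
  classical
  have h1 (t : ℕ) : (∀ v ≤ t + 1, seqCons s ω v ∉ B) ↔ ∀ v ≤ t, ω v ∉ B :=
    ⟨fun h v hv => h (v + 1) (by omega), fun h v hv => by
      cases v with
      | zero => exact hsB
      | succ v => exact h v (by omega)⟩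
  have h2 (t : ℕ) : (∀ v ≤ t + 1, seqCons s ω v ∉ C.terminal) ↔ ∀ v ≤ t, ω v ∉ C.terminal :=
    ⟨fun h v hv => h (v + 1) (by omega), fun h v hv => by
      cases v with
      | zero => exact hs
      | succ v => exact h v (by omega)⟩
  have h3 : (∃ t, seqCons s ω t ∈ B ∧ ∀ v ≤ t, seqCons s ω v ∉ C.terminal) ↔
      ∃ t, ω t ∈ B ∧ ∀ v ≤ t, ω v ∉ C.terminal := by
    constructor
    · rintro ⟨t, ht, h⟩
      cases t with
      | zero => exact absurd ht hsB
      | succ t => exact ⟨t, ht, (h2 t).1 h⟩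
    · rintro ⟨t, ht, h⟩
      exact ⟨t + 1, ht, (h2 t).2 h⟩
  unfold localReturn
  rw [tsum_eq_zero_add']
  · have h0 : ∀ v ≤ 0, seqCons s ω v ∉ B := fun v hv => by simpa [Nat.le_zero.1 hv] using hsB
    simp only [h1, h3, if_pos h0, seqCons_zero, seqCons_succ, add_assoc]
  · simp only [h1, seqCons_succ]
    refine .of_enorm (ne_top_of_le_ne_top h.ne (ENNReal.tsum_le_tsum fun t => ?_))
    split_ifs <;> simp

lemma localReturn_of_terminal {ω : ℕ → S} (h : ∀ t, ω t ∈ C.terminal) :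
    C.localReturn α B ω = 0 := by
  unfold localReturn
  have h1 (t : ℕ) : C.reward (ω t) = 0 := C.reward_terminal _ (h t)
  rw [if_neg]
  · simp [h1]
  · rintro ⟨t, -, ht⟩
    exact ht t le_rfl (h t)

end LocalReturn

/-- The value of the stopping set `B` in the local problem. -/
def stopValue (α : ℝ) (B : Set S) (s : S) : ℝ := ∫ ω, C.localReturn α B ω ∂C.traj s

lemma measurable_stopValue (α : ℝ) {B : Set S} (hB : MeasurableSet B) :
    Measurable (C.stopValue α B) :=
  (StronglyMeasurable.integral_kernel (κ := C.trajKernel)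
    (C.measurable_localReturn α hB).stronglyMeasurable).measurable

variable {C}

section StopValue

variable (hC : C.Admissible) (α : ℝ) {B : Set S} (hB : MeasurableSet B)
include hC hB

lemma Admissible.integrable_localReturn (s : S) :
    Integrable (C.localReturn α B) (C.traj s) := by
  refine ((hC.integrable_absReward s).add (integrable_const |α|)).mono'
    (C.measurable_localReturn α hB).aestronglyMeasurable ?_
  filter_upwards [hC.ae_absReward_lt_top s] with ω hω
  exact C.abs_localReturn_le α hω

lemma Admissible.abs_stopValue_le (s : S) : |C.stopValue α B s| ≤ C.bound s + |α| := by
  refine (norm_integral_le_integral_norm (C.localReturn α B)).trans ?_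
  have : ∫ ω, ((C.absReward ω).toReal + |α|) ∂C.traj s = C.bound s + |α| := by
    rw [integral_add (hC.integrable_absReward s) (integrable_const _), hC.integral_absReward]
    simp
  rw [← this]
  refine integral_mono_ae (hC.integrable_localReturn α hB s).norm
    ((hC.integrable_absReward s).add (integrable_const |α|)) ?_
  filter_upwards [hC.ae_absReward_lt_top s] with ω hω
  exact C.abs_localReturn_le α hω

lemma Admissible.integrable_stopValue (s : S) : Integrable (C.stopValue α B) (C.step s) :=
  ((hC.integrable_bound s).add (integrable_const |α|)).mono'
    (C.measurable_stopValue α hB).aestronglyMeasurable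
    (Eventually.of_forall fun y => hC.abs_stopValue_le α hB y)

omit hC hB in
lemma stopValue_of_terminal {s : S} (hs : s ∈ C.terminal) : C.stopValue α B s = 0 := by
  refine integral_eq_zero_of_ae ?_
  filter_upwards [C.ae_terminal_of_mem hs] with ω h using C.localReturn_of_terminal α h

lemma Admissible.stopValue_of_mem {s : S} (hs : s ∉ C.terminal) (hsB : s ∈ B) :
    C.stopValue α B s = α := by
  rw [stopValue, C.integral_traj_cons s (C.measurable_localReturn α hB)
    (hC.integrable_localReturn α hB s)]
  simp [C.localReturn_seqCons_of_mem α hs hsB]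

/-- With `stopValue_of_mem` this is the linear counterpart of the Bellman equation; the two are
compared by the maximum principle. -/
lemma Admissible.stopValue_of_notMem {s : S} (hs : s ∉ C.terminal) (hsB : s ∉ B) :
    C.stopValue α B s = C.reward s + ∫ y, C.stopValue α B y ∂C.step s := by
  rw [stopValue, C.integral_traj_cons s (C.measurable_localReturn α hB)
    (hC.integrable_localReturn α hB s)]
  have (y : S) : ∫ ω, C.localReturn α B (seqCons s ω) ∂C.traj y =
      C.reward s + C.stopValue α B y := by
    have h1 : ∫ ω, C.localReturn α B (seqCons s ω) ∂C.traj y =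
        ∫ ω, (C.reward s + C.localReturn α B ω) ∂C.traj y := by
      refine integral_congr_ae ?_
      filter_upwards [hC.ae_absReward_lt_top y] with ω hω
      exact C.localReturn_seqCons_of_notMem α hs hsB hω
    rw [h1, integral_add (integrable_const _) (hC.integrable_localReturn α hB y)]
    simp [stopValue]
  simp only [this]
  rw [integral_add (integrable_const _) (hC.integrable_stopValue α hB s)]
  simp

end StopValue

end RewardChain

/-! ### Value iteration, the Bellman equation and the optimal stopping set. -/

namespace RewardChain

variable {S : Type u} [MeasurableSpace S] (C : RewardChain S)

open Classical in
/-- The optimal value in the local problem when one has to stop within the given number of steps. -/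
def valueIter (α : ℝ) : ℕ → S → ℝ
  | 0 => fun s => if s ∈ C.terminal then 0 else α
  | N + 1 => fun s =>
      if s ∈ C.terminal then 0 else max α (C.reward s + ∫ y, valueIter α N y ∂C.step s)

lemma measurable_valueIter (α : ℝ) (N : ℕ) : Measurable (C.valueIter α N) := by
  cases N with
  | zero => exact Measurable.ite C.measurableSet_terminal measurable_const measurable_const
  | succ N =>
    refine Measurable.ite C.measurableSet_terminal measurable_const
      (measurable_const.max (C.measurable_reward.add ?_))
    exact (StronglyMeasurable.integral_kernel (κ := C.step)
      (measurable_valueIter α N).stronglyMeasurable).measurable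

lemma valueIter_of_terminal (α : ℝ) (N : ℕ) {s : S} (hs : s ∈ C.terminal) :
    C.valueIter α N s = 0 := by
  cases N <;> simp [valueIter, hs]

variable {C}

section

variable (hC : C.Admissible) (α : ℝ)
include hC

lemma Admissible.abs_valueIter_le (N : ℕ) (s : S) :
    |C.valueIter α N s| ≤ C.bound s + |α| := by
  induction N generalizing s with
  | zero =>
    have := C.bound_nonneg s
    unfold valueIter
    split_ifs
    · simp; positivity
    · linarith
  | succ N ih =>
    have h0 := C.bound_nonneg s
    unfold valueIter
    split_ifs with hs
    · simp; positivity
    · refine abs_max_le_max_abs_abs.trans (max_le (by linarith) ?_)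
      have hint : Integrable (fun y => C.bound y + |α|) (C.step s) :=
        (hC.integrable_bound s).add (integrable_const _)
      have h1 : |∫ y, C.valueIter α N y ∂C.step s| ≤ ∫ y, (C.bound y + |α|) ∂C.step s :=
        (norm_integral_le_integral_norm (C.valueIter α N)).trans
          (integral_mono_of_nonneg (Eventually.of_forall fun y => norm_nonneg _) hint
            (Eventually.of_forall fun y => ih y))
      rw [integral_add (hC.integrable_bound s) (integrable_const _)] at h1
      simp only [integral_const, probReal_univ, smul_eq_mul, one_mul] at h1
      rw [hC.bound_eq s]
      linarith [abs_add_le (C.reward s) (∫ y, C.valueIter α N y ∂C.step s)]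

lemma Admissible.integrable_of_abs_le {f : S → ℝ} (hf : Measurable f)
    (h : ∀ y, |f y| ≤ C.bound y + |α|) (s : S) : Integrable f (C.step s) :=
  ((hC.integrable_bound s).add (integrable_const |α|)).mono'
    hf.aestronglyMeasurable (Eventually.of_forall fun y => h y)

lemma Admissible.valueIter_mono (s : S) : Monotone fun N => C.valueIter α N s := by
  refine monotone_nat_of_le_succ fun N => ?_
  induction N generalizing s with
  | zero =>
    simp only [valueIter]
    split_ifs
    · rfl
    · exact le_max_left _ _
  | succ N ih =>
    rw [valueIter, valueIter]
    dsimp only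
    split_ifs
    · rfl
    · refine max_le_max le_rfl (by
        gcongr
        · exact hC.integrable_of_abs_le α (C.measurable_valueIter α _) (hC.abs_valueIter_le α _) s
        · exact hC.integrable_of_abs_le α (C.measurable_valueIter α _) (hC.abs_valueIter_le α _) s
        · exact fun y => ih y)

/-- The limit of the value iteration. -/
def _root_.RewardChain.iterLimit (C : RewardChain S) (α : ℝ) (s : S) : ℝ := ⨆ N, C.valueIter α N s

lemma Admissible.tendsto_valueIter (s : S) :
    Tendsto (fun N => C.valueIter α N s) atTop (𝓝 (C.iterLimit α s)) :=
  tendsto_atTop_ciSup (hC.valueIter_mono α s)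
    ⟨C.bound s + |α|, by rintro _ ⟨N, rfl⟩; exact (le_abs_self _).trans (hC.abs_valueIter_le α N s)⟩

lemma Admissible.measurable_iterLimit : Measurable (C.iterLimit α) :=
  measurable_of_tendsto_metrizable (C.measurable_valueIter α)
    (tendsto_pi_nhds.2 (hC.tendsto_valueIter α))

lemma Admissible.abs_iterLimit_le (s : S) : |C.iterLimit α s| ≤ C.bound s + |α| :=
  le_of_tendsto' (hC.tendsto_valueIter α s).abs fun N => hC.abs_valueIter_le α N s

omit hC in
lemma iterLimit_of_terminal {s : S} (hs : s ∈ C.terminal) : C.iterLimit α s = 0 := by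
  simp [iterLimit, C.valueIter_of_terminal α _ hs]

/-- The Bellman equation. -/
lemma Admissible.iterLimit_eq {s : S} (hs : s ∉ C.terminal) :
    C.iterLimit α s = max α (C.reward s + ∫ y, C.iterLimit α y ∂C.step s) := by
  have h1 := (tendsto_add_atTop_iff_nat 1).2 (hC.tendsto_valueIter α s)
  refine tendsto_nhds_unique h1 ?_
  have h2 : Tendsto (fun N => ∫ y, C.valueIter α N y ∂C.step s) atTop
      (𝓝 (∫ y, C.iterLimit α y ∂C.step s)) :=
    tendsto_integral_of_dominated_convergence (fun y => C.bound y + |α|)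
      (fun N => (C.measurable_valueIter α N).aestronglyMeasurable)
      ((hC.integrable_bound s).add (integrable_const |α|))
      (fun N => Eventually.of_forall fun y => hC.abs_valueIter_le α N y)
      (Eventually.of_forall fun y => hC.tendsto_valueIter α y)
  refine (tendsto_const_nhds.max (tendsto_const_nhds.add h2)).congr fun N => ?_
  simp [valueIter, hs]

omit α in
/-- A real version of the maximum principle. -/
lemma Admissible.nonpos_of_le_integral {f : S → ℝ} (hf : Measurable f) {c : ℝ}
    (hc : 0 ≤ c) (hb : ∀ s, |f s| ≤ c * (C.bound s + 1)) (h0 : ∀ s ∈ C.terminal, f s ≤ 0)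
    (hsub : ∀ s, s ∉ C.terminal → 0 < f s → f s ≤ ∫ y, f y ∂C.step s) (s : S) : f s ≤ 0 := by
  -- Applied to the positive part of `f`, for which subharmonicity is trivial wherever `f ≤ 0`.
  have key := hC.eq_zero_of_le_lintegral (f := fun s => ENNReal.ofReal (f s)) (by fun_prop)
    (c := ENNReal.ofReal c) (by simp) (fun s => ?_) (fun s => ?_) s
  · exact ENNReal.ofReal_eq_zero.1 key
  · by_cases hs : s ∈ C.terminal
    · simp [ENNReal.ofReal_of_nonpos (h0 s hs)]
    · rw [← hC.ofReal_bound, Set.indicator_of_mem hs, Pi.one_apply, ← ENNReal.ofReal_one,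
        ← ENNReal.ofReal_add (C.bound_nonneg s) zero_le_one, ← ENNReal.ofReal_mul hc]
      exact ENNReal.ofReal_le_ofReal ((le_abs_self _).trans (hb s))
  · by_cases hs : s ∈ C.terminal
    · simp [ENNReal.ofReal_of_nonpos (h0 s hs)]
    · rcases le_or_gt (f s) 0 with h | h
      · simp [ENNReal.ofReal_of_nonpos h]
      · have hi : Integrable f (C.step s) :=
          (((hC.integrable_bound s).add (integrable_const 1)).const_mul c).mono'
            hf.aestronglyMeasurable (Eventually.of_forall hb)
        refine (ENNReal.ofReal_le_ofReal (hsub s hs h)).trans ?_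
        have h2 : ∫ y, f y ∂C.step s ≤ ∫ y, max (f y) 0 ∂C.step s :=
          integral_mono hi hi.pos_part fun y => le_max_left _ _
        refine (ENNReal.ofReal_le_ofReal h2).trans ?_
        rw [ofReal_integral_eq_lintegral_ofReal hi.pos_part
          (Eventually.of_forall fun y => le_max_right _ _)]
        simp

omit hC in
lemma abs_sub_le_of_abs_le {f g : S → ℝ} (hf : ∀ s, |f s| ≤ C.bound s + |α|)
    (hg : ∀ s, |g s| ≤ C.bound s + |α|) (s : S) :
    |f s - g s| ≤ (2 * (1 + |α|)) * (C.bound s + 1) := by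
  have h0 := C.bound_nonneg s
  have h1 := abs_nonneg α
  have h2 : |f s - g s| ≤ |f s| + |g s| := abs_sub _ _
  nlinarith [hf s, hg s, mul_nonneg h0 h1]

/-- Verification argument: the difference cannot be positive on `B`, since there the left side is
`α`. Off `B` the Bellman equation makes it subharmonic. -/
lemma Admissible.stopValue_le_iterLimit {B : Set S} (hB : MeasurableSet B) (s : S) :
    C.stopValue α B s ≤ C.iterLimit α s := by
  refine sub_nonpos.1 (hC.nonpos_of_le_integral
    (f := fun s => C.stopValue α B s - C.iterLimit α s)
    ((C.measurable_stopValue α hB).sub (hC.measurable_iterLimit α)) (c := 2 * (1 + |α|))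
    (by positivity)
    (abs_sub_le_of_abs_le α (hC.abs_stopValue_le α hB) (hC.abs_iterLimit_le α))
    (fun s hs => by rw [stopValue_of_terminal α hs, iterLimit_of_terminal α hs]; simp)
    (fun s hs hpos => ?_) s)
  have hle := hC.iterLimit_eq α hs
  by_cases hsB : s ∈ B
  · have h1 := hC.stopValue_of_mem α hB hs hsB
    have h2 := le_max_left α (C.reward s + ∫ y, C.iterLimit α y ∂C.step s)
    linarith
  · rw [integral_sub (hC.integrable_stopValue α hB s)
      (hC.integrable_of_abs_le α (hC.measurable_iterLimit α) (hC.abs_iterLimit_le α) s)]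
    have h1 := hC.stopValue_of_notMem α hB hs hsB
    have h2 := le_max_right α (C.reward s + ∫ y, C.iterLimit α y ∂C.step s)
    linarith

/-- The converse comparison: off this stopping set the maximum in the Bellman equation is attained
by continuing, so the difference is again subharmonic where it is positive. -/
lemma Admissible.iterLimit_le_stopValue (s : S) :
    C.iterLimit α s ≤ C.stopValue α {x | C.iterLimit α x ≤ α} s := by
  have hB : MeasurableSet {x | C.iterLimit α x ≤ α} :=
    measurableSet_le (hC.measurable_iterLimit α) measurable_const
  refine sub_nonpos.1 (hC.nonpos_of_le_integral
    (f := fun s => C.iterLimit α s - C.stopValue α {x | C.iterLimit α x ≤ α} s)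
    ((hC.measurable_iterLimit α).sub (C.measurable_stopValue α hB)) (c := 2 * (1 + |α|))
    (by positivity)
    (abs_sub_le_of_abs_le α (hC.abs_iterLimit_le α) (hC.abs_stopValue_le α hB))
    (fun s hs => by rw [stopValue_of_terminal α hs, iterLimit_of_terminal α hs]; simp)
    (fun s hs hpos => ?_) s)
  have hle := hC.iterLimit_eq α hs
  by_cases hsB : C.iterLimit α s ≤ α
  · have h1 := hC.stopValue_of_mem α hB hs hsB
    linarith
  · rw [integral_sub
      (hC.integrable_of_abs_le α (hC.measurable_iterLimit α) (hC.abs_iterLimit_le α) s)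
      (hC.integrable_stopValue α hB s)]
    have h1 := hC.stopValue_of_notMem α hB hs hsB
    rcases max_choice α (C.reward s + ∫ y, C.iterLimit α y ∂C.step s) with h | h
    · rw [h] at hle; exact absurd hle.le hsB
    · linarith

lemma Admissible.bddAbove_stopValue (s : S) :
    BddAbove (Set.range fun B : {B : Set S // MeasurableSet B} => C.stopValue α B s) :=
  ⟨C.iterLimit α s, by rintro _ ⟨B, rfl⟩; exact hC.stopValue_le_iterLimit α B.2 s⟩

/-- Replaces a supremum over all measurable stopping sets by a limit of measurable functions, which
makes the value measurable in `s`, and shows that `{V ≤ α}` is optimal from all states at once. -/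
lemma Admissible.localValue_eq_iterLimit (s : S) : C.localValue s α = C.iterLimit α s := by
  have : Nonempty {B : Set S // MeasurableSet B} := ⟨⟨∅, MeasurableSet.empty⟩⟩
  refine le_antisymm (ciSup_le fun B => hC.stopValue_le_iterLimit α B.2 s) ?_
  refine (hC.iterLimit_le_stopValue α s).trans (le_ciSup (hC.bddAbove_stopValue α s)
    ⟨{x | C.iterLimit α x ≤ α}, measurableSet_le (hC.measurable_iterLimit α) measurable_const⟩)

lemma Admissible.stopValue_le_localValue {B : Set S} (hB : MeasurableSet B) (s : S) :
    C.stopValue α B s ≤ C.localValue s α :=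
  hC.localValue_eq_iterLimit α s ▸ hC.stopValue_le_iterLimit α hB s

lemma Admissible.localValue_eq_stopValue (s : S) :
    C.localValue s α = C.stopValue α {x | C.localValue x α ≤ α} s := by
  refine le_antisymm ?_ (hC.stopValue_le_localValue α ?_ s) <;>
    simp only [hC.localValue_eq_iterLimit]
  · exact hC.iterLimit_le_stopValue α s
  · exact measurableSet_le (hC.measurable_iterLimit α) measurable_const

lemma Admissible.measurable_localValue : Measurable fun s => C.localValue s α := by
  simp only [hC.localValue_eq_iterLimit]
  exact hC.measurable_iterLimit α

end

end RewardChain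

/-! ### A convex function is determined up to a constant by its subgradients. -/

/-- Two functions with a common monotone selection of subgradients differ by a constant. -/
lemma sub_eq_sub_of_subgradient {V W F : ℝ → ℝ} {a b : ℝ} (hab : a ≤ b)
    (hV : ∀ x ∈ Set.Icc a b, ∀ y ∈ Set.Icc a b, V x + (y - x) * F x ≤ V y)
    (hW : ∀ x ∈ Set.Icc a b, ∀ y ∈ Set.Icc a b, W x + (y - x) * F x ≤ W y) :
    V b - V a = W b - W a := by
  -- Cut `[a, b]` into `N` equal pieces. On each of them the increments of `V` and `W` both lie
  -- between the length times the two endpoint values of `F`; the errors telescope.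
  have key (N : ℕ) (hN : 0 < N) :
      |(V b - W b) - (V a - W a)| ≤ (b - a) * (F b - F a) / N := by
    have hN' : (0 : ℝ) < N := by exact_mod_cast hN
    set x : ℕ → ℝ := fun j => a + j * ((b - a) / N) with hx
    have hd : 0 ≤ (b - a) / N := div_nonneg (sub_nonneg.2 hab) hN'.le
    have hxN : x N = b := by simp only [hx]; field_simp; ring
    have hx0 : x 0 = a := by simp [hx]
    have hstep (j : ℕ) : x (j + 1) - x j = (b - a) / N := by simp only [hx]; push_cast; ring
    have hmem (j : ℕ) (hj : j ≤ N) : x j ∈ Set.Icc a b := by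
      refine ⟨by simp only [hx]; nlinarith [(Nat.cast_nonneg j : (0 : ℝ) ≤ j)], ?_⟩
      rw [← hxN]
      have : (j : ℝ) ≤ N := by exact_mod_cast hj
      simp only [hx]
      nlinarith
    have hj (j : ℕ) (hj : j < N) :
        |(V (x (j + 1)) - W (x (j + 1))) - (V (x j) - W (x j))| ≤
          (b - a) / N * (F (x (j + 1)) - F (x j)) := by
      have m1 := hmem j hj.le
      have m2 := hmem (j + 1) hj
      have e := hstep j
      have e' : x j - x (j + 1) = -((b - a) / N) := by linarith
      have h1 := hV _ m1 _ m2
      have h2 := hV _ m2 _ m1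
      have h3 := hW _ m1 _ m2
      have h4 := hW _ m2 _ m1
      rw [e] at h1 h3
      rw [e'] at h2 h4
      rw [abs_le]
      constructor <;> nlinarith
    have h1 := Finset.sum_range_sub (fun j => V (x j) - W (x j)) N
    have h2 := Finset.sum_range_sub (fun j => F (x j)) N
    simp only [hxN, hx0] at h1 h2
    rw [← h1]
    refine (Finset.abs_sum_le_sum_abs _ _).trans ((Finset.sum_le_sum fun j h =>
      hj j (Finset.mem_range.1 h)).trans (le_of_eq ?_))
    rw [← Finset.mul_sum, h2]
    ring
  have hlim : Tendsto (fun N : ℕ => (b - a) * (F b - F a) / (N : ℝ)) atTop (𝓝 0) :=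
    tendsto_const_div_atTop_nhds_zero_nat _
  have h0 := ge_of_tendsto hlim ((eventually_gt_atTop 0).mono key)
  have := abs_nonpos_iff.1 h0
  linarith

/-! ### Convexity of the local value in the alternative, the Gittins index and the law of the
surrogate value. -/

namespace RewardChain

variable {S : Type u} [MeasurableSpace S] {C : RewardChain S}

section LocalValue

lemma localReturn_sub (α β : ℝ) (B : Set S) (ω : ℕ → S) :
    C.localReturn β B ω = C.localReturn α B ω +
      {ω : ℕ → S | ∃ t, ω t ∈ B ∧ ∀ v ≤ t, ω v ∉ C.terminal}.indicator (fun _ => β - α) ω := by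
  classical
  unfold localReturn
  by_cases h : ∃ t, ω t ∈ B ∧ ∀ v ≤ t, ω v ∉ C.terminal
  · rw [Set.indicator_of_mem (by exact h), if_pos h, if_pos h]; ring
  · rw [Set.indicator_of_notMem (by exact h), if_neg h, if_neg h]; ring

variable (hC : C.Admissible)
include hC

/-- For a fixed stopping set the value is affine in the alternative, so the optimal value is a
supremum of affine functions. -/
lemma Admissible.stopValue_eq_add (α β : ℝ) {B : Set S} (hB : MeasurableSet B) (s : S) :
    C.stopValue β B s = C.stopValue α B s + (β - α) *
      (C.traj s).real {ω : ℕ → S | ∃ t, ω t ∈ B ∧ ∀ v ≤ t, ω v ∉ C.terminal} := by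
  have hm := C.measurableSet_stopped hB
  have e : C.localReturn β B = fun ω => C.localReturn α B ω +
      {ω : ℕ → S | ∃ t, ω t ∈ B ∧ ∀ v ≤ t, ω v ∉ C.terminal}.indicator (fun _ => β - α) ω :=
    funext fun ω => localReturn_sub α β B ω
  rw [stopValue, e, integral_add (hC.integrable_localReturn α hB s)
    ((integrable_const _).indicator hm), integral_indicator_const _ hm, stopValue, smul_eq_mul,
    mul_comm]

/-- The stopping set that is optimal for `α` is still available for `β`; the slope of its affine
function is a subgradient at `α`. -/
lemma Admissible.localValue_subgradient (α β : ℝ) (s : S) :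
    C.localValue s α + (β - α) * (C.traj s).real
      {ω | ∃ t, C.localValue (ω t) α ≤ α ∧ ∀ v ≤ t, ω v ∉ C.terminal} ≤ C.localValue s β := by
  have hB : MeasurableSet {x | C.localValue x α ≤ α} :=
    measurableSet_le (hC.measurable_localValue α) measurable_const
  have h1 := hC.stopValue_le_localValue β hB s
  rwa [hC.stopValue_eq_add α β hB, ← hC.localValue_eq_stopValue] at h1

lemma Admissible.localValue_mono (s : S) : Monotone (C.localValue s) := fun a b hab => by
  have := hC.localValue_subgradient a b s
  have h2 : 0 ≤ (b - a) * (C.traj s).real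
    {ω | ∃ t, C.localValue (ω t) a ≤ a ∧ ∀ v ≤ t, ω v ∉ C.terminal} :=
    mul_nonneg (sub_nonneg.2 hab) measureReal_nonneg
  linarith

/-- The subgradients are probabilities, hence at most one. Consequently `V(s; g) - g` is antitone in
`g`. -/
lemma Admissible.localValue_le_add {a b : ℝ} (hab : a ≤ b) (s : S) :
    C.localValue s b ≤ C.localValue s a + (b - a) := by
  have h1 := hC.localValue_subgradient b a s
  have h2 : (C.traj s).real
    {ω | ∃ t, C.localValue (ω t) b ≤ b ∧ ∀ v ≤ t, ω v ∉ C.terminal} ≤ 1 := measureReal_le_one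
  nlinarith

/-- As `V(s; g) - g` is antitone, the set that defines the index is closed downwards. It has no
greatest element: if it contains `α`, then by monotonicity of `V` it contains the midpoint of `α`
and `V(s; α)`. So no strictness is lost at the supremum. -/
lemma Admissible.gittins_le_iff (s : S) (α : ℝ) :
    C.gittins s ≤ α ↔ C.localValue s α ≤ α := by
  constructor
  · intro h
    by_contra! hlt
    have h1 : (α + C.localValue s α) / 2 < C.localValue s ((α + C.localValue s α) / 2) := by
      have := hC.localValue_mono s (show α ≤ (α + C.localValue s α) / 2 by linarith)
      linarith
    have h2 : (((α + C.localValue s α) / 2 : ℝ) : EReal) ≤ C.gittins s :=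
      le_sSup ⟨_, h1, rfl⟩
    have := EReal.coe_le_coe_iff.1 (h2.trans h)
    linarith
  · intro h
    refine sSup_le ?_
    rintro _ ⟨g, hg, rfl⟩
    refine EReal.coe_le_coe_iff.2 ?_
    by_contra! hlt
    have := hC.localValue_le_add hlt.le s
    have hg' : g < C.localValue s g := hg
    linarith

lemma Admissible.measurable_gittins : Measurable C.gittins := by
  have hr (α : ℝ) : MeasurableSet {s | C.gittins s ≤ α} := by
    simp only [hC.gittins_le_iff]
    exact measurableSet_le (hC.measurable_localValue α) measurable_const
  refine measurable_of_Iic fun a => ?_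
  induction a with
  | bot =>
    have : C.gittins ⁻¹' Set.Iic ⊥ = ⋂ N : ℕ, {s | C.gittins s ≤ ((-(N : ℝ) : ℝ) : EReal)} := by
      ext s
      simp only [Set.mem_preimage, Set.mem_Iic, Set.mem_iInter, Set.mem_ofPred_eq]
      refine ⟨fun h N => h.trans bot_le, fun h => ?_⟩
      rw [le_bot_iff, EReal.eq_bot_iff_forall_lt]
      intro y
      obtain ⟨N, hN⟩ := exists_nat_gt (-y)
      exact (h N).trans_lt (EReal.coe_lt_coe_iff.2 (by linarith))
    rw [this]
    exact .iInter fun N => hr _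
  | coe a => exact hr a
  | top => simp

lemma Admissible.abs_localValue_le (α : ℝ) (s : S) :
    |C.localValue s α| ≤ C.bound s + |α| :=
  hC.localValue_eq_iterLimit α s ▸ hC.abs_iterLimit_le α s

lemma Admissible.le_localValue (α : ℝ) {s : S} (hs : s ∉ C.terminal) :
    α ≤ C.localValue s α := by
  rw [hC.localValue_eq_iterLimit, hC.iterLimit_eq α hs]
  exact le_max_left _ _

end LocalValue

section Surrogate

/-- Before absorption there are only finitely many times, so the infimum is attained. By
`gittins_le_iff` the event is that the optimal stopping set for `α` is entered before the chain
terminates, so its probability is the subgradient at `α`. -/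
lemma surrogate_le_iff {ω : ℕ → S} {T : ℕ} (hT : ω T ∈ C.terminal) (α : ℝ) :
    C.surrogate ω ≤ α ↔ ∃ t, C.gittins (ω t) ≤ α ∧ ∀ v ≤ t, ω v ∉ C.terminal := by
  constructor
  · intro h
    have hfin : Finite {t : ℕ // ∀ v ≤ t, ω v ∉ C.terminal} := by
      refine Set.Finite.to_subtype ((Set.finite_lt_nat T).subset fun t ht => ?_)
      by_contra hlt
      exact ht T (not_lt.1 hlt) hT
    rcases isEmpty_or_nonempty {t : ℕ // ∀ v ≤ t, ω v ∉ C.terminal} with he | he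
    · rw [surrogate, iInf_of_empty] at h
      exact absurd h (by simp)
    · obtain ⟨t, ht⟩ := exists_eq_ciInf_of_finite
        (f := fun t : {t : ℕ // ∀ v ≤ t, ω v ∉ C.terminal} => C.gittins (ω t))
      exact ⟨t, ht.trans_le h, t.2⟩
  · rintro ⟨t, ht, hv⟩
    exact (iInf_le _ (⟨t, hv⟩ : {t : ℕ // ∀ v ≤ t, ω v ∉ C.terminal})).trans ht

lemma surrogate_of_terminal {ω : ℕ → S} (h : ω 0 ∈ C.terminal) : C.surrogate ω = ⊤ := by
  have : IsEmpty {t : ℕ // ∀ v ≤ t, ω v ∉ C.terminal} := ⟨fun t => t.2 0 (Nat.zero_le _) h⟩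
  rw [surrogate, iInf_of_empty]

lemma surrogate_seqCons {s : S} (hs : s ∉ C.terminal) (ω : ℕ → S) :
    C.surrogate (seqCons s ω) = min (C.gittins s) (C.surrogate ω) := by
  unfold surrogate
  refine le_antisymm (le_min ?_ (le_iInf fun t => ?_)) (le_iInf fun t => ?_)
  · exact iInf_le_of_le ⟨0, fun v hv => by simpa [Nat.le_zero.1 hv] using hs⟩ le_rfl
  · refine iInf_le_of_le ⟨t + 1, fun v hv => ?_⟩ le_rfl
    cases v with
    | zero => exact hs
    | succ v => exact t.2 v (by omega)
  · obtain ⟨t, ht⟩ := t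
    cases t with
    | zero => exact min_le_left _ _
    | succ t =>
      refine (min_le_right _ _).trans (iInf_le_of_le ⟨t, fun v hv => ht (v + 1) (by omega)⟩ le_rfl)

lemma surrogate_le_gittins {ω : ℕ → S} (h : ω 0 ∉ C.terminal) :
    C.surrogate ω ≤ C.gittins (ω 0) :=
  iInf_le_of_le ⟨0, fun v hv => by simpa [Nat.le_zero.1 hv] using h⟩ le_rfl

variable (hC : C.Admissible)
include hC

lemma Admissible.measurable_surrogate : Measurable C.surrogate := by
  classical
  have : C.surrogate = fun ω => ⨅ t : ℕ,
      if ∀ v ≤ t, ω v ∉ C.terminal then C.gittins (ω t) else ⊤ := by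
    ext ω
    unfold surrogate
    refine le_antisymm (le_iInf fun t => ?_) (le_iInf fun t => iInf_le_of_le t.1 ?_)
    · split_ifs with h
      · exact iInf_le_of_le ⟨t, h⟩ le_rfl
      · exact le_top
    · rw [if_pos t.2]
  rw [this]
  exact Measurable.iInf fun t => Measurable.ite (measurableSet_avoid C.measurableSet_terminal t)
    (hC.measurable_gittins.comp (measurable_pi_apply t)) measurable_const

/-- The probability that the surrogate value is at most `α`. -/
lemma Admissible.surrogate_subgradient (α β : ℝ) (s : S) :
    C.localValue s α + (β - α) * (C.traj s).real {ω | C.surrogate ω ≤ α} ≤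
      C.localValue s β := by
  have h := hC.localValue_subgradient α β s
  rwa [measureReal_congr (t := {ω | C.surrogate ω ≤ α})] at h
  filter_upwards [(hC s).1] with ω ⟨T, hT⟩
  refine propext ?_
  change (∃ t, C.localValue (ω t) α ≤ α ∧ ∀ v ≤ t, ω v ∉ C.terminal) ↔ C.surrogate ω ≤ α
  rw [surrogate_le_iff hT]
  simp only [hC.gittins_le_iff]

/-- The total reward along a trajectory. -/
def _root_.RewardChain.totalReward (C : RewardChain S) (ω : ℕ → S) : ℝ := ∑' t, C.reward (ω t)

omit hC in
@[fun_prop]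
lemma measurable_totalReward : Measurable C.totalReward := by
  unfold totalReward
  exact Measurable.tsum fun t => by fun_prop

omit hC in
lemma totalReward_seqCons (s : S) {ω : ℕ → S} (h : C.absReward ω < ∞) :
    C.totalReward (seqCons s ω) = C.reward s + C.totalReward ω := by
  unfold totalReward
  rw [tsum_eq_zero_add']
  · rfl
  · exact C.summable_reward h

omit hC in
lemma abs_totalReward_le {ω : ℕ → S} (h : C.absReward ω < ∞) :
    |C.totalReward ω| ≤ (C.absReward ω).toReal :=
  C.sum_abs_le_absReward h fun _ => le_rfl

lemma Admissible.integrable_totalReward (s : S) : Integrable C.totalReward (C.traj s) := by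
  refine (hC.integrable_absReward s).mono' (by fun_prop) ?_
  filter_upwards [hC.ae_absReward_lt_top s] with ω hω using abs_totalReward_le hω

omit hC in
lemma localReturn_empty (ω : ℕ → S) (α : ℝ) : C.localReturn α ∅ ω = C.totalReward ω := by
  simp [localReturn, totalReward]

/-- The empty stopping set never takes the alternative. -/
lemma Admissible.integral_totalReward_le (α : ℝ) (s : S) :
    ∫ ω, C.totalReward ω ∂C.traj s ≤ C.localValue s α := by
  have := hC.stopValue_le_localValue α MeasurableSet.empty s
  simpa only [stopValue, localReturn_empty] using this

lemma Admissible.abs_integral_totalReward_le (s : S) :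
    |∫ ω, C.totalReward ω ∂C.traj s| ≤ C.bound s := by
  rw [← hC.integral_absReward]
  refine (norm_integral_le_integral_norm C.totalReward).trans (integral_mono_ae
    (hC.integrable_totalReward s).norm (hC.integrable_absReward s) ?_)
  filter_upwards [hC.ae_absReward_lt_top s] with ω hω using abs_totalReward_le hω

lemma Admissible.localValue_le_bound {a : ℝ} (ha : a ≤ 0) (s : S) :
    C.localValue s a ≤ C.bound s := by
  have h1 := hC.localValue_mono s ha
  have h2 := (le_abs_self _).trans (hC.abs_localValue_le 0 s)
  simp only [abs_zero, add_zero] at h2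
  linarith

/-- On `α ≤ 0` the value stays within `± C.bound s`, so the slope at `-2N` is at most `2 * C.bound s
/ N`; it dominates the probability of `⊥`. Since `V(2N) ≥ 2N` and `V(N) ≤ N + C.bound s`, the slope
at `2N` is at least `1 - C.bound s / N`, which leaves no mass for `⊤`. -/
lemma Admissible.ae_surrogate_finite {s : S} (hs : s ∉ C.terminal) :
    ∀ᵐ ω ∂C.traj s, C.surrogate ω ≠ ⊥ ∧ C.surrogate ω ≠ ⊤ := by
  have hm (a : EReal) : MeasurableSet {ω | C.surrogate ω ≤ a} :=
    measurableSet_le hC.measurable_surrogate measurable_const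
  have hlim : Tendsto (fun N : ℕ => 2 * C.bound s / (N : ℝ)) atTop (𝓝 0) :=
    tendsto_const_div_atTop_nhds_zero_nat _
  have hb0 := C.bound_nonneg s
  have h1 : (C.traj s).real {ω | C.surrogate ω = ⊥} ≤ 0 := by
    refine ge_of_tendsto hlim ((eventually_gt_atTop 0).mono fun N hN => ?_)
    have hN' : (0 : ℝ) < N := by exact_mod_cast hN
    have hsub := hC.surrogate_subgradient (-(2 * N)) (-N) s
    have hle : (C.traj s).real {ω | C.surrogate ω = ⊥} ≤
        (C.traj s).real {ω | C.surrogate ω ≤ ((-(2 * N) : ℝ) : EReal)} :=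
      measureReal_mono fun ω hω => by
        have : C.surrogate ω = ⊥ := hω
        simp [this]
    have h2 := hC.localValue_le_bound (a := -N) (by linarith) s
    have h3 := hC.integral_totalReward_le (-(2 * N)) s
    have h4 := (abs_le.1 (hC.abs_integral_totalReward_le s)).1
    rw [le_div_iff₀ hN']
    nlinarith
  have h2 : (C.traj s).real {ω | C.surrogate ω = ⊤} ≤ 0 := by
    refine ge_of_tendsto hlim ((eventually_gt_atTop 0).mono fun N hN => ?_)
    have hN' : (0 : ℝ) < N := by exact_mod_cast hN
    have hsub := hC.surrogate_subgradient (2 * N) N s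
    have hle : (C.traj s).real {ω | C.surrogate ω = ⊤} ≤
        (C.traj s).real {ω | C.surrogate ω ≤ ((2 * N : ℝ) : EReal)}ᶜ :=
      measureReal_mono fun ω hω => by
        have h : C.surrogate ω = ⊤ := hω
        have : ¬ (⊤ : EReal) ≤ ((2 * N : ℝ) : EReal) :=
          not_le.2 (EReal.coe_lt_top _)
        change ¬ C.surrogate ω ≤ ((2 * N : ℝ) : EReal)
        rwa [h]
    rw [probReal_compl_eq_one_sub (hm _)] at hle
    have h3 := hC.le_localValue (2 * N) hs
    have h4 := (le_abs_self _).trans (hC.abs_localValue_le N s)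
    rw [abs_of_pos hN'] at h4
    rw [le_div_iff₀ hN']
    nlinarith
  have e1 : C.traj s {ω | C.surrogate ω = ⊥} = 0 :=
    (measureReal_eq_zero_iff).1 (le_antisymm h1 measureReal_nonneg)
  have e2 : C.traj s {ω | C.surrogate ω = ⊤} = 0 :=
    (measureReal_eq_zero_iff).1 (le_antisymm h2 measureReal_nonneg)
  filter_upwards [measure_eq_zero_iff_ae_notMem.1 e1, measure_eq_zero_iff_ae_notMem.1 e2]
    with ω a b using ⟨a, b⟩

end Surrogate

end RewardChain

/-! ### Expectation of the surrogate value against the expected total reward. -/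

namespace RewardChain

variable {S : Type u} [MeasurableSpace S] {C : RewardChain S}

/-- The surrogate value as a real number. -/
def realSurrogate (C : RewardChain S) (ω : ℕ → S) : ℝ := (C.surrogate ω).toReal

lemma realSurrogate_of_terminal {ω : ℕ → S} (h : ω 0 ∈ C.terminal) : C.realSurrogate ω = 0 := by
  simp [realSurrogate, surrogate_of_terminal h]

variable (hC : C.Admissible)
include hC

lemma Admissible.measurable_realSurrogate : Measurable C.realSurrogate :=
  hC.measurable_surrogate.ereal_toReal

lemma Admissible.ae_coe_realSurrogate {s : S} (hs : s ∉ C.terminal) :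
    ∀ᵐ ω ∂C.traj s, (C.realSurrogate ω : EReal) = C.surrogate ω := by
  filter_upwards [hC.ae_surrogate_finite hs] with ω h using EReal.coe_toReal h.2 h.1

/-- On `[a, b]` both sides, as functions of the upper endpoint, have the subgradient `P(Γ ≤ ·)`. The
cut-off at `a` keeps the integrand bounded, as `Γ` is not yet known to be integrable. -/
lemma Admissible.integral_pos_part_sub_max {s : S} (hs : s ∉ C.terminal) {a b : ℝ} (hab : a ≤ b) :
    ∫ ω, max (b - max (C.realSurrogate ω) a) 0 ∂C.traj s = C.localValue s b - C.localValue s a := by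
  have hm := hC.measurable_realSurrogate
  have hint (x : ℝ) : Integrable (fun ω => max (x - max (C.realSurrogate ω) a) 0) (C.traj s) := by
    refine (integrable_const (|x| + |a|)).mono' (by fun_prop) (Eventually.of_forall fun ω => ?_)
    rw [Real.norm_eq_abs, abs_of_nonneg (le_max_right _ _)]
    refine max_le ?_ (by positivity)
    linarith [le_max_right (C.realSurrogate ω) a, le_abs_self x, neg_abs_le a]
  have key := sub_eq_sub_of_subgradient (F := fun x => (C.traj s).real {ω | C.surrogate ω ≤ x})
    (V := C.localValue s) (W := fun x => ∫ ω, max (x - max (C.realSurrogate ω) a) 0 ∂C.traj s) hab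
    (fun x _ y _ => hC.surrogate_subgradient x y s) (fun x hx y hy => ?_)
  · rw [key]
    have : (fun ω => max (a - max (C.realSurrogate ω) a) 0) = fun _ => (0 : ℝ) := by
      ext ω
      exact max_eq_right (by linarith [le_max_right (C.realSurrogate ω) a])
    simp only [this, integral_zero, sub_zero]
  · have hms : MeasurableSet {ω | C.surrogate ω ≤ x} :=
      measurableSet_le hC.measurable_surrogate measurable_const
    have e : (y - x) * (C.traj s).real {ω | C.surrogate ω ≤ x} =
        ∫ ω, {ω | C.surrogate ω ≤ x}.indicator (fun _ => y - x) ω ∂C.traj s := by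
      rw [integral_indicator_const _ hms, smul_eq_mul, mul_comm]
    have hi : Integrable ({ω | C.surrogate ω ≤ x}.indicator fun _ => y - x) (C.traj s) :=
      (integrable_const _).indicator hms
    rw [e, ← integral_add (hint x) hi]
    refine integral_mono_ae ((hint x).add hi) (hint y) ?_
    filter_upwards [hC.ae_coe_realSurrogate hs] with ω hω
    by_cases h : C.surrogate ω ≤ x
    · rw [Set.indicator_of_mem (by exact h)]
      rw [← hω, EReal.coe_le_coe_iff] at h
      have h2 : max (C.realSurrogate ω) a ≤ x := max_le h hx.1
      rw [max_eq_left (by linarith)]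
      linarith [le_max_left (y - max (C.realSurrogate ω) a) 0]
    · rw [Set.indicator_of_notMem (by exact h), add_zero]
      rw [← hω, EReal.coe_le_coe_iff, not_le] at h
      rw [max_eq_right (by linarith [le_max_left (C.realSurrogate ω) a])]
      exact le_max_right _ _

omit hC in
-- `N - (N - max g (-N))⁺` is the truncation of `g` to `[-N, N]`. The right side writes its absolute
-- value through functions whose expectations `integral_pos_part_sub_max` computes.
lemma abs_clamp_eq (g : ℝ) {N : ℝ} (hN : 0 ≤ N) :
    |N - max (N - max g (-N)) 0| =
      (N - max (N - max g 0) 0) + max (0 - max g (-N)) 0 := by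
  rcases le_total g (-N) with h1 | h1
  · rw [max_eq_right h1, max_eq_right (by linarith : g ≤ 0), max_eq_left (by linarith : 0 ≤ N - -N),
      max_eq_left (by linarith : 0 ≤ N - 0), max_eq_left (by linarith : 0 ≤ 0 - -N),
      abs_of_nonpos (by linarith)]
    ring
  · rw [max_eq_left h1]
    rcases le_total g 0 with h2 | h2
    · rw [max_eq_right h2, max_eq_left (by linarith : 0 ≤ N - g),
        max_eq_left (by linarith : 0 ≤ N - 0), max_eq_left (by linarith : 0 ≤ 0 - g),
        abs_of_nonpos (by linarith)]
      ring
    · rw [max_eq_left h2, max_eq_right (by linarith : 0 - g ≤ 0)]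
      rcases le_total g N with h3 | h3
      · rw [max_eq_left (by linarith : 0 ≤ N - g), abs_of_nonneg (by linarith)]; ring
      · rw [max_eq_right (by linarith : N - g ≤ 0), abs_of_nonneg (by linarith)]; ring

omit hC in
lemma abs_clamp_le (g : ℝ) {N : ℝ} (hN : 0 ≤ N) :
    |N - max (N - max g (-N)) 0| ≤ |g| := by
  rw [abs_clamp_eq g hN]
  rcases le_total g 0 with h | h
  · rw [max_eq_right h, max_eq_left (by linarith : 0 ≤ N - 0), abs_of_nonpos h]
    have : max (0 - max g (-N)) 0 ≤ -g := max_le (by linarith [le_max_left g (-N)]) (by linarith)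
    linarith
  · rw [max_eq_left h, abs_of_nonneg h,
      max_eq_right (by linarith [le_max_left g (-N)] : 0 - max g (-N) ≤ 0)]
    linarith [le_max_left (N - g) 0]

omit hC in
lemma clamp_eq_self {g N : ℝ} (hN : |g| ≤ N) : N - max (N - max g (-N)) 0 = g := by
  have := abs_le.1 hN
  rw [max_eq_left this.1, max_eq_left (by linarith)]
  ring

omit hC in
lemma tendsto_clamp (g : ℝ) :
    Tendsto (fun N : ℕ => (N : ℝ) - max (N - max g (-N)) 0) atTop (𝓝 g) := by
  refine tendsto_const_nhds.congr' ?_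
  obtain ⟨M, hM⟩ := exists_nat_ge |g|
  filter_upwards [eventually_ge_atTop M] with N hN
  exact (clamp_eq_self (hM.trans (by exact_mod_cast hN))).symm

lemma Admissible.integrable_pos_part_sub_max {a b : ℝ} (s : S) :
    Integrable (fun ω => max (b - max (C.realSurrogate ω) a) 0) (C.traj s) := by
  have hm := hC.measurable_realSurrogate
  refine (integrable_const (|b| + |a|)).mono' (by fun_prop) (Eventually.of_forall fun ω => ?_)
  rw [Real.norm_eq_abs, abs_of_nonneg (le_max_right _ _)]
  refine max_le ?_ (by positivity)
  linarith [le_max_right (C.realSurrogate ω) a, le_abs_self b, neg_abs_le a]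

lemma Admissible.integrable_realSurrogate {s : S} (hs : s ∉ C.terminal) :
    Integrable C.realSurrogate (C.traj s) := by
  have hm := hC.measurable_realSurrogate
  have hi (a b : ℝ) := hC.integrable_pos_part_sub_max (a := a) (b := b) s
  refine ⟨hm.aestronglyMeasurable, ?_⟩
  -- The expectation is `(N - V(N)) + 2 V(0) - V(-N)`: the first term is at most `0`, `V(0)` at most
  -- `C.bound s`, and `V(-N)` at least `-C.bound s`. Fatou's lemma then removes the truncation.
  have hbound (N : ℕ) : ∫⁻ ω, ‖(N : ℝ) - max (N - max (C.realSurrogate ω) (-N)) 0‖ₑ ∂C.traj s ≤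
      ENNReal.ofReal (3 * C.bound s) := by
    have hN : (0 : ℝ) ≤ N := Nat.cast_nonneg N
    have h1 : ∫⁻ ω, ‖(N : ℝ) - max (N - max (C.realSurrogate ω) (-N)) 0‖ₑ ∂C.traj s =
        ENNReal.ofReal
          (∫ ω, ‖(N : ℝ) - max (N - max (C.realSurrogate ω) (-N)) 0‖ ∂C.traj s) :=
      (ofReal_integral_norm_eq_lintegral_enorm ((integrable_const _).sub (hi _ _))).symm
    rw [h1]
    refine ENNReal.ofReal_le_ofReal ?_
    simp only [Real.norm_eq_abs, abs_clamp_eq _ hN]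
    have hs1 : Integrable (fun ω => (N : ℝ) - max (N - max (C.realSurrogate ω) 0) 0) (C.traj s) :=
      (integrable_const _).sub (hi _ _)
    rw [integral_add hs1 (hi _ _), integral_sub (integrable_const _) (hi _ _),
      hC.integral_pos_part_sub_max hs hN,
      hC.integral_pos_part_sub_max hs (by linarith)]
    simp only [integral_const, probReal_univ, smul_eq_mul, one_mul]
    have h2 := hC.localValue_le_bound (a := 0) le_rfl s
    have h3 := hC.integral_totalReward_le (-N) s
    have h4 := (abs_le.1 (hC.abs_integral_totalReward_le s)).1
    have h5 := hC.le_localValue N hs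
    linarith
  have hF := lintegral_liminf_le (μ := C.traj s) (u := atTop)
    (f := fun (N : ℕ) ω => ‖(N : ℝ) - max (N - max (C.realSurrogate ω) (-N)) 0‖ₑ)
    (fun N => by fun_prop)
  have e : (fun ω => liminf (fun N : ℕ =>
      ‖(N : ℝ) - max (N - max (C.realSurrogate ω) (-N)) 0‖ₑ) atTop) =
      fun ω => ‖C.realSurrogate ω‖ₑ :=
    funext fun ω => (tendsto_clamp (C.realSurrogate ω)).enorm.liminf_eq
  rw [e] at hF
  refine lt_of_le_of_lt (hF.trans (liminf_le_of_frequently_le' (Frequently.of_forall hbound)))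
    ENNReal.ofReal_lt_top

/-- As `Γ` is finite, almost every trajectory eventually avoids the optimal stopping set for `-N`
until it terminates. Evaluating these sets with alternative `0` gives a dominated sequence, and only
discards the non-positive term `-N` times the probability of stopping. -/
lemma Admissible.tendsto_localValue_neg {s : S} (hs : s ∉ C.terminal) :
    Tendsto (fun N : ℕ => C.localValue s (-N)) atTop (𝓝 (∫ ω, C.totalReward ω ∂C.traj s)) := by
  have hB (α : ℝ) : MeasurableSet {x | C.localValue x α ≤ α} :=
    measurableSet_le (hC.measurable_localValue α) measurable_const
  have hlim : Tendsto (fun N : ℕ => C.stopValue 0 {x | C.localValue x (-N) ≤ -N} s) atTop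
      (𝓝 (∫ ω, C.totalReward ω ∂C.traj s)) := by
    refine tendsto_integral_of_dominated_convergence (fun ω => (C.absReward ω).toReal)
      (fun N => (C.measurable_localReturn 0 (hB _)).aestronglyMeasurable)
      (hC.integrable_absReward s) (fun N => ?_) ?_
    · filter_upwards [hC.ae_absReward_lt_top s] with ω hω
      simpa using C.abs_localReturn_le 0 hω
    · filter_upwards [hC.ae_coe_realSurrogate hs, C.ae_terminal_mono s, (hC s).1]
        with ω hω hmono ⟨T, hT⟩
      refine tendsto_const_nhds.congr' ?_
      obtain ⟨M, hM⟩ := exists_nat_gt (-C.realSurrogate ω)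
      filter_upwards [eventually_ge_atTop M] with N hN
      have hN' : (M : ℝ) ≤ N := by exact_mod_cast hN
      have hlt : ((-N : ℝ) : EReal) < C.surrogate ω := by
        rw [← hω]; exact EReal.coe_lt_coe_iff.2 (by linarith)
      rw [← not_le, surrogate_le_iff hT] at hlt
      push Not at hlt
      unfold totalReward localReturn
      simp only [ite_self, add_zero]
      refine tsum_congr fun t => ?_
      split_ifs with h
      · rfl
      -- The set may be entered after absorption, where the rewards that are cut off are zero.
      · push Not at h
        obtain ⟨v, hv, hvB⟩ := h
        obtain ⟨w, hw, hwt⟩ := hlt v ((hC.gittins_le_iff _ _).2 hvB)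
        exact C.reward_terminal _ (hmono w hwt t (hw.trans hv))
  refine tendsto_of_tendsto_of_tendsto_of_le_of_le tendsto_const_nhds hlim
    (fun N => hC.integral_totalReward_le _ s) fun N => ?_
  have h1 := hC.localValue_eq_stopValue (-N) s
  have h2 := hC.stopValue_eq_add 0 (-N) (hB (-N)) s
  have h3 : 0 ≤ (N : ℝ) * (C.traj s).real
    {ω : ℕ → S | ∃ t, ω t ∈ {x | C.localValue x (-N) ≤ -N} ∧ ∀ v ≤ t, ω v ∉ C.terminal} :=
    mul_nonneg (Nat.cast_nonneg _) measureReal_nonneg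
  simp only
  linarith

/-- This is `integral_pos_part_sub_max` with `a = -N`, `b = N`. Since `N ≤ V(N)`, the limit is
non-positive, and since `V(N) = N` as soon as `N` is at least the Gittins index, it is zero when the
index is finite. -/
lemma Admissible.tendsto_integral_realSurrogate {s : S} (hs : s ∉ C.terminal) :
    Tendsto (fun N : ℕ => (N : ℝ) - C.localValue s N) atTop
      (𝓝 (∫ ω, C.realSurrogate ω ∂C.traj s - ∫ ω, C.totalReward ω ∂C.traj s)) := by
  have hm := hC.measurable_realSurrogate
  have h1 : Tendsto (fun N : ℕ => ∫ ω, ((N : ℝ) - max (N - max (C.realSurrogate ω) (-N)) 0)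
      ∂C.traj s) atTop (𝓝 (∫ ω, C.realSurrogate ω ∂C.traj s)) :=
    tendsto_integral_of_dominated_convergence (fun ω => |C.realSurrogate ω|)
      (fun N => by fun_prop) (hC.integrable_realSurrogate hs).abs
      (fun N => Eventually.of_forall fun ω => abs_clamp_le _ (Nat.cast_nonneg N))
      (Eventually.of_forall fun ω => tendsto_clamp _)
  refine (h1.sub (hC.tendsto_localValue_neg hs)).congr fun N => ?_
  have hN : (0 : ℝ) ≤ N := Nat.cast_nonneg N
  rw [integral_sub (integrable_const _) (hC.integrable_pos_part_sub_max s),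
    hC.integral_pos_part_sub_max hs (by linarith)]
  simp only [integral_const, probReal_univ, smul_eq_mul, one_mul]
  ring

lemma Admissible.integral_realSurrogate_le {s : S} (hs : s ∉ C.terminal) :
    ∫ ω, C.realSurrogate ω ∂C.traj s ≤ ∫ ω, C.totalReward ω ∂C.traj s := by
  refine sub_nonpos.1 (le_of_tendsto' (hC.tendsto_integral_realSurrogate hs) fun N => ?_)
  linarith [hC.le_localValue N hs]

lemma Admissible.neg_bound_le {s : S} (hs : s ∉ C.terminal) :
    -C.bound s ≤ ∫ ω, C.realSurrogate ω ∂C.traj s - ∫ ω, C.totalReward ω ∂C.traj s := by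
  refine ge_of_tendsto' (hC.tendsto_integral_realSurrogate hs) fun N => ?_
  have := (le_abs_self _).trans (hC.abs_localValue_le N s)
  rw [abs_of_nonneg (Nat.cast_nonneg N)] at this
  linarith

lemma Admissible.integral_realSurrogate_eq {s : S} (hs : s ∉ C.terminal) (hG : C.gittins s ≠ ⊤) :
    ∫ ω, C.realSurrogate ω ∂C.traj s = ∫ ω, C.totalReward ω ∂C.traj s := by
  obtain ⟨M, hM⟩ : ∃ M : ℕ, C.gittins s ≤ ((M : ℝ) : EReal) := by
    obtain ⟨M, hM⟩ := exists_nat_ge (C.gittins s).toReal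
    exact ⟨M, (EReal.le_coe_toReal hG).trans (EReal.coe_le_coe_iff.2 hM)⟩
  refine sub_eq_zero.1 (tendsto_nhds_unique (hC.tendsto_integral_realSurrogate hs) ?_)
  refine tendsto_const_nhds.congr' ?_
  filter_upwards [eventually_ge_atTop M] with N hN
  have h1 : C.gittins s ≤ ((N : ℝ) : EReal) :=
    hM.trans (EReal.coe_le_coe_iff.2 (by exact_mod_cast hN))
  linarith [hC.le_localValue N hs, (hC.gittins_le_iff s N).1 h1]

/-- A state of infinite Gittins index does not lead directly to a terminal state. -/
lemma Admissible.ae_notMem_terminal {s : S} (hs : s ∉ C.terminal) (hG : C.gittins s = ⊤) :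
    ∀ᵐ y ∂C.step s, y ∉ C.terminal := by
  have h1 : ∀ᵐ ω ∂C.traj s, C.surrogate ω ≠ ⊤ := by
    filter_upwards [hC.ae_surrogate_finite hs] with ω h using h.2
  rw [C.ae_traj_iff s (p := fun ω => C.surrogate ω ≠ ⊤)
    (hC.measurable_surrogate (measurableSet_singleton ⊤).compl)] at h1
  -- A terminal `y` would give the surrogate value `min ⊤ ⊤ = ⊤`, which has probability zero.
  filter_upwards [h1] with y hy hyt
  have h2 := C.ae_traj_zero y C.measurableSet_terminal hyt
  obtain ⟨ω, h3, h4⟩ := (hy.and h2).exists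
  rw [surrogate_seqCons hs, hG, surrogate_of_terminal h4] at h3
  exact h3 (min_self _)

/-- The defect `f = E [total reward - Γ]` is non-negative and vanishes where the index is finite.
Where the index is infinite the first state does not influence `Γ`, so `f = r + ∫ f`. Such a state
cannot terminate at once, so, not being free, it has `r < 0`, and `f` is subharmonic there. The
maximum principle gives `f = 0` everywhere, hence `r = 0`, a contradiction. -/
lemma Admissible.gittins_ne_top (hfree : ∀ s, ¬ C.IsFree s) {s : S} (hs : s ∉ C.terminal) :
    C.gittins s ≠ ⊤ := by
  set f : S → ℝ := fun s => ∫ ω, (C.totalReward ω - C.realSurrogate ω) ∂C.traj s with hf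
  have hms := hC.measurable_realSurrogate
  have hm : Measurable fun ω => C.totalReward ω - C.realSurrogate ω := by fun_prop
  have hfm : Measurable f :=
    (StronglyMeasurable.integral_kernel (κ := C.trajKernel) hm.stronglyMeasurable).measurable
  have h0 (s : S) (hs : s ∈ C.terminal) : f s = 0 := by
    refine integral_eq_zero_of_ae ?_
    filter_upwards [C.ae_terminal_of_mem hs] with ω h
    simp [realSurrogate_of_terminal (h 0), totalReward, C.reward_terminal _ (h _)]
  have hfs (s : S) (hs : s ∉ C.terminal) :
      f s = ∫ ω, C.totalReward ω ∂C.traj s - ∫ ω, C.realSurrogate ω ∂C.traj s :=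
    integral_sub (hC.integrable_totalReward s) (hC.integrable_realSurrogate hs)
  have hnn (s : S) : 0 ≤ f s := by
    by_cases hs : s ∈ C.terminal
    · rw [h0 s hs]
    · rw [hfs s hs]; linarith [hC.integral_realSurrogate_le hs]
  have hb (s : S) : |f s| ≤ 1 * (C.bound s + 1) := by
    rw [abs_of_nonneg (hnn s)]
    by_cases hs : s ∈ C.terminal
    · rw [h0 s hs]; linarith [C.bound_nonneg s]
    · rw [hfs s hs]; linarith [hC.neg_bound_le hs]
  have hfi (s : S) : Integrable f (C.step s) :=
    (((hC.integrable_bound s).add (integrable_const 1)).const_mul 1).mono'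
      hfm.aestronglyMeasurable (Eventually.of_forall hb)
  have hrec (s : S) (hs : s ∉ C.terminal) (hG : C.gittins s = ⊤) :
      f s = C.reward s + ∫ y, f y ∂C.step s := by
    have h1 : f s = ∫ y, ∫ ω, (C.totalReward (seqCons s ω) - C.realSurrogate (seqCons s ω))
        ∂C.traj y ∂C.step s := C.integral_traj_cons s hm
      ((hC.integrable_totalReward s).sub (hC.integrable_realSurrogate hs))
    have h2 (y : S) : ∫ ω, (C.totalReward (seqCons s ω) - C.realSurrogate (seqCons s ω))
        ∂C.traj y = C.reward s + f y := by
      have hi : Integrable (fun ω => C.totalReward ω - C.realSurrogate ω) (C.traj y) := by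
        refine (hC.integrable_totalReward y).sub ?_
        by_cases hy : y ∈ C.terminal
        · refine (integrable_zero (ℕ → S) ℝ (C.traj y)).congr ?_
          filter_upwards [C.ae_terminal_of_mem hy] with ω h
          simp [realSurrogate_of_terminal (h 0)]
        · exact hC.integrable_realSurrogate hy
      have h3 : ∫ ω, (C.totalReward (seqCons s ω) - C.realSurrogate (seqCons s ω)) ∂C.traj y =
          ∫ ω, (C.reward s + (C.totalReward ω - C.realSurrogate ω)) ∂C.traj y := by
        refine integral_congr_ae ?_
        filter_upwards [hC.ae_absReward_lt_top y] with ω hω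
        rw [totalReward_seqCons s hω, realSurrogate, surrogate_seqCons hs, hG,
          min_eq_right le_top, realSurrogate]
        ring
      rw [h3, integral_add (integrable_const _) hi]
      simp [hf]
    rw [h1]
    simp only [h2]
    rw [integral_add (integrable_const _) (hfi s)]
    simp
  have hneg (s : S) (hs : s ∉ C.terminal) (hG : C.gittins s = ⊤) : C.reward s < 0 := by
    by_contra! hr
    refine hfree s ⟨hs, hr, ?_⟩
    exact measure_eq_zero_iff_ae_notMem.2 (hC.ae_notMem_terminal hs hG)
  have hf0 (s : S) : f s = 0 := by
    refine le_antisymm (hC.nonpos_of_le_integral hfm zero_le_one hb (fun s hs => (h0 s hs).le)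
      (fun s hs hpos => ?_) s) (hnn s)
    by_cases hG : C.gittins s = ⊤
    · linarith [hrec s hs hG, hneg s hs hG]
    · rw [hfs s hs, hC.integral_realSurrogate_eq hs hG, sub_self] at hpos
      exact absurd hpos (lt_irrefl 0)
  intro hG
  have := hrec s hs hG
  simp only [hf0, integral_zero, add_zero] at this
  exact (hneg s hs hG).ne this.symm

end RewardChain

/-! ### Independent trajectories of all chains and the transition law under a policy. -/

namespace MCS

variable {n : ℕ} {S : Fin n → Type u} [∀ i, MeasurableSpace (S i)] (C : ∀ i, RewardChain (S i))

/-- The joint law of independent trajectories of all the chains, started at `x`. -/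
def jointTraj (x : ∀ i, S i) : Measure (∀ i, ℕ → S i) := Measure.pi fun i => (C i).traj (x i)

instance (x : ∀ i, S i) : IsProbabilityMeasure (jointTraj C x) := by
  unfold jointTraj; infer_instance

lemma measurable_jointTraj : Measurable (jointTraj C) := by
  refine Measurable.measure_of_isPiSystem_of_isProbabilityMeasure generateFrom_pi.symm
    isPiSystem_pi ?_
  rintro _ ⟨s, hs, rfl⟩
  simp only [jointTraj, Measure.pi_pi]
  refine Finset.measurable_fun_prod _ fun i _ => ?_
  exact (Measure.measurable_coe (show MeasurableSet (s i) from hs i (Set.mem_univ i))).comp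
    ((C i).measurable_traj.comp (measurable_pi_apply i))

/-- `jointTraj` as a kernel. -/
def jointKernel : Kernel (∀ i, S i) (∀ i, ℕ → S i) := ⟨jointTraj C, measurable_jointTraj C⟩

instance : IsMarkovKernel (jointKernel C) :=
  ⟨fun x => inferInstanceAs (IsProbabilityMeasure (jointTraj C x))⟩

/-- Puts the current state of the chain that is played in front of its future trajectory. -/
def push (e : (∀ i, S i) × Fin n) (η : ∀ i, ℕ → S i) : ∀ i, ℕ → S i :=
  Function.update η e.2 (seqCons (e.1 e.2) (η e.2))

omit [∀ i, MeasurableSpace (S i)] in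
lemma push_self (e : (∀ i, S i) × Fin n) (η : ∀ i, ℕ → S i) :
    push e η e.2 = seqCons (e.1 e.2) (η e.2) := by simp [push]

omit [∀ i, MeasurableSpace (S i)] in
lemma push_of_ne (e : (∀ i, S i) × Fin n) (η : ∀ i, ℕ → S i) {i : Fin n} (h : i ≠ e.2) :
    push e η i = η i := by simp [push, h]

lemma measurable_push : Measurable fun p : ((∀ i, S i) × Fin n) × (∀ i, ℕ → S i) =>
    push p.1 p.2 := by
  have h (a : Fin n) : Measurable fun p : (∀ i, S i) × (∀ i, ℕ → S i) => push (p.1, a) p.2 := by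
    refine measurable_pi_iff.2 fun j => ?_
    by_cases hj : j = a
    · subst hj
      have e (p : (∀ i, S i) × (∀ i, ℕ → S i)) : push (p.1, j) p.2 j = seqCons (p.1 j) (p.2 j) :=
        push_self (p.1, j) p.2
      simp only [e]
      exact measurable_seqCons_uncurry.comp
        (((measurable_pi_apply j).comp measurable_fst).prodMk
          ((measurable_pi_apply j).comp measurable_snd))
    · have e (p : (∀ i, S i) × (∀ i, ℕ → S i)) : push (p.1, a) p.2 j = p.2 j :=
        push_of_ne (p.1, a) p.2 hj
      simp only [e]
      fun_prop
  have h2 : Measurable fun q : ((∀ i, S i) × (∀ i, ℕ → S i)) × Fin n => push (q.1.1, q.2) q.1.2 :=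
    measurable_from_prod_countable_left h
  exact h2.comp ((by fun_prop : Measurable fun p : ((∀ i, S i) × Fin n) × (∀ i, ℕ → S i) =>
    ((p.1.1, p.2), p.1.2)))

lemma measurable_push_left (e : (∀ i, S i) × Fin n) : Measurable (push e) :=
  measurable_push.comp (measurable_const.prodMk measurable_id)

lemma step_apply (e : (∀ i, S i) × Fin n) :
    step C e = ((C e.2).step (e.1 e.2)).map (Function.update e.1 e.2) := rfl

/-- The Markov property of the joint trajectories at the first step of one chain. -/
lemma jointTraj_eq_bind (e : (∀ i, S i) × Fin n) :
    jointTraj C e.1 = (step C e).bind fun y => (jointTraj C y).map (push e) := by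
  obtain ⟨x, a⟩ := e
  have hk : Measurable fun y => (jointTraj C y).map (push (x, a)) :=
    (Measure.measurable_map _ (measurable_push_left _)).comp (measurable_jointTraj C)
  -- It suffices to compare boxes. Only the factor of chain `a` changes, by that chain's own Markov
  -- property.
  refine Measure.pi_eq fun s hs => ?_
  have hms : MeasurableSet (Set.univ.pi s) := .univ_pi hs
  have hks : Measurable fun y => (jointTraj C y).map (push (x, a)) (Set.univ.pi s) :=
    (Measure.measurable_coe hms).comp hk
  rw [Measure.bind_apply hms hk.aemeasurable, step_apply]
  dsimp only
  rw [lintegral_map hks (measurable_update x)]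
  set s' : ∀ i, Set (ℕ → S i) := Function.update s a (seqCons (x a) ⁻¹' s a) with hs'
  have hpre : push (x, a) ⁻¹' (Set.univ.pi s) = Set.univ.pi s' := by
    ext η
    simp only [Set.mem_preimage, Set.mem_univ_pi]
    refine forall_congr' fun i => ?_
    by_cases hi : i = a
    · subst hi
      rw [push_self (x, i) η, hs', Function.update_self]; rfl
    · rw [push_of_ne (x, a) η hi, hs', Function.update_of_ne hi]
  have h1 (z : S a) : (jointTraj C (Function.update x a z)).map (push (x, a)) (Set.univ.pi s) =
      (C a).traj z (seqCons (x a) ⁻¹' s a) *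
        ∏ i ∈ Finset.univ.erase a, (C i).traj (x i) (s i) := by
    rw [Measure.map_apply (measurable_push_left _) hms, hpre, jointTraj, Measure.pi_pi,
      ← Finset.mul_prod_erase _ _ (Finset.mem_univ a), Function.update_self, hs',
      Function.update_self]
    congr 1
    refine Finset.prod_congr rfl fun i hi => ?_
    rw [Function.update_of_ne (Finset.ne_of_mem_erase hi),
      Function.update_of_ne (Finset.ne_of_mem_erase hi)]
  have hsa : MeasurableSet (seqCons (x a) ⁻¹' s a) := measurable_seqCons (x a) (hs a)
  simp only [h1]
  have hka : Measurable fun z => (C a).traj z (seqCons (x a) ⁻¹' s a) :=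
    (Measure.measurable_coe hsa).comp (C a).measurable_traj
  rw [lintegral_mul_const _ hka, ← Finset.mul_prod_erase _ _ (Finset.mem_univ a)]
  congr 1
  have h2 := (C a).lintegral_traj_cons (x a) (f := (s a).indicator 1)
    (measurable_one.indicator (hs a))
  rw [lintegral_indicator_one (hs a)] at h2
  rw [h2]
  refine lintegral_congr fun z => ?_
  rw [← lintegral_indicator_one hsa]
  rfl

lemma lintegral_jointTraj_push (e : (∀ i, S i) × Fin n) {F : (∀ i, ℕ → S i) → ℝ≥0∞}
    (hF : Measurable F) :
    ∫⁻ y, ∫⁻ η, F (push e η) ∂jointTraj C y ∂step C e = ∫⁻ η, F η ∂jointTraj C e.1 := by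
  have hk : Measurable fun y => (jointTraj C y).map (push e) :=
    (Measure.measurable_map _ (measurable_push_left _)).comp (measurable_jointTraj C)
  rw [jointTraj_eq_bind C e, Measure.lintegral_bind hk.aemeasurable hF.aemeasurable]
  refine lintegral_congr fun y => ?_
  rw [lintegral_map hF (measurable_push_left e)]

lemma map_eval_jointTraj (x : ∀ i, S i) (i : Fin n) :
    (jointTraj C x).map (Function.eval i) = (C i).traj (x i) :=
  (measurePreserving_eval (fun i => (C i).traj (x i)) i).map_eq

lemma ae_step_iff (e : (∀ i, S i) × Fin n) {p : (∀ i, S i) → Prop} (hp : MeasurableSet {y | p y}) :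
    (∀ᵐ y ∂step C e, p y) ↔ ∀ᵐ z ∂(C e.2).step (e.1 e.2), p (Function.update e.1 e.2 z) := by
  rw [step_apply, ae_map_iff (measurable_update e.1).aemeasurable hp]

namespace Policy

variable {C} {k : ℕ} (π : Policy C k)

instance (x : ∀ i, S i) : IsProbabilityMeasure (π.traj x) := by
  have : IsProbabilityMeasure ((π.first x).map fun a (_ : Finset.Iic 0) => (x, a)) :=
    Measure.isProbabilityMeasure_map (by fun_prop)
  unfold traj
  infer_instance

lemma lintegral_traj_next (x : ∀ i, S i) (t : ℕ)
    {f : (Finset.Iic t → (∀ i, S i) × Fin n) × ((∀ i, S i) × Fin n) → ℝ≥0∞} (hf : Measurable f) :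
    ∫⁻ ω, f (Preorder.frestrictLe t ω, ω (t + 1)) ∂π.traj x =
      ∫⁻ ω, ∫⁻ y, ∫⁻ a, f (Preorder.frestrictLe t ω, (y, a))
        ∂π.next t (Preorder.frestrictLe t ω, y) ∂step C (ω t) ∂π.traj x := by
  have hm : Measurable fun ω : ℕ → (∀ i, S i) × Fin n =>
      ((Preorder.frestrictLe t ω : Finset.Iic t → (∀ i, S i) × Fin n), ω (t + 1)) := by fun_prop
  have hm1 : Measurable fun ω : ℕ → (∀ i, S i) × Fin n =>
      f (Preorder.frestrictLe t ω, ω (t + 1)) := hf.comp hm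
  have hm2 : Measurable fun h : Finset.Iic t → (∀ i, S i) × Fin n =>
      ∫⁻ e, f (h, e) ∂(((step C).comap
        (fun h : (Finset.Iic t → (∀ i, S i) × Fin n) => h ⟨t, Finset.mem_Iic.2 le_rfl⟩)
        (measurable_pi_apply _)) ⊗ₖ π.next t) h := hf.lintegral_kernel_prod_right'
  have h1 (ω : ℕ → (∀ i, S i) × Fin n) :
      ∫⁻ y, ∫⁻ a, f (Preorder.frestrictLe t ω, (y, a))
        ∂π.next t (Preorder.frestrictLe t ω, y) ∂step C (ω t) =
      ∫⁻ e, f (Preorder.frestrictLe t ω, e) ∂(((step C).comap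
        (fun h : (Finset.Iic t → (∀ i, S i) × Fin n) => h ⟨t, Finset.mem_Iic.2 le_rfl⟩)
        (measurable_pi_apply _)) ⊗ₖ π.next t) (Preorder.frestrictLe t ω) := by
    exact (Kernel.lintegral_compProd ((step C).comap
        (fun h : (Finset.Iic t → (∀ i, S i) × Fin n) => h ⟨t, Finset.mem_Iic.2 le_rfl⟩)
        (measurable_pi_apply _)) (π.next t) (Preorder.frestrictLe t ω)
      (f := fun e => f (Preorder.frestrictLe t ω, e))
      (hf.comp measurable_prodMk_left)).symm
  simp only [h1]
  have hm3 := hm2.comp (Preorder.measurable_frestrictLe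
    (X := fun _ => (∀ i, S i) × Fin n) t)
  unfold Function.comp at hm3
  unfold traj
  rw [Measure.lintegral_bind (Kernel.measurable _).aemeasurable hm1.aemeasurable,
    Measure.lintegral_bind (Kernel.measurable _).aemeasurable hm3.aemeasurable]
  refine lintegral_congr fun h => ?_
  exact _root_.lintegral_traj_next _ h t hf

end Policy
end MCS

/-! ### Almost sure properties of the process step by step, and measurability of state sets. -/

namespace MCS

variable {n : ℕ} {S : Fin n → Type u} [∀ i, MeasurableSpace (S i)] {C : ∀ i, RewardChain (S i)}
  {k : ℕ}

namespace Policy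

variable (π : Policy C k)

/-- One step of the state process, for functions of the history and of the next state. -/
lemma lintegral_traj_next_state (x : ∀ i, S i) (t : ℕ)
    {Φ : (ℕ → (∀ i, S i) × Fin n) × (∀ i, S i) → ℝ≥0∞} (hΦ : Measurable Φ)
    (hdep : ∀ ω ω' y, (∀ v ≤ t, ω v = ω' v) → Φ (ω, y) = Φ (ω', y)) :
    ∫⁻ ω, Φ (ω, (ω (t + 1)).1) ∂π.traj x = ∫⁻ ω, ∫⁻ y, Φ (ω, y) ∂step C (ω t) ∂π.traj x := by
  -- Continues a finite history by repeating its last entry; by `hdep` the continuation does not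
  -- affect `Φ`.
  set ext : (Finset.Iic t → (∀ i, S i) × Fin n) → ℕ → (∀ i, S i) × Fin n :=
    fun h v => h ⟨min v t, Finset.mem_Iic.2 (min_le_right _ _)⟩ with hext
  have hme : Measurable ext := by fun_prop
  have he (ω : ℕ → (∀ i, S i) × Fin n) (y : ∀ i, S i) :
      Φ (ext (Preorder.frestrictLe t ω), y) = Φ (ω, y) :=
    hdep _ _ _ fun v hv => by simp [hext, min_eq_left hv]
  have h := π.lintegral_traj_next x t (f := fun p => Φ (ext p.1, p.2.1)) (by fun_prop)
  simp only [he, lintegral_const, measure_univ, mul_one] at h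
  exact h

lemma ae_traj_next_state (x : ∀ i, S i) (t : ℕ)
    {p : ((∀ i, S i) × Fin n) × (∀ i, S i) → Prop} (hp : MeasurableSet {q | p q})
    (h : ∀ e, ∀ᵐ y ∂step C e, p (e, y)) : ∀ᵐ ω ∂π.traj x, p (ω t, (ω (t + 1)).1) := by
  have hm : Measurable fun q : (ℕ → (∀ i, S i) × Fin n) × (∀ i, S i) => (q.1 t, q.2) := by fun_prop
  have hmi : Measurable ({q | p q}ᶜ.indicator fun _ => (1 : ℝ≥0∞)) :=
    measurable_const.indicator hp.compl
  have key := π.lintegral_traj_next_state x t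
    (Φ := fun q => {q | p q}ᶜ.indicator (fun _ => 1) (q.1 t, q.2)) (hmi.comp hm)
    (fun ω ω' y hω => by simp only [hω t le_rfl])
  have h0 : ∀ ω : ℕ → (∀ i, S i) × Fin n,
      ∫⁻ y, {q | p q}ᶜ.indicator (fun _ => (1 : ℝ≥0∞)) (ω t, y) ∂step C (ω t) = 0 := by
    intro ω
    refine (lintegral_congr_ae ((h (ω t)).mono fun y hy => ?_)).trans lintegral_zero
    exact Set.indicator_of_notMem (not_not_intro hy) _
  simp only [h0, lintegral_zero] at key
  rw [lintegral_eq_zero_iff (by fun_prop)] at key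
  filter_upwards [key] with ω hω
  by_contra hn
  have : (ω t, (ω (t + 1)).1) ∈ {q | p q}ᶜ := hn
  rw [Set.indicator_of_mem this] at hω
  exact one_ne_zero hω

lemma ae_traj_zero (x : ∀ i, S i) {p : (∀ i, S i) × Fin n → Prop} (hp : MeasurableSet {e | p e})
    (h : ∀ᵐ a ∂π.first x, p (x, a)) : ∀ᵐ ω ∂π.traj x, p (ω 0) := by
  have hms : MeasurableSet {ω : ℕ → (∀ i, S i) × Fin n | p (ω 0)}ᶜ :=
    (measurable_pi_apply 0 hp).compl
  have hm : Measurable fun (a : Fin n) (_ : Finset.Iic 0) => (x, a) := by fun_prop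
  have h0 (g : Finset.Iic 0 → (∀ i, S i) × Fin n) (hg : p (g ⟨0, by simp⟩))
      (κ : ∀ t : ℕ, Kernel (Finset.Iic t → (∀ i, S i) × Fin n) ((∀ i, S i) × Fin n))
      [∀ t, IsMarkovKernel (κ t)] :
      Kernel.traj (X := fun _ => (∀ i, S i) × Fin n) κ 0 g {ω | p (ω 0)}ᶜ = 0 := by
    have e : (Kernel.traj (X := fun _ => (∀ i, S i) × Fin n) κ 0 g).map (Preorder.frestrictLe 0) =
        Measure.dirac g := by
      rw [Kernel.traj_map_frestrictLe_apply, Kernel.partialTraj_self, Kernel.id_apply]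
    have hev : Measurable fun h : Finset.Iic 0 → (∀ i, S i) × Fin n => h ⟨0, by simp⟩ := by fun_prop
    have hs : MeasurableSet {h : Finset.Iic 0 → (∀ i, S i) × Fin n | p (h ⟨0, by simp⟩)}ᶜ :=
      (hev hp).compl
    have e2 : Measure.dirac g {h : Finset.Iic 0 → (∀ i, S i) × Fin n | p (h ⟨0, by simp⟩)}ᶜ =
        0 := by
      rw [Measure.dirac_apply' _ hs]
      exact Set.indicator_of_notMem (not_not_intro hg) _
    rw [← e, Measure.map_apply (by fun_prop) hs] at e2
    exact e2
  change π.traj x {ω | p (ω 0)}ᶜ = 0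
  unfold traj
  rw [Measure.bind_apply hms (Kernel.measurable _).aemeasurable, lintegral_eq_zero_iff
    (Kernel.measurable_coe _ hms)]
  have hev : Measurable fun h : Finset.Iic 0 → (∀ i, S i) × Fin n => h ⟨0, by simp⟩ := by fun_prop
  have hm2 : MeasurableSet {g : Finset.Iic 0 → (∀ i, S i) × Fin n | p (g ⟨0, by simp⟩)} :=
    hev hp
  have : ∀ᵐ g ∂(π.first x).map fun (a : Fin n) (_ : Finset.Iic 0) => (x, a),
      p (g ⟨0, by simp⟩) := by
    rw [ae_map_iff hm.aemeasurable hm2]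
    exact h
  filter_upwards [this] with g hg
  exact h0 g hg _

lemma ae_traj_state_zero (x : ∀ i, S i) {p : (∀ i, S i) → Prop} (hp : MeasurableSet {y | p y})
    (h : p x) : ∀ᵐ ω ∂π.traj x, p (ω 0).1 :=
  π.ae_traj_zero x (p := fun e => p e.1) (measurable_fst hp) (Eventually.of_forall fun _ => h)

/-- A property of the action given the state that holds for all action kernels holds along the
trajectory. -/
lemma ae_traj_action (x : ∀ i, S i) {p : (∀ i, S i) × Fin n → Prop} (hp : MeasurableSet {e | p e})
    (h0 : ∀ x, ∀ᵐ a ∂π.first x, p (x, a))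
    (h1 : ∀ t h x, ∀ᵐ a ∂π.next t (h, x), p (x, a)) : ∀ᵐ ω ∂π.traj x, ∀ t, p (ω t) := by
  refine ae_all_iff.2 fun t => ?_
  cases t with
  | zero => exact π.ae_traj_zero x hp (h0 x)
  | succ t =>
    have hmi : Measurable ({e | p e}ᶜ.indicator fun _ => (1 : ℝ≥0∞)) :=
    measurable_const.indicator hp.compl
    have key := π.lintegral_traj_next x t (f := fun q => {e | p e}ᶜ.indicator (fun _ => 1) q.2)
      (hmi.comp measurable_snd)
    have h2 (ω : ℕ → (∀ i, S i) × Fin n) (y : ∀ i, S i) :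
        ∫⁻ a, {e | p e}ᶜ.indicator (fun _ => (1 : ℝ≥0∞)) (y, a)
          ∂π.next t (Preorder.frestrictLe t ω, y) = 0 := by
      refine (lintegral_congr_ae ((h1 t _ y).mono fun a ha => ?_)).trans lintegral_zero
      exact Set.indicator_of_notMem (not_not_intro ha) _
    simp only [h2, lintegral_zero] at key
    have hev : Measurable fun ω : ℕ → (∀ i, S i) × Fin n => ω (t + 1) := by fun_prop
    have hmi' := hmi.comp hev
    unfold Function.comp at hmi'
    rw [lintegral_eq_zero_iff hmi'] at key
    filter_upwards [key] with ω hω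
    by_contra hn
    have : ω (t + 1) ∈ {e | p e}ᶜ := hn
    simp only [Set.indicator_of_mem this] at hω
    exact one_ne_zero hω

end Policy

lemma mem_active {x : ∀ i, S i} {i : Fin n} : i ∈ active C x ↔ x i ∉ (C i).terminal := by
  simp [active]

lemma mem_finished {x : ∀ i, S i} {i : Fin n} : i ∈ finished C x ↔ x i ∈ (C i).terminal := by
  simp [finished]

lemma measurableSet_mem_terminal (i : Fin n) :
    MeasurableSet {x : ∀ i, S i | x i ∈ (C i).terminal} :=
  measurable_pi_apply i (C i).measurableSet_terminal

/-- Sets of states that are described by which chains are terminal are measurable. -/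
lemma measurableSet_of_finished (p : Finset (Fin n) → Prop) :
    MeasurableSet {x : ∀ i, S i | p (finished C x)} := by
  have hm : Measurable fun (x : ∀ i, S i) (i : Fin n) => (x i ∈ (C i).terminal : Prop) :=
    measurable_pi_iff.2 fun i => measurable_to_prop (by
      have : (fun x : ∀ i, S i => (x i ∈ (C i).terminal : Prop)) ⁻¹' {True} =
          {x | x i ∈ (C i).terminal} := by ext; simp
      rw [this]
      exact measurableSet_mem_terminal i)
  classical
  have e : {x : ∀ i, S i | p (finished C x)} =
      (fun (x : ∀ i, S i) (i : Fin n) => (x i ∈ (C i).terminal : Prop)) ⁻¹'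
        {q | p (Finset.univ.filter fun i => q i)} := by
    ext x
    simp only [Set.mem_preimage, Set.mem_ofPred_eq, finished]
  rw [e]
  exact hm (Set.toFinite _).measurableSet

lemma measurableSet_ended : MeasurableSet {x : ∀ i, S i | Ended C k x} :=
  measurableSet_of_finished fun s => k ≤ s.card

lemma measurableSet_pair {α : Type*} [MeasurableSpace α] {p : α × Fin n → Prop}
    (h : ∀ a, MeasurableSet {x | p (x, a)}) : MeasurableSet {e | p e} := by
  have : {e | p e} = ⋃ a : Fin n, {x | p (x, a)} ×ˢ {a} := by
    ext ⟨x, a⟩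
    simp
  rw [this]
  exact .iUnion fun a => (h a).prod (measurableSet_singleton a)

end MCS

lemma measurable_apply_nat {α β : Type*} [MeasurableSpace α] [MeasurableSpace β] {f : ℕ → α → β}
    (hf : ∀ t, Measurable (f t)) {τ : α → ℕ} (hτ : Measurable τ) :
    Measurable fun a => f (τ a) a := by
  have h : Measurable fun p : ℕ × α => f p.1 p.2 := measurable_from_prod_countable_right hf
  exact h.comp (hτ.prodMk measurable_id)

/-! ### Gluing the history to the future trajectories; almost sure termination. -/

namespace MCS

variable {n : ℕ} {S : Fin n → Type u}

/-- Puts the states in which the chains were played before time `t` in front of their future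
trajectories. -/
def glue : ℕ → (ℕ → (∀ i, S i) × Fin n) → (∀ i, ℕ → S i) → ∀ i, ℕ → S i
  | 0, _, η => η
  -- The latest state is prepended first, so that earlier ones come to stand in front of it.
  | t + 1, ω, η => glue t ω (push (ω t) η)

lemma glue_congr {t : ℕ} {ω ω' : ℕ → (∀ i, S i) × Fin n} (h : ∀ v < t, ω v = ω' v)
    (η : ∀ i, ℕ → S i) : glue t ω η = glue t ω' η := by
  induction t generalizing η with
  | zero => rfl
  | succ t ih =>
    rw [glue, glue, h t (Nat.lt_succ_self t), ih fun v hv => h v (by omega)]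

/-- The number of times that chain `i` is played before time `t`. -/
def playCount (t : ℕ) (ω : ℕ → (∀ i, S i) × Fin n) (i : Fin n) : ℕ :=
  ((Finset.range t).filter fun v => (ω v).2 = i).card

lemma playCount_succ (t : ℕ) (ω : ℕ → (∀ i, S i) × Fin n) (i : Fin n) :
    playCount (t + 1) ω i = playCount t ω i + if (ω t).2 = i then 1 else 0 := by
  unfold playCount
  rw [Finset.range_add_one, Finset.filter_insert]
  split_ifs with h
  · rw [Finset.card_insert_of_notMem (by simp)]
  · rfl

lemma sum_playCount (t : ℕ) (ω : ℕ → (∀ i, S i) × Fin n) : ∑ i, playCount t ω i = t := by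
  unfold playCount
  rw [← Finset.card_eq_sum_card_fiberwise (f := fun v => (ω v).2) (t := Finset.univ)
    (fun _ _ => Finset.mem_coe.2 (Finset.mem_univ _)), Finset.card_range]

lemma glue_playCount_add (t : ℕ) (ω : ℕ → (∀ i, S i) × Fin n) (η : ∀ i, ℕ → S i) (i : Fin n)
    (j : ℕ) : glue t ω η i (playCount t ω i + j) = η i j := by
  induction t generalizing η j with
  | zero => simp [playCount, glue]
  | succ t ih =>
    rw [glue, playCount_succ, add_assoc, ih]
    split_ifs with h
    · subst h
      rw [push_self, add_comm, seqCons_succ]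
    · rw [push_of_ne _ _ (Ne.symm h), zero_add]

variable [∀ i, MeasurableSpace (S i)] (C : ∀ i, RewardChain (S i)) (k : ℕ)

lemma glue_notMem_terminal {t : ℕ} {ω : ℕ → (∀ i, S i) × Fin n}
    (h : ∀ v < t, (ω v).2 ∈ active C (ω v).1) (η : ∀ i, ℕ → S i) (i : Fin n) {j : ℕ}
    (hj : j < playCount t ω i) : glue t ω η i j ∉ (C i).terminal := by
  induction t generalizing η with
  | zero => simp [playCount] at hj
  | succ t ih =>
    rw [glue]
    rcases lt_or_ge j (playCount t ω i) with h1 | h1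
    · exact ih (fun v hv => h v (by omega)) _ h1
    · rw [playCount_succ] at hj
      split_ifs at hj with hi
      · subst hi
        obtain rfl : j = playCount t ω (ω t).2 + 0 := by omega
        rw [glue_playCount_add, push_self, seqCons_zero]
        exact mem_active.1 (h t (Nat.lt_succ_self t))
      · omega

lemma measurable_glue (t : ℕ) : Measurable fun p : (ℕ → (∀ i, S i) × Fin n) × (∀ i, ℕ → S i) =>
    glue t p.1 p.2 := by
  induction t with
  | zero => exact measurable_snd
  | succ t ih =>
    have h1 : Measurable fun p : (ℕ → (∀ i, S i) × Fin n) × (∀ i, ℕ → S i) => (p.1 t, p.2) := by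
      fun_prop
    exact ih.comp (measurable_fst.prodMk (measurable_push.comp h1))

lemma measurable_glue_right (t : ℕ) (ω : ℕ → (∀ i, S i) × Fin n) :
    Measurable fun η : ∀ i, ℕ → S i => glue t ω η :=
  (measurable_glue t).comp measurable_prodMk_left

lemma ae_jointTraj_eval {x : ∀ i, S i} {i : Fin n} {p : (ℕ → S i) → Prop}
    (h : ∀ᵐ ω ∂(C i).traj (x i), p ω) : ∀ᵐ η ∂jointTraj C x, p (η i) := by
  rw [← map_eval_jointTraj C x i] at h
  exact ae_of_ae_map (measurable_pi_apply i).aemeasurable h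

/-- The expectation of `F`, evaluated at the full trajectories, given the history up to `t`. -/
def condMean (F : (∀ i, ℕ → S i) → ℝ≥0∞) (t : ℕ) (ω : ℕ → (∀ i, S i) × Fin n) : ℝ≥0∞ :=
  ∫⁻ η, F (glue t ω η) ∂jointTraj C (ω t).1

lemma measurable_condMean {F : (∀ i, ℕ → S i) → ℝ≥0∞} (hF : Measurable F) (t : ℕ) :
    Measurable (condMean C F t) := by
  have hm : Measurable fun ω : ℕ → (∀ i, S i) × Fin n => (ω t).1 := by fun_prop
  exact (hF.comp (measurable_glue t)).lintegral_kernel_prod_right'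
    (κ := (jointKernel C).comap (fun ω : ℕ → (∀ i, S i) × Fin n => (ω t).1) hm)

open Classical in
/-- The time at which the process ends, or `N` if it does not end earlier. -/
def stopTime : ℕ → (ℕ → (∀ i, S i) × Fin n) → ℕ
  | 0, _ => 0
  | N + 1, ω => if ∀ v ≤ N, ¬ Ended C k (ω v).1 then N + 1 else stopTime N ω

lemma measurableSet_running (N : ℕ) :
    MeasurableSet {ω : ℕ → (∀ i, S i) × Fin n | ∀ v ≤ N, ¬ Ended C k (ω v).1} := by
  simp only [Set.ofPred_forall]
  refine .iInter fun v => .iInter fun _ => ?_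
  have hm : Measurable fun ω : ℕ → (∀ i, S i) × Fin n => (ω v).1 := by fun_prop
  exact (hm measurableSet_ended).compl

lemma measurable_stopTime (N : ℕ) : Measurable (stopTime C k N) := by
  induction N with
  | zero => exact measurable_const
  | succ N ih => exact Measurable.ite (measurableSet_running C k N) measurable_const ih

lemma stopTime_of_running {N : ℕ} {ω : ℕ → (∀ i, S i) × Fin n}
    (h : ∀ v < N, ¬ Ended C k (ω v).1) : stopTime C k N ω = N := by
  cases N with
  | zero => rfl
  | succ N => rw [stopTime, if_pos fun v hv => h v (by omega)]

lemma measurable_condMean_comp {F : (∀ i, ℕ → S i) → ℝ≥0∞} (hF : Measurable F)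
    {τ : (ℕ → (∀ i, S i) × Fin n) → ℕ} (hτ : Measurable τ) :
    Measurable fun ω => condMean C F (τ ω) ω :=
  measurable_apply_nat (measurable_condMean C hF) hτ

lemma measurable_lintegral_glue {F : (∀ i, ℕ → S i) → ℝ≥0∞} (hF : Measurable F) (t : ℕ) :
    Measurable fun q : (ℕ → (∀ i, S i) × Fin n) × (∀ i, S i) =>
      ∫⁻ η, F (glue t q.1 η) ∂jointTraj C q.2 := by
  have h1 : Measurable fun p : ((ℕ → (∀ i, S i) × Fin n) × (∀ i, S i)) × (∀ i, ℕ → S i) =>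
      F (glue t p.1.1 p.2) :=
    hF.comp ((measurable_glue t).comp ((measurable_fst.comp measurable_fst).prodMk measurable_snd))
  exact h1.lintegral_kernel_prod_right' (κ := (jointKernel C).comap
    (fun q : (ℕ → (∀ i, S i) × Fin n) × (∀ i, S i) => q.2) measurable_snd)

namespace Policy

variable {C k} (π : Policy C k)

lemma lintegral_condMean_zero {F : (∀ i, ℕ → S i) → ℝ≥0∞} (hF : Measurable F) (x : ∀ i, S i) :
    ∫⁻ ω, condMean C F 0 ω ∂π.traj x = ∫⁻ η, F η ∂jointTraj C x := by
  have hm : Measurable fun y => ∫⁻ η, F η ∂jointTraj C y :=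
    hF.lintegral_kernel (κ := jointKernel C)
  have h := π.ae_traj_state_zero x (p := fun y => ∫⁻ η, F η ∂jointTraj C y =
    ∫⁻ η, F η ∂jointTraj C x) (measurableSet_eq_fun hm measurable_const) rfl
  have h2 : ∫⁻ ω, condMean C F 0 ω ∂π.traj x =
      ∫⁻ _, (∫⁻ η, F η ∂jointTraj C x) ∂π.traj x := lintegral_congr_ae h
  rw [h2]
  simp

/-- `condMean` is the Doob martingale of `F`: playing a chain reveals one step of its trajectory,
and `jointTraj_eq_bind` averages over it. The restriction to an event of the history up to `t`
allows the martingale to be stopped. -/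
lemma setLIntegral_condMean_succ {F : (∀ i, ℕ → S i) → ℝ≥0∞} (hF : Measurable F) (x : ∀ i, S i)
    (t : ℕ) :
    ∫⁻ ω in {ω | ∀ v ≤ t, ¬ Ended C k (ω v).1}, condMean C F (t + 1) ω ∂π.traj x =
      ∫⁻ ω in {ω | ∀ v ≤ t, ¬ Ended C k (ω v).1}, condMean C F t ω ∂π.traj x := by
  have hA := measurableSet_running C k t
  rw [← lintegral_indicator hA, ← lintegral_indicator hA]
  set A := {ω : ℕ → (∀ i, S i) × Fin n | ∀ v ≤ t, ¬ Ended C k (ω v).1} with hAdef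
  have hm := measurable_lintegral_glue C hF (t + 1)
  have key := π.lintegral_traj_next_state x t
    (Φ := fun q => A.indicator (fun _ => 1) q.1 * ∫⁻ η, F (glue (t + 1) q.1 η) ∂jointTraj C q.2)
    (((measurable_const.indicator hA).comp measurable_fst).mul hm) (fun ω ω' y h => by
      have h1 : ω ∈ A ↔ ω' ∈ A :=
        forall_congr' fun v => forall_congr' fun hv => by rw [h v hv]
      have h2 (η : ∀ i, ℕ → S i) : glue (t + 1) ω η = glue (t + 1) ω' η :=
        glue_congr (fun v hv => h v (by omega)) η
      simp only [h2]
      congr 1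
      by_cases h3 : ω ∈ A
      · rw [Set.indicator_of_mem h3, Set.indicator_of_mem (h1.1 h3)]
      · rw [Set.indicator_of_notMem h3, Set.indicator_of_notMem (fun h4 => h3 (h1.2 h4))])
  have e1 (ω : ℕ → (∀ i, S i) × Fin n) : A.indicator (condMean C F (t + 1)) ω =
      A.indicator (fun _ => 1) ω *
        ∫⁻ η, F (glue (t + 1) ω η) ∂jointTraj C (ω (t + 1)).1 := by
    by_cases h : ω ∈ A
    · rw [Set.indicator_of_mem h, Set.indicator_of_mem h, one_mul]; rfl
    · rw [Set.indicator_of_notMem h, Set.indicator_of_notMem h, zero_mul]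
  have e2 (ω : ℕ → (∀ i, S i) × Fin n) : A.indicator (condMean C F t) ω =
      ∫⁻ y, A.indicator (fun _ => 1) ω *
        ∫⁻ η, F (glue (t + 1) ω η) ∂jointTraj C y ∂step C (ω t) := by
    have hm' : Measurable fun y => ∫⁻ η, F (glue (t + 1) ω η) ∂jointTraj C y :=
      (hF.comp (measurable_glue_right (t + 1) ω)).lintegral_kernel (κ := jointKernel C)
    rw [lintegral_const_mul _ hm']
    have h1 := lintegral_jointTraj_push C (ω t) (F := fun η => F (glue t ω η))
      (hF.comp (measurable_glue_right t ω))
    have h2 : ∫⁻ y, ∫⁻ η, F (glue (t + 1) ω η) ∂jointTraj C y ∂step C (ω t) =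
      condMean C F t ω := h1
    rw [h2]
    by_cases h : ω ∈ A
    · rw [Set.indicator_of_mem h, Set.indicator_of_mem h, one_mul]
    · rw [Set.indicator_of_notMem h, Set.indicator_of_notMem h, zero_mul]
  simp only [e1, e2]
  exact key

/-- Optional stopping at a bounded time: consecutive stopping times differ only where the process is
still running, and there they equal `N` and `N + 1`. -/
lemma lintegral_condMean_stopTime {F : (∀ i, ℕ → S i) → ℝ≥0∞} (hF : Measurable F) (x : ∀ i, S i)
    (N : ℕ) : ∫⁻ ω, condMean C F (stopTime C k N ω) ω ∂π.traj x = ∫⁻ η, F η ∂jointTraj C x := by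
  induction N with
  | zero => exact π.lintegral_condMean_zero hF x
  | succ N ih =>
    rw [← ih]
    have hA := measurableSet_running C k N
    rw [← lintegral_add_compl _ hA,
      ← lintegral_add_compl (fun ω => condMean C F (stopTime C k N ω) ω) hA]
    congr 1
    · have h1 : ∫⁻ ω in {ω | ∀ v ≤ N, ¬ Ended C k (ω v).1},
          condMean C F (stopTime C k (N + 1) ω) ω ∂π.traj x =
          ∫⁻ ω in {ω | ∀ v ≤ N, ¬ Ended C k (ω v).1}, condMean C F (N + 1) ω ∂π.traj x :=
        setLIntegral_congr_fun hA fun ω hω => by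
          rw [stopTime_of_running C k fun v hv => hω v (by omega)]
      have h2 : ∫⁻ ω in {ω | ∀ v ≤ N, ¬ Ended C k (ω v).1},
          condMean C F (stopTime C k N ω) ω ∂π.traj x =
          ∫⁻ ω in {ω | ∀ v ≤ N, ¬ Ended C k (ω v).1}, condMean C F N ω ∂π.traj x :=
        setLIntegral_congr_fun hA fun ω hω => by
          rw [stopTime_of_running C k fun v hv => hω v (by omega)]
      rw [h1, h2, π.setLIntegral_condMean_succ hF]
    · refine setLIntegral_congr_fun hA.compl fun ω hω => ?_
      have : stopTime C k (N + 1) ω = stopTime C k N ω := by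
        rw [stopTime, if_neg (show ¬ ∀ v ≤ N, ¬ Ended C k (ω v).1 from hω)]
      rw [this]

lemma ae_action_mem_active (x : ∀ i, S i) :
    ∀ᵐ ω ∂π.traj x, ∀ t, ¬ Ended C k (ω t).1 → (ω t).2 ∈ active C (ω t).1 := by
  refine π.ae_traj_action x (p := fun e => ¬ Ended C k e.1 → e.2 ∈ active C e.1) ?_ (fun x => ?_)
    (fun t h x => ?_)
  · refine measurableSet_pair fun a => ?_
    simp only [mem_active]
    exact measurableSet_ended.compl.imp (measurableSet_mem_terminal a).compl
  · by_cases hx : Ended C k x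
    · exact Eventually.of_forall fun a h => absurd hx h
    · exact (π.first_allowed x hx).mono fun a ha _ => ha
  · by_cases hx : Ended C k x
    · exact Eventually.of_forall fun a h => absurd hx h
    · exact (π.next_allowed t h x hx).mono fun a ha _ => ha

/-- The process ends almost surely. -/
lemma ae_exists_ended (hC : ∀ i, (C i).Admissible) (x : ∀ i, S i) :
    ∀ᵐ ω ∂π.traj x, ∃ t, Ended C k (ω t).1 := by
  -- In `D m` some chain has its first `m` states non-terminal, an event of vanishing probability.
  -- If the process runs for `n * m` steps, by pigeonhole some chain is played at least `m` times,
  -- each time from a non-terminal state, so all glued trajectories lie in `D m`.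
  set D : ℕ → Set (∀ i, ℕ → S i) := fun m => ⋃ i, {ζ | ∀ j < m, ζ i j ∉ (C i).terminal} with hD
  have hmD (m : ℕ) : MeasurableSet (D m) := by
    refine .iUnion fun i => ?_
    simp only [Set.ofPred_forall]
    refine .iInter fun j => .iInter fun _ => ?_
    have hm : Measurable fun ζ : ∀ i, ℕ → S i => ζ i j := by fun_prop
    exact (hm (C i).measurableSet_terminal).compl
  have hlim : Tendsto (fun m => ∫⁻ ζ, (D m).indicator (fun _ => 1) ζ ∂jointTraj C x) atTop
      (𝓝 (∫⁻ _, 0 ∂jointTraj C x)) := by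
    refine tendsto_lintegral_of_dominated_convergence (fun _ => 1)
      (fun m => measurable_const.indicator (hmD m))
      (fun m => Eventually.of_forall fun ζ => Set.indicator_le_self' (fun _ _ => zero_le_one) _)
      (by simp) ?_
    have h1 : ∀ᵐ ζ ∂jointTraj C x, ∀ i, ∃ t, ζ i t ∈ (C i).terminal :=
      ae_all_iff.2 fun i => ae_jointTraj_eval C (hC i (x i)).1
    filter_upwards [h1] with ζ hζ
    choose T hT using hζ
    refine tendsto_const_nhds.congr' ?_
    filter_upwards [eventually_gt_atTop (Finset.univ.sup T)] with m hm
    refine (Set.indicator_of_notMem (fun h => ?_) _).symm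
    obtain ⟨i, hi⟩ := Set.mem_iUnion.1 h
    exact hi (T i) (lt_of_le_of_lt (Finset.le_sup (Finset.mem_univ i)) hm) (hT i)
  have hbound (m : ℕ) : π.traj x {ω | ∀ t, ¬ Ended C k (ω t).1} ≤
      ∫⁻ ζ, (D m).indicator (fun _ => 1) ζ ∂jointTraj C x := by
    have hmF : Measurable ((D m).indicator fun _ => (1 : ℝ≥0∞)) :=
      measurable_const.indicator (hmD m)
    rw [← π.lintegral_condMean_stopTime hmF x (n * m)]
    have hms : MeasurableSet {ω : ℕ → (∀ i, S i) × Fin n | ∀ t, ¬ Ended C k (ω t).1} := by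
      have : {ω : ℕ → (∀ i, S i) × Fin n | ∀ t, ¬ Ended C k (ω t).1} =
          ⋂ N, {ω | ∀ v ≤ N, ¬ Ended C k (ω v).1} := by
        ext ω
        simp only [Set.mem_ofPred_eq, Set.mem_iInter]
        exact ⟨fun h N v _ => h v, fun h t => h t t le_rfl⟩
      rw [this]
      exact .iInter fun N => measurableSet_running C k N
    rw [← lintegral_indicator_one hms]
    refine lintegral_mono_ae ?_
    filter_upwards [π.ae_action_mem_active x] with ω hω
    by_cases h : ω ∈ {ω : ℕ → (∀ i, S i) × Fin n | ∀ t, ¬ Ended C k (ω t).1}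
    · rw [Set.indicator_of_mem h, stopTime_of_running C k fun v _ => h v]
      have hne : (Finset.univ : Finset (Fin n)).Nonempty := ⟨(ω 0).2, Finset.mem_univ _⟩
      obtain ⟨i, -, hi⟩ := Finset.exists_le_of_sum_le hne (f := fun _ => m)
        (g := playCount (n * m) ω) (by rw [sum_playCount]; simp)
      have h1 (η : ∀ i, ℕ → S i) : glue (n * m) ω η ∈ D m :=
        Set.mem_iUnion.2 ⟨i, fun j hj => glue_notMem_terminal C (fun v _ => hω v (h v)) η i
          (lt_of_lt_of_le hj hi)⟩
      unfold condMean
      simp [Set.indicator_of_mem (h1 _)]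
    · rw [Set.indicator_of_notMem h]
      exact zero_le
  have h0 : π.traj x {ω | ∀ t, ¬ Ended C k (ω t).1} = 0 := by
    have := ge_of_tendsto' hlim hbound
    rw [lintegral_zero] at this
    exact le_antisymm this zero_le
  filter_upwards [measure_eq_zero_iff_ae_notMem.1 h0] with ω hω
  by_contra hn
  push Not at hn
  exact hω hn

end Policy

end MCS

/-! ### The end time and the coupling with independent full trajectories. -/

namespace MCS

variable {n : ℕ} {S : Fin n → Type u} [∀ i, MeasurableSpace (S i)] (C : ∀ i, RewardChain (S i))
  (k : ℕ)

/-- Makes `Nat.find` applicable to every path; on a path that never ends the end time is `0`. -/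
lemma exists_ended_or_forall (ω : ℕ → (∀ i, S i) × Fin n) :
    ∃ t, Ended C k (ω t).1 ∨ ∀ v, ¬ Ended C k (ω v).1 := by
  by_cases h : ∃ t, Ended C k (ω t).1
  · exact h.imp fun t => Or.inl
  · exact ⟨0, Or.inr fun v hv => h ⟨v, hv⟩⟩

open Classical in
/-- The time at which the process ends. -/
def endTime (ω : ℕ → (∀ i, S i) × Fin n) : ℕ := Nat.find (exists_ended_or_forall C k ω)

lemma measurable_endTime : Measurable (endTime C k) := by
  classical
  refine measurable_find _ fun t => ?_
  have hm (t : ℕ) : MeasurableSet {ω : ℕ → (∀ i, S i) × Fin n | Ended C k (ω t).1} := by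
    have h : Measurable fun ω : ℕ → (∀ i, S i) × Fin n => (ω t).1 := by fun_prop
    exact h measurableSet_ended
  have h2 : MeasurableSet {ω : ℕ → (∀ i, S i) × Fin n | ∀ v, ¬ Ended C k (ω v).1} := by
    simp only [Set.ofPred_forall]
    exact .iInter fun v => (hm v).compl
  exact (hm t).union h2

variable {C k}

lemma ended_endTime {ω : ℕ → (∀ i, S i) × Fin n} (h : ∃ t, Ended C k (ω t).1) :
    Ended C k (ω (endTime C k ω)).1 := by
  classical
  obtain ⟨t, ht⟩ := h
  exact (Nat.find_spec (exists_ended_or_forall C k ω)).resolve_right fun hn => hn t ht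

lemma not_ended_of_lt_endTime {ω : ℕ → (∀ i, S i) × Fin n} {v : ℕ} (hv : v < endTime C k ω) :
    ¬ Ended C k (ω v).1 := by
  classical
  exact fun hn => Nat.find_min (exists_ended_or_forall C k ω) hv (Or.inl hn)

lemma stopTime_eq_min {ω : ℕ → (∀ i, S i) × Fin n} (h : ∃ t, Ended C k (ω t).1) (N : ℕ) :
    stopTime C k N ω = min N (endTime C k ω) := by
  induction N with
  | zero => simp [stopTime]
  | succ N ih =>
    rw [stopTime, ih]
    split_ifs with hr
    · have : N < endTime C k ω := by
        by_contra! hle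
        exact hr _ hle (ended_endTime h)
      omega
    · have : ¬ N < endTime C k ω := fun hlt =>
        hr fun v hv => not_ended_of_lt_endTime (lt_of_le_of_lt hv hlt)
      omega

lemma measurable_endState :
    Measurable fun ω : ℕ → (∀ i, S i) × Fin n => (ω (endTime C k ω)).1 :=
  measurable_apply_nat (f := fun t (ω : ℕ → (∀ i, S i) × Fin n) => (ω t).1)
    (fun t => by fun_prop) (measurable_endTime C k)

/-- The full trajectories of the chains, from the trajectory of the process and the trajectories
that the chains follow after the end of the process. -/
def merged (C : ∀ i, RewardChain (S i)) (k : ℕ)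
    (q : (ℕ → (∀ i, S i) × Fin n) × (∀ i, ℕ → S i)) : ∀ i, ℕ → S i :=
  glue (endTime C k q.1) q.1 q.2

lemma measurable_merged : Measurable (merged C k) :=
  measurable_apply_nat (f := fun t (q : (ℕ → (∀ i, S i) × Fin n) × (∀ i, ℕ → S i)) =>
    glue t q.1 q.2) measurable_glue ((measurable_endTime C k).comp measurable_fst)

/-- The law of the trajectories that the chains follow after the end of the process. -/
def endKernel (C : ∀ i, RewardChain (S i)) (k : ℕ) :
    Kernel (ℕ → (∀ i, S i) × Fin n) (∀ i, ℕ → S i) :=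
  (jointKernel C).comap (fun ω => (ω (endTime C k ω)).1) measurable_endState

instance : IsMarkovKernel (endKernel C k) := by unfold endKernel; infer_instance

lemma endKernel_apply (ω : ℕ → (∀ i, S i) × Fin n) :
    endKernel C k ω = jointTraj C (ω (endTime C k ω)).1 := rfl

namespace Policy

variable (π : Policy C k)

/-- The joint law of the trajectory of the process and of the trajectories that the chains follow
after its end. -/
def coupling (x : ∀ i, S i) : Measure ((ℕ → (∀ i, S i) × Fin n) × (∀ i, ℕ → S i)) :=
  π.traj x ⊗ₘ endKernel C k

/-- Optional stopping at the end time, by bounded convergence of `lintegral_condMean_stopTime`.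
Expectations of functions of the full trajectories therefore do not depend on the policy. -/
lemma map_merged (hC : ∀ i, (C i).Admissible) (x : ∀ i, S i) :
    (π.coupling x).map (merged C k) = jointTraj C x := by
  refine Measure.ext fun s hs => ?_
  have hF : Measurable (s.indicator fun _ => (1 : ℝ≥0∞)) := measurable_const.indicator hs
  have e1 : jointTraj C x s = ∫⁻ η, s.indicator (fun _ => 1) η ∂jointTraj C x := by
    rw [lintegral_indicator hs]; simp
  have e2 : (π.coupling x).map (merged C k) s =
      ∫⁻ ω, condMean C (s.indicator fun _ => 1) (endTime C k ω) ω ∂π.traj x := by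
    have h1 : (π.coupling x).map (merged C k) s =
        ∫⁻ η, s.indicator (fun _ => 1) η ∂(π.coupling x).map (merged C k) := by
      rw [lintegral_indicator hs]; simp
    rw [h1, lintegral_map hF measurable_merged]
    exact Measure.lintegral_compProd (f := fun q => s.indicator (fun _ => 1) (merged C k q))
      (hF.comp measurable_merged)
  rw [e1, e2]
  have hlim : Tendsto (fun N => ∫⁻ ω, condMean C (s.indicator fun _ => 1) (stopTime C k N ω) ω
      ∂π.traj x) atTop
      (𝓝 (∫⁻ ω, condMean C (s.indicator fun _ => 1) (endTime C k ω) ω ∂π.traj x)) := by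
    refine tendsto_lintegral_of_dominated_convergence (fun _ => 1)
      (fun N => measurable_condMean_comp C hF (measurable_stopTime C k N))
      (fun N => Eventually.of_forall fun ω => ?_) (by simp) ?_
    · refine (lintegral_mono fun η => Set.indicator_le_self' (fun _ _ => zero_le_one) _).trans ?_
      simp
    · filter_upwards [π.ae_exists_ended hC x] with ω hω
      refine tendsto_const_nhds.congr' ?_
      filter_upwards [eventually_ge_atTop (endTime C k ω)] with N hN
      rw [stopTime_eq_min hω, min_eq_right hN]
  simp only [π.lintegral_condMean_stopTime hF] at hlim
  exact tendsto_nhds_unique hlim tendsto_const_nhds |>.symm ▸ rfl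

lemma ae_merged (hC : ∀ i, (C i).Admissible) {x : ∀ i, S i} {p : (∀ i, ℕ → S i) → Prop}
    (h : ∀ᵐ ζ ∂jointTraj C x, p ζ) : ∀ᵐ q ∂π.coupling x, p (merged C k q) := by
  rw [← π.map_merged hC x] at h
  exact ae_of_ae_map measurable_merged.aemeasurable h

lemma integral_merged (hC : ∀ i, (C i).Admissible) (x : ∀ i, S i) {F : (∀ i, ℕ → S i) → ℝ}
    (hF : Measurable F) : ∫ q, F (merged C k q) ∂π.coupling x = ∫ ζ, F ζ ∂jointTraj C x := by
  rw [← π.map_merged hC x, integral_map measurable_merged.aemeasurable hF.aestronglyMeasurable]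

lemma lintegral_merged (hC : ∀ i, (C i).Admissible) (x : ∀ i, S i) {F : (∀ i, ℕ → S i) → ℝ≥0∞}
    (hF : Measurable F) : ∫⁻ q, F (merged C k q) ∂π.coupling x = ∫⁻ ζ, F ζ ∂jointTraj C x := by
  rw [← π.map_merged hC x, lintegral_map hF measurable_merged]

lemma integrable_merged (hC : ∀ i, (C i).Admissible) (x : ∀ i, S i) {F : (∀ i, ℕ → S i) → ℝ}
    (hi : Integrable F (jointTraj C x)) :
    Integrable (fun q => F (merged C k q)) (π.coupling x) := by
  rw [← π.map_merged hC x] at hi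
  exact hi.comp_measurable measurable_merged

lemma ae_coupling_fst {x : ∀ i, S i} {p : (ℕ → (∀ i, S i) × Fin n) → Prop}
    (h : ∀ᵐ ω ∂π.traj x, p ω) : ∀ᵐ q ∂π.coupling x, p q.1 := by
  have e : (π.coupling x).map Prod.fst = π.traj x := Measure.fst_compProd _ _
  rw [← e] at h
  exact ae_of_ae_map measurable_fst.aemeasurable h

lemma ae_coupling {x : ∀ i, S i} {p : (ℕ → (∀ i, S i) × Fin n) × (∀ i, ℕ → S i) → Prop}
    (hp : MeasurableSet {q | p q})
    (h : ∀ᵐ ω ∂π.traj x, ∀ᵐ η ∂jointTraj C (ω (endTime C k ω)).1, p (ω, η)) :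
    ∀ᵐ q ∂π.coupling x, p q :=
  (Measure.ae_compProd_iff hp).2 h

end Policy

end MCS

/-! ### Pathwise analysis: rewards, surrogate values and Gittins policies. -/

namespace MCS

variable {n : ℕ} {S : Fin n → Type u} [∀ i, MeasurableSpace (S i)] {C : ∀ i, RewardChain (S i)}
  {k : ℕ}

lemma sum_absReward_push (e : (∀ i, S i) × Fin n) (η : ∀ i, ℕ → S i) :
    ∑ i, (C i).absReward (push e η i) =
      ‖(C e.2).reward (e.1 e.2)‖ₑ + ∑ i, (C i).absReward (η i) := by
  rw [← Finset.add_sum_erase _ _ (Finset.mem_univ e.2),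
    ← Finset.add_sum_erase _ (fun i => (C i).absReward (η i)) (Finset.mem_univ e.2), push_self,
    RewardChain.absReward_seqCons, add_assoc]
  congr 2
  exact Finset.sum_congr rfl fun i hi => by rw [push_of_ne _ _ (Finset.ne_of_mem_erase hi)]

lemma sum_absReward_glue (t : ℕ) (ω : ℕ → (∀ i, S i) × Fin n) (η : ∀ i, ℕ → S i) :
    ∑ i, (C i).absReward (glue t ω η i) =
      ∑ v ∈ Finset.range t, ‖(C (ω v).2).reward ((ω v).1 (ω v).2)‖ₑ +
        ∑ i, (C i).absReward (η i) := by
  induction t generalizing η with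
  | zero => simp [glue]
  | succ t ih => rw [glue, ih, sum_absReward_push, Finset.sum_range_succ, add_assoc]

lemma sum_totalReward_push (e : (∀ i, S i) × Fin n) {η : ∀ i, ℕ → S i}
    (h : ∀ i, (C i).absReward (η i) < ∞) :
    ∑ i, (C i).totalReward (push e η i) =
      (C e.2).reward (e.1 e.2) + ∑ i, (C i).totalReward (η i) := by
  rw [← Finset.add_sum_erase _ _ (Finset.mem_univ e.2),
    ← Finset.add_sum_erase _ (fun i => (C i).totalReward (η i)) (Finset.mem_univ e.2), push_self,
    RewardChain.totalReward_seqCons _ (h _), add_assoc]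
  congr 2
  exact Finset.sum_congr rfl fun i hi => by rw [push_of_ne _ _ (Finset.ne_of_mem_erase hi)]

lemma sum_totalReward_glue (t : ℕ) (ω : ℕ → (∀ i, S i) × Fin n) {η : ∀ i, ℕ → S i}
    (h : ∀ i, (C i).absReward (η i) < ∞) :
    ∑ i, (C i).totalReward (glue t ω η i) =
      ∑ v ∈ Finset.range t, (C (ω v).2).reward ((ω v).1 (ω v).2) +
        ∑ i, (C i).totalReward (η i) := by
  induction t generalizing η with
  | zero => simp [glue]
  | succ t ih =>
    rw [glue, ih, sum_totalReward_push _ h, Finset.sum_range_succ, add_assoc]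
    intro i
    have h1 : ∑ i, (C i).absReward (push (ω t) η i) < ∞ := by
      rw [sum_absReward_push]
      exact ENNReal.add_lt_top.2 ⟨by simp, ENNReal.sum_lt_top.2 fun i _ => h i⟩
    exact lt_of_le_of_lt (Finset.single_le_sum (f := fun i => (C i).absReward (push (ω t) η i))
      (fun _ _ => zero_le) (Finset.mem_univ i)) h1

/-- The minimal Gittins index among the states in which chain `i` is played before time `t`. -/
def playedMin (C : ∀ i, RewardChain (S i)) (ω : ℕ → (∀ i, S i) × Fin n) (i : Fin n) : ℕ → EReal
  | 0 => ⊤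
  | t + 1 => if (ω t).2 = i then min (playedMin C ω i t) ((C i).gittins ((ω t).1 i))
      else playedMin C ω i t

lemma playedMin_self (ω : ℕ → (∀ i, S i) × Fin n) (t : ℕ) :
    playedMin C ω (ω t).2 (t + 1) =
      min (playedMin C ω (ω t).2 t) ((C (ω t).2).gittins ((ω t).1 (ω t).2)) := if_pos rfl

lemma playedMin_of_ne (ω : ℕ → (∀ i, S i) × Fin n) {t : ℕ} {i : Fin n} (h : i ≠ (ω t).2) :
    playedMin C ω i (t + 1) = playedMin C ω i t := if_neg h.symm

/-- All played states are non-terminal, so their indices enter the minimum that defines the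
surrogate value. -/
lemma surrogate_glue {t : ℕ} {ω : ℕ → (∀ i, S i) × Fin n}
    (h : ∀ v < t, (ω v).2 ∈ active C (ω v).1) (η : ∀ i, ℕ → S i) (i : Fin n) :
    (C i).surrogate (glue t ω η i) = min (playedMin C ω i t) ((C i).surrogate (η i)) := by
  induction t generalizing η with
  | zero => simp [glue, playedMin]
  | succ t ih =>
    rw [glue, ih fun v hv => h v (by omega)]
    by_cases hi : i = (ω t).2
    · subst hi
      rw [push_self, RewardChain.surrogate_seqCons (mem_active.1 (h t (Nat.lt_succ_self t))),
        playedMin_self, min_assoc]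
    · rw [push_of_ne _ _ hi, playedMin_of_ne _ hi]

/-- The properties of the trajectories of the process, started at `x`, that hold almost surely. -/
structure IsRegular (C : ∀ i, RewardChain (S i)) (k : ℕ) (x : ∀ i, S i)
    (ω : ℕ → (∀ i, S i) × Fin n) : Prop where
  active_zero : active C (ω 0).1 = active C x
  mem_active : ∀ t, ¬ Ended C k (ω t).1 → (ω t).2 ∈ active C (ω t).1
  active_succ : ∀ t j, j ≠ (ω t).2 → (j ∈ active C (ω (t + 1)).1 ↔ j ∈ active C (ω t).1)
  gittins_succ : ∀ t j, j ≠ (ω t).2 →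
    (C j).gittins ((ω (t + 1)).1 j) = (C j).gittins ((ω t).1 j)
  active_anti : ∀ t, active C (ω (t + 1)).1 ⊆ active C (ω t).1
  gittins_top : ∀ t, (ω t).2 ∈ active C (ω t).1 →
    (C (ω t).2).gittins ((ω t).1 (ω t).2) = ⊤ → (ω t).2 ∈ active C (ω (t + 1)).1
  exists_ended : ∃ t, Ended C k (ω t).1

lemma card_active_add (x : ∀ i, S i) : (active C x).card + (finished C x).card = n := by
  classical
  have := Finset.card_filter_add_card_filter_not (s := (Finset.univ : Finset (Fin n)))
    fun i => x i ∈ (C i).terminal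
  simp only [Finset.card_univ, Fintype.card_fin] at this
  rw [add_comm]
  unfold active finished
  convert! this

lemma ended_iff (x : ∀ i, S i) : Ended C k x ↔ k + (active C x).card ≤ n := by
  have := card_active_add (C := C) x
  unfold Ended
  omega

namespace IsRegular

variable {x : ∀ i, S i} {ω : ℕ → (∀ i, S i) × Fin n} (h : IsRegular C k x ω)
include h

lemma active_antitone {s t : ℕ} (hst : s ≤ t) : active C (ω t).1 ⊆ active C (ω s).1 := by
  induction t, hst using Nat.le_induction with
  | base => exact subset_rfl
  | succ t _ ih => exact (h.active_anti t).trans ih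

lemma active_subset (t : ℕ) : active C (ω t).1 ⊆ active C x :=
  h.active_zero ▸ h.active_antitone (Nat.zero_le t)

lemma ended_of_le {t : ℕ} (ht : endTime C k ω ≤ t) : Ended C k (ω t).1 := by
  have h1 := (ended_iff _).1 (ended_endTime h.exists_ended)
  have h2 := Finset.card_le_card (h.active_antitone ht)
  rw [ended_iff]
  omega

lemma action_mem_active {t : ℕ} (ht : t < endTime C k ω) : (ω t).2 ∈ active C (ω t).1 :=
  h.mem_active t (not_ended_of_lt_endTime ht)

lemma tsum_reward : ∑' t, reward C k (ω t) =
    ∑ v ∈ Finset.range (endTime C k ω), (C (ω v).2).reward ((ω v).1 (ω v).2) := by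
  rw [tsum_eq_sum (s := Finset.range (endTime C k ω))]
  · refine Finset.sum_congr rfl fun v hv => ?_
    rw [reward, if_neg (not_ended_of_lt_endTime (Finset.mem_range.1 hv))]
  · intro t ht
    rw [reward, if_pos (h.ended_of_le (not_lt.1 fun h1 => ht (Finset.mem_range.2 h1)))]

lemma tsum_enorm_reward : ∑' t, ‖reward C k (ω t)‖ₑ =
    ∑ v ∈ Finset.range (endTime C k ω), ‖(C (ω v).2).reward ((ω v).1 (ω v).2)‖ₑ := by
  rw [tsum_eq_sum (s := Finset.range (endTime C k ω))]
  · refine Finset.sum_congr rfl fun v hv => ?_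
    rw [reward, if_neg (not_ended_of_lt_endTime (Finset.mem_range.1 hv))]
  · intro t ht
    rw [reward, if_pos (h.ended_of_le (not_lt.1 fun h1 => ht (Finset.mem_range.2 h1)))]
    simp

/-- The last chain that is played reaches a terminal state. -/
lemma last_notMem_active {T : ℕ} (hT : endTime C k ω = T + 1) :
    (ω T).2 ∉ active C (ω (T + 1)).1 := by
  intro hmem
  have h1 : active C (ω (T + 1)).1 = active C (ω T).1 := by
    refine (h.active_anti T).antisymm fun j hj => ?_
    by_cases hja : j = (ω T).2
    · exact hja ▸ hmem
    · exact (h.active_succ T j hja).2 hj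
  have h2 := ended_endTime h.exists_ended
  rw [hT] at h2
  refine not_ended_of_lt_endTime (ω := ω) (C := C) (k := k) (v := T) (by omega) ?_
  rw [ended_iff] at h2 ⊢
  rwa [← h1]

lemma active_last {T : ℕ} (hT : endTime C k ω = T + 1) :
    active C (ω (T + 1)).1 = (active C (ω T).1).erase (ω T).2 := by
  ext j
  rw [Finset.mem_erase]
  by_cases hja : j = (ω T).2
  · simp only [hja, ne_eq, not_true_eq_false, false_and, iff_false]
    exact h.last_notMem_active hT
  · simp [hja, h.active_succ T j hja]

/-- The last play finishes exactly one chain, so the threshold `k` is not overshot. If the process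
has ended at the start, nothing finishes and the subtraction truncates to `0`. -/
lemma card_sdiff_active :
    (active C x \ active C (ω (endTime C k ω)).1).card = k - (finished C x).card := by
  rw [Finset.card_sdiff_of_subset (h.active_subset _)]
  have h0 := card_active_add (C := C) x
  have h2 := (ended_iff _).1 (ended_endTime h.exists_ended)
  have h4 := Finset.card_le_card (h.active_subset (endTime C k ω))
  rcases hT : endTime C k ω with _ | T
  · rw [hT] at h2
    rw [h.active_zero] at h2 ⊢
    omega
  · have h1 := h.action_mem_active (t := T) (by omega)
    have h3 : ¬ Ended C k (ω T).1 := not_ended_of_lt_endTime (by omega)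
    rw [ended_iff] at h3
    rw [hT] at h2 h4
    rw [h.active_last hT, Finset.card_erase_of_mem h1] at h2 h4 ⊢
    have h5 := Finset.card_le_card (h.active_subset T)
    have h6 : 0 < (active C (ω T).1).card := Finset.card_pos.2 ⟨_, h1⟩
    omega

section Gittins

variable (hG : ∀ t < endTime C k ω, IsGittinsAction C (ω t).1 (ω t).2)
include hG

/-- At most one active chain has an index above its played minimum, and it is then played until this
ceases; in the meantime no other active chain exceeds that minimum. For a finished chain the played
minimum dominates what the surrogate value of an active chain can reach. At time `0` all played
minima are `⊤`. -/
lemma gittins_invariant {t : ℕ} (ht : t ≤ endTime C k ω) :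
    (∀ i ∈ active C (ω t).1, playedMin C ω i t < (C i).gittins ((ω t).1 i) →
      ∀ j ∈ active C (ω t).1, j ≠ i → (C j).gittins ((ω t).1 j) ≤ playedMin C ω i t) ∧
    ∀ i, i ∉ active C (ω t).1 → ∀ j ∈ active C (ω t).1,
      min (playedMin C ω j t) ((C j).gittins ((ω t).1 j)) ≤ playedMin C ω i t := by
  induction t with
  | zero => exact ⟨fun i _ _ j _ _ => le_top, fun i _ j _ => le_top⟩
  | succ t ih =>
    obtain ⟨h1, h2⟩ := ih (by omega)
    obtain ⟨ha, hmax⟩ := hG t (by omega)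
    -- If the played chain was above its played minimum, the invariant bounds the other indices by
    -- that minimum; otherwise the maximality of its index does.
    have hK : ∀ j ∈ active C (ω t).1, j ≠ (ω t).2 →
        (C j).gittins ((ω t).1 j) ≤ playedMin C ω (ω t).2 (t + 1) := by
      intro j hj hja
      rw [playedMin_self]
      refine le_min ?_ (hmax j hj)
      rcases le_or_gt ((C (ω t).2).gittins ((ω t).1 (ω t).2)) (playedMin C ω (ω t).2 t) with h3 | h3
      · exact (hmax j hj).trans h3
      · exact h1 _ ha h3 j hj hja
    have hL : ∀ j ∈ active C (ω t).1, j ≠ (ω t).2 →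
        (C j).gittins ((ω t).1 j) ≤ playedMin C ω j t := by
      intro j hj hja
      by_contra! hlt
      exact absurd (hmax j hj) (not_le.2 ((h1 j hj hlt _ ha hja.symm).trans_lt hlt))
    refine ⟨fun i hi hlt j hj hji => ?_, fun i hi j hj => ?_⟩
    · by_cases hia : i = (ω t).2
      · subst hia
        rw [h.gittins_succ t j hji]
        exact hK j (h.active_anti t hj) hji
      · rw [playedMin_of_ne _ hia, h.gittins_succ t i hia] at hlt
        exact absurd (hL i (h.active_anti t hi) hia) (not_le.2 hlt)
    · by_cases hia : i = (ω t).2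
      · have hja : j ≠ (ω t).2 := fun h3 => hi (by rw [hia, ← h3]; exact hj)
        subst hia
        refine (min_le_right _ _).trans ?_
        rw [h.gittins_succ t j hja]
        exact hK j (h.active_anti t hj) hja
      · have hi' : i ∉ active C (ω t).1 := fun h3 => hi ((h.active_succ t i hia).2 h3)
        rw [playedMin_of_ne _ hia]
        by_cases hja : j = (ω t).2
        · subst hja
          refine (min_le_left _ _).trans ?_
          rw [playedMin_self]
          exact h2 i hi' _ ha
        · rw [playedMin_of_ne _ hja, h.gittins_succ t j hja]
          exact h2 i hi' j (h.active_anti t hj)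

/-- The only chain that might be above its played minimum would have been played last, and the chain
played last has finished. -/
lemma gittins_le_playedMin {i : Fin n} (hi : i ∈ active C (ω (endTime C k ω)).1) :
    (C i).gittins ((ω (endTime C k ω)).1 i) ≤ playedMin C ω i (endTime C k ω) := by
  rcases hT : endTime C k ω with _ | T
  · exact le_top
  · rw [hT] at hi
    have hia : i ≠ (ω T).2 := fun h1 => h.last_notMem_active hT (h1 ▸ hi)
    rw [playedMin_of_ne _ hia, h.gittins_succ T i hia]
    obtain ⟨ha, hmax⟩ := hG T (by omega)
    have hi' := h.active_anti T hi
    by_contra! hlt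
    exact absurd (hmax i hi')
      (not_le.2 (((h.gittins_invariant hG (t := T) (by omega)).1 i hi' hlt _ ha hia.symm).trans_lt
        hlt))

/-- The last chain played reached a terminal state in one step, so its index was finite, and it was
the greatest one. -/
lemma gittins_ne_top_of_not_ended (hx : ¬ Ended C k x) {i : Fin n}
    (hi : i ∈ active C (ω (endTime C k ω)).1) :
    (C i).gittins ((ω (endTime C k ω)).1 i) ≠ ⊤ := by
  rcases hT : endTime C k ω with _ | T
  · have h1 := ended_endTime h.exists_ended
    rw [hT, ended_iff, h.active_zero, ← ended_iff] at h1
    exact absurd h1 hx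
  · rw [hT] at hi
    have hia : i ≠ (ω T).2 := fun h1 => h.last_notMem_active hT (h1 ▸ hi)
    rw [h.gittins_succ T i hia]
    obtain ⟨ha, hmax⟩ := hG T (by omega)
    refine ((hmax i (h.active_anti T hi)).trans_lt (lt_top_iff_ne_top.2 fun h1 => ?_)).ne
    exact h.last_notMem_active hT (h.gittins_top T ha h1)

end Gittins

end IsRegular

/-! ### Sums of the largest entries. -/

section TopSum

lemma sum_le_topSum {J I : Finset (Fin n)} {m : ℕ} (v : Fin n → ℝ) (hI : I ⊆ J) (hm : I.card = m) :
    ∑ i ∈ I, v i ≤ topSum J m v :=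
  le_ciSup (f := fun I : Finset.powersetCard m J => ∑ i ∈ I.1, v i) (Set.finite_range _).bddAbove
    ⟨I, Finset.mem_powersetCard.2 ⟨hI, hm⟩⟩

/-- Exchange argument: after cancelling the common part, `I' \ I` and `I \ I'` have equal
cardinality, and the least value on `I \ I'` separates the two sums. -/
lemma topSum_eq_sum {J I : Finset (Fin n)} {m : ℕ} {v : Fin n → ℝ} (hI : I ⊆ J) (hm : I.card = m)
    (h : ∀ i ∈ I, ∀ j ∈ J \ I, v j ≤ v i) : topSum J m v = ∑ i ∈ I, v i := by
  refine le_antisymm ?_ (sum_le_topSum v hI hm)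
  have : Nonempty (Finset.powersetCard m J) := ⟨⟨I, Finset.mem_powersetCard.2 ⟨hI, hm⟩⟩⟩
  refine ciSup_le fun I' => ?_
  obtain ⟨I', hI'⟩ := I'
  obtain ⟨hI'J, hm'⟩ := Finset.mem_powersetCard.1 hI'
  have hcard : (I' \ I).card = (I \ I').card :=
    Finset.card_sdiff_comm (hm'.trans hm.symm)
  have h1 := Finset.sum_inter_add_sum_sdiff I' I v
  have h2 := Finset.sum_inter_add_sum_sdiff I I' v
  rw [Finset.inter_comm] at h2
  suffices ∑ i ∈ I' \ I, v i ≤ ∑ i ∈ I \ I', v i by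
    simp only
    linarith
  rcases (I \ I').eq_empty_or_nonempty with he | hne
  · rw [he, Finset.card_empty, Finset.card_eq_zero] at hcard
    rw [he, hcard]
  · obtain ⟨i, hi, hmin⟩ := Finset.exists_min_image (I \ I') v hne
    have h3 : ∑ j ∈ I' \ I, v j ≤ (I' \ I).card • v i :=
      Finset.sum_le_card_nsmul _ _ _ fun j hj =>
        h i (Finset.mem_sdiff.1 hi).1 j (Finset.mem_sdiff.2 ⟨hI'J (Finset.mem_sdiff.1 hj).1,
          (Finset.mem_sdiff.1 hj).2⟩)
    have h4 : (I \ I').card • v i ≤ ∑ j ∈ I \ I', v j :=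
      Finset.card_nsmul_le_sum _ _ _ fun j hj => hmin j hj
    rw [hcard] at h3
    exact h3.trans h4

lemma abs_topSum_le (J : Finset (Fin n)) {m : ℕ} (hm : m ≤ J.card) (v : Fin n → ℝ) :
    |topSum J m v| ≤ ∑ i ∈ J, |v i| := by
  obtain ⟨I, hI, hIm⟩ := Finset.exists_subset_card_eq hm
  have hle (I' : Finset (Fin n)) (hI' : I' ⊆ J) : |∑ i ∈ I', v i| ≤ ∑ i ∈ J, |v i| :=
    (Finset.abs_sum_le_sum_abs _ _).trans
      (Finset.sum_le_sum_of_subset_of_nonneg hI' fun _ _ _ => abs_nonneg _)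
  have : Nonempty (Finset.powersetCard m J) := ⟨⟨I, Finset.mem_powersetCard.2 ⟨hI, hIm⟩⟩⟩
  refine abs_le.2 ⟨(abs_le.1 (hle I hI)).1.trans (sum_le_topSum v hI hIm), ciSup_le fun I' => ?_⟩
  exact (abs_le.1 (hle I'.1 (Finset.mem_powersetCard.1 I'.2).1)).2

lemma measurable_topSum (J : Finset (Fin n)) (m : ℕ) : Measurable (topSum J m) := by
  unfold topSum
  exact Measurable.iSup fun I => by fun_prop

end TopSum

end MCS

/-! ### Almost sure regularity of the paths and integrability of the rewards. -/

namespace MCS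

variable {n : ℕ} {S : Fin n → Type u} [∀ i, MeasurableSpace (S i)] {C : ∀ i, RewardChain (S i)}
  {k : ℕ}

/-- How the activity and the Gittins index of chain `j` may change in one step. -/
def IsRegularStep (C : ∀ i, RewardChain (S i)) (j : Fin n)
    (q : ((∀ i, S i) × Fin n) × (∀ i, S i)) : Prop :=
  (j ≠ q.1.2 → (q.2 j ∈ (C j).terminal ↔ q.1.1 j ∈ (C j).terminal) ∧
    (C j).gittins (q.2 j) = (C j).gittins (q.1.1 j)) ∧
  (q.1.1 j ∈ (C j).terminal → q.2 j ∈ (C j).terminal) ∧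
  (j = q.1.2 → q.1.1 j ∉ (C j).terminal → (C j).gittins (q.1.1 j) = ⊤ → q.2 j ∉ (C j).terminal)

lemma measurableSet_isRegularStep (hC : ∀ i, (C i).Admissible) (j : Fin n) :
    MeasurableSet {q | IsRegularStep C j q} := by
  have h1 : MeasurableSet {q : ((∀ i, S i) × Fin n) × (∀ i, S i) | q.1.1 j ∈ (C j).terminal} :=
    (by fun_prop : Measurable fun q : ((∀ i, S i) × Fin n) × (∀ i, S i) => q.1.1 j)
      (C j).measurableSet_terminal
  have h2 : MeasurableSet {q : ((∀ i, S i) × Fin n) × (∀ i, S i) | q.2 j ∈ (C j).terminal} :=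
    (by fun_prop : Measurable fun q : ((∀ i, S i) × Fin n) × (∀ i, S i) => q.2 j)
      (C j).measurableSet_terminal
  have h3 : MeasurableSet {q : ((∀ i, S i) × Fin n) × (∀ i, S i) | j = q.1.2} :=
    (by fun_prop : Measurable fun q : ((∀ i, S i) × Fin n) × (∀ i, S i) => q.1.2)
      (measurableSet_eq (a := j)) |>.congr (by ext; simp [eq_comm])
  have hg := (hC j).measurable_gittins
  have h4 : MeasurableSet {q : ((∀ i, S i) × Fin n) × (∀ i, S i) |
      (C j).gittins (q.2 j) = (C j).gittins (q.1.1 j)} :=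
    measurableSet_eq_fun (by fun_prop) (by fun_prop)
  have h5 : MeasurableSet {q : ((∀ i, S i) × Fin n) × (∀ i, S i) |
      (C j).gittins (q.1.1 j) = ⊤} :=
    measurableSet_eq_fun (by fun_prop) (by fun_prop)
  exact (h3.compl.imp ((h2.iff h1).inter h4)).inter
    ((h1.imp h2).inter (h3.imp (h1.compl.imp (h5.imp h2.compl))))

lemma ae_isRegularStep (hC : ∀ i, (C i).Admissible) (j : Fin n) (e : (∀ i, S i) × Fin n) :
    ∀ᵐ y ∂step C e, IsRegularStep C j (e, y) := by
  rw [ae_step_iff C e (p := fun y => IsRegularStep C j (e, y))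
    (measurable_prodMk_left (measurableSet_isRegularStep hC j))]
  obtain ⟨x, a⟩ := e
  dsimp only
  by_cases hj : j = a
  · subst hj
    have h1 : ∀ᵐ z ∂(C j).step (x j), x j ∈ (C j).terminal → z ∈ (C j).terminal := by
      by_cases hx : x j ∈ (C j).terminal
      · rw [(C j).absorbing _ hx]
        exact ((ae_dirac_iff (C j).measurableSet_terminal).2 hx).mono fun z hz _ => hz
      · exact Eventually.of_forall fun z h => absurd h hx
    have h2 : ∀ᵐ z ∂(C j).step (x j), x j ∉ (C j).terminal → (C j).gittins (x j) = ⊤ →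
        z ∉ (C j).terminal := by
      by_cases hx : x j ∉ (C j).terminal ∧ (C j).gittins (x j) = ⊤
      · exact ((hC j).ae_notMem_terminal hx.1 hx.2).mono fun z hz _ _ => hz
      · exact Eventually.of_forall fun z h h' => absurd ⟨h, h'⟩ hx
    filter_upwards [h1, h2] with z hz1 hz2
    refine ⟨fun h => absurd rfl h, ?_, fun _ => ?_⟩
    · simpa using hz1
    · simpa using hz2
  · refine Eventually.of_forall fun z => ⟨fun _ => ?_, ?_, fun h => absurd h hj⟩
    · simp [Function.update_of_ne hj]
    · simp [Function.update_of_ne hj]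

namespace Policy

variable (π : Policy C k)

lemma ae_isRegular (hC : ∀ i, (C i).Admissible) (x : ∀ i, S i) :
    ∀ᵐ ω ∂π.traj x, IsRegular C k x ω := by
  have h0 : ∀ᵐ ω ∂π.traj x, finished C (ω 0).1 = finished C x :=
    π.ae_traj_state_zero x (p := fun y => finished C y = finished C x)
      (measurableSet_of_finished fun s => s = finished C x) rfl
  have h1 : ∀ᵐ ω ∂π.traj x, ∀ t j, IsRegularStep C j (ω t, (ω (t + 1)).1) :=
    ae_all_iff.2 fun t => ae_all_iff.2 fun j =>
      π.ae_traj_next_state x t (measurableSet_isRegularStep hC j) (ae_isRegularStep hC j)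
  filter_upwards [h0, h1, π.ae_action_mem_active x, π.ae_exists_ended hC x] with ω h0 h1 h2 h3
  refine ⟨?_, h2, fun t j hj => ?_, fun t j hj => ((h1 t j).1 hj).2, fun t j hj => ?_,
    fun t ht hG => ?_, h3⟩
  · ext i
    rw [mem_active, mem_active, ← mem_finished, ← mem_finished, h0]
  · rw [mem_active, mem_active]
    exact not_congr ((h1 t j).1 hj).1
  · rw [mem_active] at hj ⊢
    exact fun h => hj ((h1 t j).2.1 h)
  · rw [mem_active] at ht ⊢
    exact (h1 t _).2.2 rfl ht hG

end Policy

lemma measurableSet_isGittinsAction (hC : ∀ i, (C i).Admissible) :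
    MeasurableSet {e : (∀ i, S i) × Fin n | IsGittinsAction C e.1 e.2} := by
  refine measurableSet_pair (p := fun e => IsGittinsAction C e.1 e.2) fun a => ?_
  simp only [IsGittinsAction, mem_active]
  have h : MeasurableSet {x : ∀ i, S i |
      ∀ j, x j ∉ (C j).terminal → (C j).gittins (x j) ≤ (C a).gittins (x a)} := by
    simp only [Set.ofPred_forall]
    refine .iInter fun j => ?_
    have h1 : MeasurableSet {x : ∀ i, S i | (C j).gittins (x j) ≤ (C a).gittins (x a)} := by
      have := (hC j).measurable_gittins
      have := (hC a).measurable_gittins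
      exact measurableSet_le (by fun_prop) (by fun_prop)
    exact ((measurableSet_mem_terminal j).compl.imp h1 :)
  exact (measurableSet_mem_terminal a).compl.inter h

namespace Policy

variable (π : Policy C k)

lemma IsGittins.ae_isGittinsAction {π : Policy C k} (hπ : π.IsGittins)
    (hC : ∀ i, (C i).Admissible) (x : ∀ i, S i) :
    ∀ᵐ ω ∂π.traj x, ∀ t < endTime C k ω, IsGittinsAction C (ω t).1 (ω t).2 := by
  have h : ∀ᵐ ω ∂π.traj x, ∀ t, ¬ Ended C k (ω t).1 → IsGittinsAction C (ω t).1 (ω t).2 := by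
    refine π.ae_traj_action x (p := fun e => ¬ Ended C k e.1 → IsGittinsAction C e.1 e.2) ?_
      (fun y => ?_) (fun t h y => ?_)
    · have : MeasurableSet {e : (∀ i, S i) × Fin n | Ended C k e.1} :=
        measurable_fst measurableSet_ended
      exact this.compl.imp (measurableSet_isGittinsAction hC)
    · by_cases hy : Ended C k y
      · exact Eventually.of_forall fun a h => absurd hy h
      · exact (hπ.1 y hy).mono fun a ha _ => ha
    · by_cases hy : Ended C k y
      · exact Eventually.of_forall fun a h => absurd hy h
      · exact (hπ.2 t h y hy).mono fun a ha _ => ha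
  filter_upwards [h] with ω hω t ht using hω t (not_ended_of_lt_endTime ht)

/-- The rewards are absolutely integrable under every policy. -/
lemma lintegral_tsum_enorm_reward_lt_top (hC : ∀ i, (C i).Admissible) (x : ∀ i, S i) :
    ∫⁻ ω, ∑' t, ‖reward C k (ω t)‖ₑ ∂π.traj x < ∞ := by
  have hm : Measurable fun ζ : ∀ i, ℕ → S i => ∑ i, (C i).absReward (ζ i) := by fun_prop
  have h1 : ∫⁻ ζ, ∑ i, (C i).absReward (ζ i) ∂jointTraj C x = ∑ i, (C i).absValue (x i) := by
    rw [lintegral_finsetSum _ fun i _ => by fun_prop]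
    refine Finset.sum_congr rfl fun i _ => ?_
    rw [RewardChain.absValue, ← map_eval_jointTraj C x i,
      lintegral_map (C i).measurable_absReward (measurable_pi_apply i)]
  have h2 : ∫⁻ q, ∑ i, (C i).absReward (merged C k q i) ∂π.coupling x < ∞ := by
    rw [π.lintegral_merged hC x hm, h1]
    exact ENNReal.sum_lt_top.2 fun i _ => (hC i).absValue_lt_top _
  refine lt_of_le_of_lt ?_ h2
  have h3 : ∫⁻ q, ∑ i, (C i).absReward (merged C k q i) ∂π.coupling x =
      ∫⁻ ω, ∫⁻ η, ∑ i, (C i).absReward (merged C k (ω, η) i) ∂endKernel C k ω ∂π.traj x :=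
    Measure.lintegral_compProd (f := fun q => ∑ i, (C i).absReward (merged C k q i))
      (hm.comp measurable_merged)
  rw [h3]
  refine lintegral_mono_ae ?_
  filter_upwards [π.ae_isRegular hC x] with ω hω
  rw [hω.tsum_enorm_reward]
  -- The process collects only a part of the rewards along the full trajectories.
  have h4 (η : ∀ i, ℕ → S i) : ∑ v ∈ Finset.range (endTime C k ω),
      ‖(C (ω v).2).reward ((ω v).1 (ω v).2)‖ₑ ≤ ∑ i, (C i).absReward (merged C k (ω, η) i) := by
    rw [merged, sum_absReward_glue]
    exact le_self_add
  calc _ = ∫⁻ _, ∑ v ∈ Finset.range (endTime C k ω),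
      ‖(C (ω v).2).reward ((ω v).1 (ω v).2)‖ₑ ∂endKernel C k ω := by simp
    _ ≤ _ := lintegral_mono h4

end Policy

end MCS

/-! ### Surrogate values and forgone rewards at the end of the process. -/

namespace RewardChain

variable {S : Type u} [MeasurableSpace S] {C : RewardChain S}

lemma ae_realSurrogate_eq_zero {s : S} (hs : s ∈ C.terminal) :
    ∀ᵐ ω ∂C.traj s, C.realSurrogate ω = 0 := by
  filter_upwards [C.ae_terminal_of_mem hs] with ω h using realSurrogate_of_terminal (h 0)

lemma totalReward_eq_zero {ω : ℕ → S} (h : ∀ t, ω t ∈ C.terminal) : C.totalReward ω = 0 := by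
  simp [totalReward, C.reward_terminal _ (h _)]

lemma integral_totalReward_of_mem {s : S} (hs : s ∈ C.terminal) :
    ∫ ω, C.totalReward ω ∂C.traj s = 0 :=
  integral_eq_zero_of_ae ((C.ae_terminal_of_mem hs).mono fun _ h => totalReward_eq_zero h)

variable (hC : C.Admissible)
include hC

lemma Admissible.integrable_realSurrogate' (s : S) : Integrable C.realSurrogate (C.traj s) := by
  by_cases hs : s ∈ C.terminal
  · refine (integrable_zero (ℕ → S) ℝ (C.traj s)).congr ?_
    filter_upwards [ae_realSurrogate_eq_zero hs] with ω h using h.symm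
  · exact hC.integrable_realSurrogate hs

lemma Admissible.integral_realSurrogate_le' (s : S) :
    ∫ ω, C.realSurrogate ω ∂C.traj s ≤ ∫ ω, C.totalReward ω ∂C.traj s := by
  by_cases hs : s ∈ C.terminal
  · rw [integral_totalReward_of_mem hs, integral_eq_zero_of_ae (ae_realSurrogate_eq_zero hs)]
  · exact hC.integral_realSurrogate_le hs

lemma Admissible.integral_realSurrogate_eq' {s : S} (hG : s ∉ C.terminal → C.gittins s ≠ ⊤) :
    ∫ ω, C.realSurrogate ω ∂C.traj s = ∫ ω, C.totalReward ω ∂C.traj s := by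
  by_cases hs : s ∈ C.terminal
  · rw [integral_totalReward_of_mem hs, integral_eq_zero_of_ae (ae_realSurrogate_eq_zero hs)]
  · exact hC.integral_realSurrogate_eq hs (hG hs)

end RewardChain

namespace MCS

variable {n : ℕ} {S : Fin n → Type u} [∀ i, MeasurableSpace (S i)] {C : ∀ i, RewardChain (S i)}
  {k : ℕ}

lemma integral_comp_eval_jointTraj (x : ∀ i, S i) (i : Fin n) {f : (ℕ → S i) → ℝ}
    (hf : Measurable f) : ∫ η, f (η i) ∂jointTraj C x = ∫ ω, f ω ∂(C i).traj (x i) := by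
  rw [← map_eval_jointTraj C x i,
    integral_map (measurable_pi_apply i).aemeasurable hf.aestronglyMeasurable]

lemma integrable_comp_eval_jointTraj {x : ∀ i, S i} {i : Fin n} {f : (ℕ → S i) → ℝ}
    (hf : Integrable f ((C i).traj (x i))) : Integrable (fun η => f (η i)) (jointTraj C x) := by
  rw [← map_eval_jointTraj C x i] at hf
  exact hf.comp_measurable (measurable_pi_apply i)

lemma measurable_reward : Measurable (reward C k) := by
  refine Measurable.ite (measurable_fst measurableSet_ended) measurable_const ?_
  exact measurable_from_prod_countable_left fun a =>
    (C a).measurable_reward.comp (measurable_pi_apply a)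

/-- The properties of the trajectories of the process, together with the trajectories that the
chains follow after its end, that hold almost surely. -/
structure IsRegularPair (C : ∀ i, RewardChain (S i)) (k : ℕ) (x : ∀ i, S i)
    (q : (ℕ → (∀ i, S i) × Fin n) × (∀ i, ℕ → S i)) : Prop where
  regular : IsRegular C k x q.1
  absReward_lt_top : ∀ i, (C i).absReward (q.2 i) < ∞
  terminal : ∀ i, q.2 i 0 ∈ (C i).terminal ↔ i ∉ active C (q.1 (endTime C k q.1)).1
  gittins_zero : ∀ i, (C i).gittins (q.2 i 0) = (C i).gittins ((q.1 (endTime C k q.1)).1 i)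
  coe_end : ∀ i ∈ active C (q.1 (endTime C k q.1)).1,
    ((C i).realSurrogate (q.2 i) : EReal) = (C i).surrogate (q.2 i)
  coe_merged : ∀ i ∈ active C x,
    ((C i).realSurrogate (merged C k q i) : EReal) = (C i).surrogate (merged C k q i)

namespace Policy

variable (π : Policy C k)

lemma ae_isRegularPair (hC : ∀ i, (C i).Admissible) (x : ∀ i, S i) :
    ∀ᵐ q ∂π.coupling x, IsRegularPair C k x q := by
  have hfst : Measurable fun q : (ℕ → (∀ i, S i) × Fin n) × (∀ i, ℕ → S i) =>
    (q.1 (endTime C k q.1)).1 := measurable_endState.comp measurable_fst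
  have hT (i : Fin n) : MeasurableSet {q : (ℕ → (∀ i, S i) × Fin n) × (∀ i, ℕ → S i) |
      (q.1 (endTime C k q.1)).1 i ∈ (C i).terminal} := hfst (measurableSet_mem_terminal i)
  have h1 : ∀ᵐ q ∂π.coupling x, ∀ i, (C i).absReward (q.2 i) < ∞ := by
    refine ae_all_iff.2 fun i => π.ae_coupling ?_ (Eventually.of_forall fun ω => ?_)
    · exact measurableSet_lt (by fun_prop) measurable_const
    · exact ae_jointTraj_eval C ((hC i).ae_absReward_lt_top _)
  have h2 : ∀ᵐ q ∂π.coupling x, ∀ i,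
      q.2 i 0 ∈ (C i).terminal ↔ i ∉ active C (q.1 (endTime C k q.1)).1 := by
    refine ae_all_iff.2 fun i => ?_
    simp only [mem_active, not_not]
    refine π.ae_coupling ?_ (Eventually.of_forall fun ω => ?_)
    · have h3 : MeasurableSet {q : (ℕ → (∀ i, S i) × Fin n) × (∀ i, ℕ → S i) |
          q.2 i 0 ∈ (C i).terminal} :=
        (by fun_prop : Measurable fun q : (ℕ → (∀ i, S i) × Fin n) × (∀ i, ℕ → S i) => q.2 i 0)
          (C i).measurableSet_terminal
      exact h3.iff (hT i)
    · have hs : MeasurableSet {s | s ∈ (C i).terminal ↔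
          (ω (endTime C k ω)).1 i ∈ (C i).terminal} :=
        MeasurableSet.iff (C i).measurableSet_terminal (.const _)
      exact ae_jointTraj_eval C ((C i).ae_traj_zero _ hs Iff.rfl)
  have h4 : ∀ᵐ q ∂π.coupling x, ∀ i,
      (C i).gittins (q.2 i 0) = (C i).gittins ((q.1 (endTime C k q.1)).1 i) := by
    refine ae_all_iff.2 fun i => π.ae_coupling ?_ (Eventually.of_forall fun ω => ?_)
    · have hg := (hC i).measurable_gittins
      exact measurableSet_eq_fun (by fun_prop) (hg.comp ((measurable_pi_apply i).comp hfst))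
    · have hs : MeasurableSet {s | (C i).gittins s = (C i).gittins ((ω (endTime C k ω)).1 i)} :=
        measurableSet_eq_fun (hC i).measurable_gittins measurable_const
      exact ae_jointTraj_eval C ((C i).ae_traj_zero _ hs rfl)
  have h5 : ∀ᵐ q ∂π.coupling x, ∀ i, i ∈ active C (q.1 (endTime C k q.1)).1 →
      ((C i).realSurrogate (q.2 i) : EReal) = (C i).surrogate (q.2 i) := by
    refine ae_all_iff.2 fun i => ?_
    simp only [mem_active]
    refine π.ae_coupling ?_ (Eventually.of_forall fun ω => ?_)
    · have hm1 := (hC i).measurable_realSurrogate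
      have hm2 := (hC i).measurable_surrogate
      have h6 : MeasurableSet {q : (ℕ → (∀ i, S i) × Fin n) × (∀ i, ℕ → S i) |
          ((C i).realSurrogate (q.2 i) : EReal) = (C i).surrogate (q.2 i)} :=
        measurableSet_eq_fun (by fun_prop) (by fun_prop)
      exact (hT i).compl.imp h6
    · by_cases h : (ω (endTime C k ω)).1 i ∈ (C i).terminal
      · exact Eventually.of_forall fun η h' => absurd h h'
      · exact (ae_jointTraj_eval C ((hC i).ae_coe_realSurrogate h)).mono fun η hη _ => hη
  have h7 : ∀ᵐ q ∂π.coupling x, ∀ i, i ∈ active C x →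
      ((C i).realSurrogate (merged C k q i) : EReal) = (C i).surrogate (merged C k q i) := by
    refine ae_all_iff.2 fun i => ?_
    by_cases h : i ∈ active C x
    · exact (π.ae_merged hC (ae_jointTraj_eval C
        ((hC i).ae_coe_realSurrogate (mem_active.1 h)))).mono fun q hq _ => hq
    · exact Eventually.of_forall fun q h' => absurd h' h
  filter_upwards [π.ae_coupling_fst (π.ae_isRegular hC x), h1, h2, h4, h5, h7] with q a b c d e f
  exact ⟨a, b, c, d, e, f⟩

end Policy

/-- The surrogate value of chain `i` if it is not in a terminal state when the process ends, and
zero otherwise. -/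
def unfinishedSurrogate (C : ∀ i, RewardChain (S i)) (k : ℕ) (i : Fin n)
    (q : (ℕ → (∀ i, S i) × Fin n) × (∀ i, ℕ → S i)) : ℝ :=
  if i ∈ active C (q.1 (endTime C k q.1)).1 then (C i).realSurrogate (merged C k q i) else 0

lemma measurable_unfinishedSurrogate (hC : ∀ i, (C i).Admissible) (i : Fin n) :
    Measurable (unfinishedSurrogate C k i) := by
  have h1 : MeasurableSet {q : (ℕ → (∀ i, S i) × Fin n) × (∀ i, ℕ → S i) |
      i ∈ active C (q.1 (endTime C k q.1)).1} := by
    simp only [mem_active]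
    exact ((measurable_endState.comp measurable_fst) (measurableSet_mem_terminal i)).compl
  have h2 := (hC i).measurable_realSurrogate
  have h3 := measurable_merged (C := C) (k := k)
  exact Measurable.ite h1 (h2.comp ((measurable_pi_apply i).comp h3)) measurable_const

namespace IsRegularPair

variable {x : ∀ i, S i} {q : (ℕ → (∀ i, S i) × Fin n) × (∀ i, ℕ → S i)}
  (h : IsRegularPair C k x q)
include h

/-- The collected rewards are those of the full trajectories minus the forgone ones; by `map_merged`
the policy influences only the expectation of the latter. -/
lemma tsum_reward : ∑' t, reward C k (q.1 t) =
    ∑ i, (C i).totalReward (merged C k q i) - ∑ i, (C i).totalReward (q.2 i) := by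
  rw [h.regular.tsum_reward, merged, sum_totalReward_glue _ _ h.absReward_lt_top]
  ring

lemma abs_totalReward_le (i : Fin n) :
    |(C i).totalReward (q.2 i)| ≤ ∑ j, ((C j).absReward (merged C k q j)).toReal := by
  have h1 : ∑ j, (C j).absReward (merged C k q j) < ∞ := by
    rw [merged, sum_absReward_glue]
    exact ENNReal.add_lt_top.2 ⟨ENNReal.sum_lt_top.2 fun _ _ => by simp,
      ENNReal.sum_lt_top.2 fun j _ => h.absReward_lt_top j⟩
  have h2 : (C i).absReward (q.2 i) ≤ ∑ j, (C j).absReward (merged C k q j) := by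
    rw [merged, sum_absReward_glue]
    exact (Finset.single_le_sum (f := fun j => (C j).absReward (q.2 j)) (fun _ _ => zero_le)
      (Finset.mem_univ i)).trans le_add_self
  rw [← ENNReal.toReal_sum fun j _ => (ENNReal.sum_lt_top.1 h1 j (Finset.mem_univ j)).ne]
  exact ((C i).abs_totalReward_le (h.absReward_lt_top i)).trans (ENNReal.toReal_mono h1.ne h2)

lemma surrogate_merged (i : Fin n) : (C i).surrogate (merged C k q i) =
    min (playedMin C q.1 i (endTime C k q.1)) ((C i).surrogate (q.2 i)) :=
  surrogate_glue (fun _ hv => h.regular.action_mem_active hv) q.2 i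

lemma unfinishedSurrogate_le (i : Fin n) :
    unfinishedSurrogate C k i q ≤ (C i).realSurrogate (q.2 i) := by
  unfold unfinishedSurrogate
  split_ifs with hi
  · rw [← EReal.coe_le_coe_iff, h.coe_merged i (h.regular.active_subset _ hi), h.coe_end i hi,
      h.surrogate_merged]
    exact min_le_right _ _
  -- A chain that has finished leaves the surrogate value `⊤`, whose `toReal` is `0`.
  · rw [RewardChain.realSurrogate_of_terminal ((h.terminal i).2 hi)]

lemma sum_unfinishedSurrogate : ∑ i, unfinishedSurrogate C k i q =
    ∑ i ∈ active C x, (C i).realSurrogate (merged C k q i) -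
      ∑ i ∈ active C x \ active C (q.1 (endTime C k q.1)).1,
        (C i).realSurrogate (merged C k q i) := by
  unfold unfinishedSurrogate
  rw [← Finset.sum_sdiff (h.regular.active_subset (endTime C k q.1)), add_sub_cancel_left,
    Finset.sum_ite_mem, Finset.univ_inter]

/-- The chains that finish during the process form one of the sets over which `topSum` maximizes. -/
lemma le_sum_unfinishedSurrogate : ∑ i ∈ active C x, (C i).realSurrogate (merged C k q i) -
      topSum (active C x) (k - (finished C x).card)
        (fun i => (C i).realSurrogate (merged C k q i)) ≤ ∑ i, unfinishedSurrogate C k i q := by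
  rw [h.sum_unfinishedSurrogate]
  exact sub_le_sub_left (sum_le_topSum (fun i => (C i).realSurrogate (merged C k q i))
    Finset.sdiff_subset h.regular.card_sdiff_active) _

variable (hG : ∀ t < endTime C k q.1, IsGittinsAction C (q.1 t).1 (q.1 t).2)
include hG

/-- The remaining surrogate value is at most the current index, hence at most the played minimum, so
the past does not lower it. -/
lemma unfinishedSurrogate_eq (i : Fin n) :
    unfinishedSurrogate C k i q = (C i).realSurrogate (q.2 i) := by
  unfold unfinishedSurrogate
  split_ifs with hi
  · rw [RewardChain.realSurrogate, RewardChain.realSurrogate, h.surrogate_merged, min_eq_right]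
    have h1 : q.2 i 0 ∉ (C i).terminal := fun h2 => (h.terminal i).1 h2 hi
    refine ((RewardChain.surrogate_le_gittins h1).trans ?_)
    rw [h.gittins_zero]
    exact h.regular.gittins_le_playedMin hG hi
  · rw [RewardChain.realSurrogate_of_terminal ((h.terminal i).2 hi)]

/-- The surrogate value of a finished chain is its played minimum, so the second half of
`gittins_invariant` says that the finished chains carry the largest values. -/
lemma sum_unfinishedSurrogate_eq : ∑ i, unfinishedSurrogate C k i q =
    ∑ i ∈ active C x, (C i).realSurrogate (merged C k q i) -
      topSum (active C x) (k - (finished C x).card)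
        (fun i => (C i).realSurrogate (merged C k q i)) := by
  rw [h.sum_unfinishedSurrogate]
  congr 1
  refine (topSum_eq_sum Finset.sdiff_subset h.regular.card_sdiff_active fun i hi j hj => ?_).symm
  rw [Finset.mem_sdiff] at hi hj
  have hj' : j ∈ active C (q.1 (endTime C k q.1)).1 := by
    by_contra h1
    exact hj.2 (Finset.mem_sdiff.2 ⟨hj.1, h1⟩)
  rw [← EReal.coe_le_coe_iff, h.coe_merged i hi.1, h.coe_merged j hj.1, h.surrogate_merged,
    h.surrogate_merged, RewardChain.surrogate_of_terminal ((h.terminal i).2 hi.2),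
    min_eq_left le_top]
  have h1 : q.2 j 0 ∉ (C j).terminal := fun h2 => (h.terminal j).1 h2 hj'
  refine (min_le_min_left _ ?_).trans ((h.regular.gittins_invariant hG le_rfl).2 i hi.2 j hj')
  rw [← h.gittins_zero]
  exact RewardChain.surrogate_le_gittins h1

end IsRegularPair

end MCS

/-! ### The upper bound for all policies and its attainment by Gittins policies. -/

namespace MCS

variable {n : ℕ} {S : Fin n → Type u} [∀ i, MeasurableSpace (S i)] {C : ∀ i, RewardChain (S i)}
  {k : ℕ}

/-- The upper bound for the value of a policy; it is attained by the Gittins policies. -/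
def upperValue (C : ∀ i, RewardChain (S i)) (k : ℕ) (x : ∀ i, S i) : ℝ :=
  ∑ i, ∫ ω, (C i).totalReward ω ∂(C i).traj (x i) -
    ∫ η, (∑ i ∈ active C x, (C i).realSurrogate (η i) - surrogateSum C k x η) ∂jointTraj C x

lemma measurable_surrogateSum (hC : ∀ i, (C i).Admissible) (x : ∀ i, S i) :
    Measurable (surrogateSum C k x) := by
  have h (i : Fin n) := (hC i).measurable_realSurrogate
  exact (measurable_topSum _ _).comp (g := topSum (active C x) (k - (finished C x).card))
    (f := fun (η : ∀ i, ℕ → S i) i => (C i).realSurrogate (η i)) (by fun_prop)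

lemma integrable_surrogateSum (hC : ∀ i, (C i).Admissible) (hkn : k ≤ n) (x : ∀ i, S i) :
    Integrable (surrogateSum C k x) (jointTraj C x) := by
  have h1 : Integrable (fun η : ∀ i, ℕ → S i => ∑ i ∈ active C x, |(C i).realSurrogate (η i)|)
      (jointTraj C x) := integrable_finsetSum _ fun i _ =>
    (integrable_comp_eval_jointTraj ((hC i).integrable_realSurrogate' (x i))).abs
  refine h1.mono' (measurable_surrogateSum hC x).aestronglyMeasurable
    (Eventually.of_forall fun η => abs_topSum_le _ ?_ _)
  have := card_active_add (C := C) x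
  omega

lemma integral_comp_eval_endKernel (ω : ℕ → (∀ i, S i) × Fin n) (i : Fin n) {f : (ℕ → S i) → ℝ}
    (hf : Measurable f) : ∫ η, f (η i) ∂endKernel C k ω =
      ∫ η, f η ∂(C i).traj ((ω (endTime C k ω)).1 i) := by
  rw [endKernel_apply, integral_comp_eval_jointTraj _ i hf]

lemma integrable_comp_eval_endKernel {ω : ℕ → (∀ i, S i) × Fin n} {i : Fin n} {f : (ℕ → S i) → ℝ}
    (hf : Integrable f ((C i).traj ((ω (endTime C k ω)).1 i))) :
    Integrable (fun η => f (η i)) (endKernel C k ω) := by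
  rw [endKernel_apply]
  exact integrable_comp_eval_jointTraj hf

namespace Policy

variable (π : Policy C k) (hC : ∀ i, (C i).Admissible)

lemma value_of_ended (hC : ∀ i, (C i).Admissible) {x : ∀ i, S i} (hx : Ended C k x) :
    π.value x = 0 := by
  refine integral_eq_zero_of_ae ?_
  filter_upwards [π.ae_isRegular hC x] with ω h
  have h0 : endTime C k ω = 0 := by
    by_contra hne
    refine not_ended_of_lt_endTime (Nat.pos_of_ne_zero hne) ?_
    rwa [ended_iff, h.active_zero, ← ended_iff]
  simp [h.tsum_reward, h0]

lemma integrable_integral_endKernel {x : ∀ i, S i}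
    {f : (ℕ → (∀ i, S i) × Fin n) × (∀ i, ℕ → S i) → ℝ} (hf : Integrable f (π.coupling x)) :
    Integrable (fun ω => ∫ η, f (ω, η) ∂endKernel C k ω) (π.traj x) := by
  unfold coupling Measure.compProd at hf
  simpa using hf.integral_compProd

include hC

lemma integrable_totalReward_end (x : ∀ i, S i) (i : Fin n) :
    Integrable (fun q : (ℕ → (∀ i, S i) × Fin n) × (∀ i, ℕ → S i) => (C i).totalReward (q.2 i))
      (π.coupling x) := by
  have h1 : Integrable (fun ζ : ∀ i, ℕ → S i => ∑ j, ((C j).absReward (ζ j)).toReal)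
      (jointTraj C x) := integrable_finsetSum _ fun j _ =>
    integrable_comp_eval_jointTraj (f := fun ω => ((C j).absReward ω).toReal)
      ((hC j).integrable_absReward (x j))
  refine (π.integrable_merged hC x h1).mono' ?_ ?_
  · have := (C i).measurable_totalReward
    exact (by fun_prop : Measurable _).aestronglyMeasurable
  · filter_upwards [π.ae_isRegularPair hC x] with q h using h.abs_totalReward_le i

lemma value_eq (x : ∀ i, S i) : π.value x =
    ∑ i, ∫ ω, (C i).totalReward ω ∂(C i).traj (x i) -
      ∑ i, ∫ q, (C i).totalReward (q.2 i) ∂π.coupling x := by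
  have e : (π.coupling x).map Prod.fst = π.traj x := Measure.fst_compProd _ _
  have hm : Measurable fun ω : ℕ → (∀ i, S i) × Fin n => ∑' t, reward C k (ω t) := by
    have := measurable_reward (C := C) (k := k)
    exact Measurable.tsum fun t => by fun_prop
  have h1 : π.value x = ∫ q, ∑' t, reward C k (q.1 t) ∂π.coupling x := by
    rw [value, ← e, integral_map measurable_fst.aemeasurable hm.aestronglyMeasurable]
  have h2 : ∫ q, ∑' t, reward C k (q.1 t) ∂π.coupling x =
      ∫ q, (∑ i, (C i).totalReward (merged C k q i) - ∑ i, (C i).totalReward (q.2 i))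
        ∂π.coupling x := by
    refine integral_congr_ae ?_
    filter_upwards [π.ae_isRegularPair hC x] with q h using h.tsum_reward
  have hi (i : Fin n) : Integrable (fun η => (C i).totalReward (η i)) (jointTraj C x) :=
    integrable_comp_eval_jointTraj ((hC i).integrable_totalReward (x i))
  have hi' (i : Fin n) := π.integrable_merged hC x (hi i)
  rw [h1, h2, integral_sub (integrable_finsetSum _ fun i _ => hi' i)
    (integrable_finsetSum _ fun i _ => π.integrable_totalReward_end hC x i),
    integral_finsetSum _ fun i _ => hi' i,
    integral_finsetSum _ fun i _ => π.integrable_totalReward_end hC x i]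
  congr 1
  refine Finset.sum_congr rfl fun i _ => ?_
  have hmi : Measurable fun η : ∀ i, ℕ → S i => (C i).totalReward (η i) := by
    have := (C i).measurable_totalReward
    fun_prop
  rw [π.integral_merged hC x hmi, integral_comp_eval_jointTraj x i (C i).measurable_totalReward]

lemma integrable_unfinishedSurrogate (x : ∀ i, S i) (i : Fin n) :
    Integrable (unfinishedSurrogate C k i) (π.coupling x) := by
  refine (π.integrable_merged hC x (integrable_comp_eval_jointTraj
    ((hC i).integrable_realSurrogate' (x i)))).mono
    (measurable_unfinishedSurrogate hC i).aestronglyMeasurable (Eventually.of_forall fun q => ?_)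
  unfold unfinishedSurrogate
  split_ifs
  · exact le_rfl
  · simp

lemma integral_totalReward_end (x : ∀ i, S i) (i : Fin n) :
    ∫ q, (C i).totalReward (q.2 i) ∂π.coupling x =
      ∫ ω, ∫ η, (C i).totalReward (η i) ∂endKernel C k ω ∂π.traj x :=
  Measure.integral_compProd (π.integrable_totalReward_end hC x i)

omit π in
-- Given the history, the remaining trajectory is a fresh one from the end state, so the one-chain
-- inequality between surrogate value and total reward applies to it.
lemma integral_unfinishedSurrogate_endKernel_le {x : ∀ i, S i} (i : Fin n)
    {ω : ℕ → (∀ i, S i) × Fin n}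
    (h1 : Integrable (fun η => unfinishedSurrogate C k i (ω, η)) (endKernel C k ω))
    (h2 : ∀ᵐ η ∂endKernel C k ω, IsRegularPair C k x (ω, η)) :
    ∫ η, unfinishedSurrogate C k i (ω, η) ∂endKernel C k ω ≤
      ∫ η, (C i).totalReward (η i) ∂endKernel C k ω := by
  have h3 := (hC i).integrable_realSurrogate' ((ω (endTime C k ω)).1 i)
  have h4 := integrable_comp_eval_endKernel (k := k) (ω := ω) h3
  calc ∫ η, unfinishedSurrogate C k i (ω, η) ∂endKernel C k ω
      ≤ ∫ η, (C i).realSurrogate (η i) ∂endKernel C k ω := by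
        refine integral_mono_ae h1 h4 ?_
        filter_upwards [h2] with η hη using hη.unfinishedSurrogate_le i
    _ = ∫ η, (C i).realSurrogate η ∂(C i).traj ((ω (endTime C k ω)).1 i) :=
        integral_comp_eval_endKernel ω i (hC i).measurable_realSurrogate
    _ ≤ ∫ η, (C i).totalReward η ∂(C i).traj ((ω (endTime C k ω)).1 i) :=
        (hC i).integral_realSurrogate_le' _
    _ = ∫ η, (C i).totalReward (η i) ∂endKernel C k ω :=
        (integral_comp_eval_endKernel ω i (C i).measurable_totalReward).symm

lemma integral_unfinishedSurrogate_le (x : ∀ i, S i) (i : Fin n) :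
    ∫ q, unfinishedSurrogate C k i q ∂π.coupling x ≤
      ∫ q, (C i).totalReward (q.2 i) ∂π.coupling x := by
  have hi := π.integrable_unfinishedSurrogate hC x i
  have hi' := π.integrable_totalReward_end hC x i
  have h1 : ∀ᵐ ω ∂π.traj x,
      Integrable (fun η => unfinishedSurrogate C k i (ω, η)) (endKernel C k ω) :=
    ((Measure.integrable_compProd_iff hi.aestronglyMeasurable).1 hi).1
  have h2 : ∀ᵐ ω ∂π.traj x, ∀ᵐ η ∂endKernel C k ω, IsRegularPair C k x (ω, η) :=
    Measure.ae_ae_of_ae_compProd (π.ae_isRegularPair hC x)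
  have e1 : ∫ q, unfinishedSurrogate C k i q ∂π.coupling x =
      ∫ ω, ∫ η, unfinishedSurrogate C k i (ω, η) ∂endKernel C k ω ∂π.traj x :=
    Measure.integral_compProd hi
  have hj : Integrable (fun ω => ∫ η, unfinishedSurrogate C k i (ω, η) ∂endKernel C k ω)
      (π.traj x) := π.integrable_integral_endKernel hi
  have hj' : Integrable (fun ω => ∫ η, (C i).totalReward (η i) ∂endKernel C k ω) (π.traj x) :=
    π.integrable_integral_endKernel (f := fun q => (C i).totalReward (q.2 i)) hi'
  have hle : ∀ᵐ ω ∂π.traj x, ∫ η, unfinishedSurrogate C k i (ω, η) ∂endKernel C k ω ≤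
      ∫ η, (C i).totalReward (η i) ∂endKernel C k ω := by
    filter_upwards [h1, h2] with ω h1 h2
    exact integral_unfinishedSurrogate_endKernel_le hC i h1 h2
  rw [e1, π.integral_totalReward_end hC]
  exact integral_mono_ae hj hj' hle

/-- Equality in the one-chain inequality needs a finite index at the end. Either alternative of `hx`
provides it: the last chain played bounds the other indices, or all indices are finite. -/
lemma IsGittins.integral_unfinishedSurrogate_eq {π : Policy C k} (hπ : π.IsGittins) {x : ∀ i, S i}
    (hx : ¬ Ended C k x ∨ ∀ i s, ¬ (C i).IsFree s) (i : Fin n) :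
    ∫ q, unfinishedSurrogate C k i q ∂π.coupling x =
      ∫ q, (C i).totalReward (q.2 i) ∂π.coupling x := by
  have e1 : ∫ q, unfinishedSurrogate C k i q ∂π.coupling x =
      ∫ ω, ∫ η, unfinishedSurrogate C k i (ω, η) ∂endKernel C k ω ∂π.traj x :=
    Measure.integral_compProd (π.integrable_unfinishedSurrogate hC x i)
  rw [e1, π.integral_totalReward_end hC]
  refine integral_congr_ae ?_
  filter_upwards [Measure.ae_ae_of_ae_compProd (π.ae_isRegularPair hC x), π.ae_isRegular hC x,
    hπ.ae_isGittinsAction hC x] with ω h2 h3 h4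
  calc ∫ η, unfinishedSurrogate C k i (ω, η) ∂endKernel C k ω
      = ∫ η, (C i).realSurrogate (η i) ∂endKernel C k ω := by
        refine integral_congr_ae ?_
        filter_upwards [h2] with η hη using hη.unfinishedSurrogate_eq h4 i
    _ = ∫ η, (C i).realSurrogate η ∂(C i).traj ((ω (endTime C k ω)).1 i) :=
        integral_comp_eval_endKernel ω i (hC i).measurable_realSurrogate
    _ = ∫ η, (C i).totalReward η ∂(C i).traj ((ω (endTime C k ω)).1 i) := by
        refine (hC i).integral_realSurrogate_eq' fun hs => ?_
        rcases hx with hx | hx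
        · exact h3.gittins_ne_top_of_not_ended h4 hx (mem_active.2 hs)
        · exact (hC i).gittins_ne_top (hx i) hs
    _ = ∫ η, (C i).totalReward (η i) ∂endKernel C k ω :=
        (integral_comp_eval_endKernel ω i (C i).measurable_totalReward).symm

omit π in
lemma integrable_sum_sub_surrogateSum (hkn : k ≤ n) (x : ∀ i, S i) : Integrable
    (fun η => ∑ i ∈ active C x, (C i).realSurrogate (η i) - surrogateSum C k x η)
    (jointTraj C x) :=
  (integrable_finsetSum _ fun i _ => integrable_comp_eval_jointTraj
    ((hC i).integrable_realSurrogate' (x i))).sub (integrable_surrogateSum hC hkn x)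

omit π in
lemma measurable_sum_sub_surrogateSum (x : ∀ i, S i) : Measurable fun η : ∀ i, ℕ → S i =>
    ∑ i ∈ active C x, (C i).realSurrogate (η i) - surrogateSum C k x η := by
  have h (i : Fin n) := (hC i).measurable_realSurrogate
  have := measurable_surrogateSum (k := k) hC x
  fun_prop

lemma value_le_upperValue (hkn : k ≤ n) (x : ∀ i, S i) : π.value x ≤ upperValue C k x := by
  rw [π.value_eq hC, upperValue]
  refine sub_le_sub_left ?_ _
  rw [← π.integral_merged hC x (measurable_sum_sub_surrogateSum hC x)]
  calc _ ≤ ∫ q, ∑ i, unfinishedSurrogate C k i q ∂π.coupling x := by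
        refine integral_mono_ae
          (π.integrable_merged hC x (integrable_sum_sub_surrogateSum hC hkn x))
          (integrable_finsetSum _ fun i _ => π.integrable_unfinishedSurrogate hC x i) ?_
        filter_upwards [π.ae_isRegularPair hC x] with q h using h.le_sum_unfinishedSurrogate
    _ = ∑ i, ∫ q, unfinishedSurrogate C k i q ∂π.coupling x :=
        integral_finsetSum _ fun i _ => π.integrable_unfinishedSurrogate hC x i
    _ ≤ _ := Finset.sum_le_sum fun i _ => π.integral_unfinishedSurrogate_le hC x i

lemma IsGittins.value_eq_upperValue {π : Policy C k} (hπ : π.IsGittins) {x : ∀ i, S i}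
    (hx : ¬ Ended C k x ∨ ∀ i s, ¬ (C i).IsFree s) : π.value x = upperValue C k x := by
  rw [π.value_eq hC, upperValue]
  congr 1
  rw [← π.integral_merged hC x (measurable_sum_sub_surrogateSum hC x)]
  calc _ = ∑ i, ∫ q, unfinishedSurrogate C k i q ∂π.coupling x :=
        Finset.sum_congr rfl fun i _ => (hπ.integral_unfinishedSurrogate_eq hC hx i).symm
    _ = ∫ q, ∑ i, unfinishedSurrogate C k i q ∂π.coupling x :=
        (integral_finsetSum _ fun i _ => π.integrable_unfinishedSurrogate hC x i).symm
    _ = _ := by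
        refine integral_congr_ae ?_
        filter_upwards [π.ae_isRegularPair hC x, (π.ae_coupling_fst
          (hπ.ae_isGittinsAction hC x) :)] with q h h' using h.sum_unfinishedSurrogate_eq h'

/-- Gittins policies are optimal. -/
lemma IsGittins.isOptimal {π : Policy C k} (hπ : π.IsGittins) (hkn : k ≤ n) : π.IsOptimal := by
  intro x ρ
  -- From an ended state `upperValue` can be positive, because a chain of infinite index may have `E
  -- Γ` smaller than its expected total reward; but there all policies have value zero.
  by_cases hx : Ended C k x
  · rw [ρ.value_of_ended hC hx, π.value_of_ended hC hx]
  · rw [hπ.value_eq_upperValue hC (Or.inl hx)]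
    exact ρ.value_le_upperValue hC hkn x

omit π in
-- All indices being finite, the expected total rewards cancel against the expected surrogate
-- values, and only the sum of the largest ones remains.
lemma upperValue_eq (hfree : ∀ i s, ¬ (C i).IsFree s) (hkn : k ≤ n) (x : ∀ i, S i) :
    upperValue C k x = ∫ η, surrogateSum C k x η ∂jointTraj C x := by
  have hi (i : Fin n) : Integrable (fun η => (C i).realSurrogate (η i)) (jointTraj C x) :=
    integrable_comp_eval_jointTraj ((hC i).integrable_realSurrogate' (x i))
  have h1 : ∑ i, ∫ ω, (C i).totalReward ω ∂(C i).traj (x i) =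
      ∑ i ∈ active C x, ∫ ω, (C i).totalReward ω ∂(C i).traj (x i) := by
    refine (Finset.sum_subset (Finset.subset_univ _) fun i _ h => ?_).symm
    rw [mem_active, not_not] at h
    exact RewardChain.integral_totalReward_of_mem h
  have h2 : ∑ i ∈ active C x, ∫ ω, (C i).totalReward ω ∂(C i).traj (x i) =
      ∑ i ∈ active C x, ∫ η, (C i).realSurrogate (η i) ∂jointTraj C x := by
    refine Finset.sum_congr rfl fun i _ => ?_
    rw [integral_comp_eval_jointTraj x i (hC i).measurable_realSurrogate]
    exact ((hC i).integral_realSurrogate_eq' fun hs => (hC i).gittins_ne_top (hfree i) hs).symm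
  rw [upperValue, h1, h2, integral_sub (integrable_finsetSum _ fun i _ => hi i)
    (integrable_surrogateSum hC hkn x), integral_finsetSum _ fun i _ => hi i, sub_sub_cancel]

end Policy

/-! ### A deterministic stationary Gittins policy. -/

lemma exists_isGittinsAction (hkn : k ≤ n) {x : ∀ i, S i} (hx : ¬ Ended C k x) :
    ∃ a, IsGittinsAction C x a := by
  have h1 : (active C x).Nonempty := by
    rw [← Finset.card_pos]
    rw [ended_iff] at hx
    omega
  obtain ⟨a, ha, hmax⟩ := Finset.exists_max_image (active C x)
    (fun i => (C i).gittins (x i)) h1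
  exact ⟨a, ha, hmax⟩

lemma exists_measurable_isGittinsAction (hC : ∀ i, (C i).Admissible) (hk : 1 ≤ k) (hkn : k ≤ n) :
    ∃ σ : (∀ i, S i) → Fin n, Measurable σ ∧
      ∀ x, ¬ Ended C k x → IsGittinsAction C x (σ x) := by
  classical
  have hn : 0 < n := by omega
  -- The least Gittins action is a measurable choice. The condition holds vacuously for `m = n`, so
  -- the search also succeeds in states without a Gittins action.
  have hex (x : ∀ i, S i) : ∃ m : ℕ, ∀ h : m < n, IsGittinsAction C x ⟨m, h⟩ :=
    ⟨n, fun h => absurd h (lt_irrefl n)⟩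
  have hms (m : ℕ) : MeasurableSet {x : ∀ i, S i | ∀ h : m < n, IsGittinsAction C x ⟨m, h⟩} := by
    simp only [Set.ofPred_forall]
    exact .iInter fun h => measurable_prodMk_right (measurableSet_isGittinsAction hC)
  have hfind := measurable_find hex hms
  set N : (∀ i, S i) → ℕ := fun x => Nat.find (hex x) with hN
  refine ⟨fun x => if h : N x < n then ⟨N x, h⟩ else ⟨0, hn⟩, ?_, fun x hx => ?_⟩
  · exact (Measurable.of_discrete (f := fun m : ℕ => if h : m < n then (⟨m, h⟩ : Fin n)
      else ⟨0, hn⟩)).comp hfind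
  · obtain ⟨a, ha⟩ := exists_isGittinsAction hkn hx
    have h1 : N x < n := (Nat.find_min' (hex x) fun _ => ha).trans_lt a.2
    simp only [h1, dif_pos]
    exact Nat.find_spec (hex x) h1

/-- The deterministic stationary policy that is given by a function of the current state. -/
def stationaryPolicy (σ : (∀ i, S i) → Fin n) (hσ : Measurable σ)
    (h : ∀ x, ¬ Ended C k x → σ x ∈ active C x) : Policy C k where
  first := Kernel.deterministic σ hσ
  next _ := Kernel.deterministic (fun p => σ p.2) (hσ.comp measurable_snd)
  isMarkov_first := inferInstance
  isMarkov_next _ := inferInstance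
  first_allowed x hx := by
    rw [Kernel.deterministic_apply]
    exact (ae_dirac_iff (Set.toFinite _).measurableSet).2 (h x hx)
  next_allowed _ _ x hx := by
    rw [Kernel.deterministic_apply]
    exact (ae_dirac_iff (Set.toFinite _).measurableSet).2 (h x hx)

lemma exists_stationary_isGittins (hC : ∀ i, (C i).Admissible) (hk : 1 ≤ k) (hkn : k ≤ n) :
    ∃ π : Policy C k, π.IsStationary ∧ π.IsGittins := by
  obtain ⟨σ, hσ, h⟩ := exists_measurable_isGittinsAction hC hk hkn
  have e1 (x : ∀ i, S i) : (stationaryPolicy σ hσ fun x hx => (h x hx).1).first x =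
      Measure.dirac (σ x) := Kernel.deterministic_apply hσ x
  have e2 (t : ℕ) (p : Finset.Iic t → (∀ i, S i) × Fin n) (x : ∀ i, S i) :
      (stationaryPolicy σ hσ fun x hx => (h x hx).1).next t (p, x) = Measure.dirac (σ x) :=
    Kernel.deterministic_apply (hσ.comp measurable_snd) (p, x)
  refine ⟨stationaryPolicy σ hσ fun x hx => (h x hx).1, ⟨σ, hσ, e1, e2⟩, fun x hx => ?_,
    fun t p x hx => ?_⟩
  · rw [e1]
    exact (ae_dirac_iff (Set.toFinite _).measurableSet).2 (h x hx)
  · rw [e2]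
    exact (ae_dirac_iff (Set.toFinite _).measurableSet).2 (h x hx)

end MCS

end

theorem mainTheorem3 {n k : ℕ} (hk : 1 ≤ k) (hkn : k ≤ n)
    {S : Fin n → Type u} [∀ i, MeasurableSpace (S i)]
    (C : ∀ i, RewardChain (S i)) (hC : ∀ i, (C i).Admissible) :
    -- under every policy, the process ends and its total reward is absolutely integrable
    (∀ (π : MCS.Policy C k) (x : ∀ i, S i),
      (∀ᵐ ω ∂π.traj x, ∃ t, MCS.Ended C k (ω t).1) ∧
      ∫⁻ ω, ∑' t, ‖MCS.reward C k (ω t)‖ₑ ∂π.traj x < ∞) ∧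
    -- a Gittins policy exists, and it can be chosen deterministic and stationary
    (∃ π : MCS.Policy C k, π.IsStationary ∧ π.IsGittins) ∧
    -- every Gittins policy is optimal
    (∀ π : MCS.Policy C k, π.IsGittins → π.IsOptimal) ∧
    -- without free states, its value is the expected sum of the largest surrogate values
    ((∀ i s, ¬ (C i).IsFree s) →
      ∀ x : ∀ i, S i,
        (∀ i ∈ MCS.active C x, ∀ᵐ ω ∂(C i).traj (x i),
          (C i).surrogate ω ≠ ⊥ ∧ (C i).surrogate ω ≠ ⊤) ∧
        Integrable (MCS.surrogateSum C k x) (Measure.pi fun i => (C i).traj (x i)) ∧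
        ∀ π : MCS.Policy C k, π.IsGittins →
          π.value x = ∫ ω, MCS.surrogateSum C k x ω ∂(Measure.pi fun i => (C i).traj (x i))) := by
  refine ⟨fun π x => ⟨π.ae_exists_ended hC x, π.lintegral_tsum_enorm_reward_lt_top hC x⟩,
    MCS.exists_stationary_isGittins hC hk hkn, fun π hπ => hπ.isOptimal hC hkn,
    fun hfree x => ⟨fun i hi => (hC i).ae_surrogate_finite (MCS.mem_active.1 hi),
      MCS.integrable_surrogateSum hC hkn x, fun π hπ => ?_⟩⟩
  rw [hπ.value_eq_upperValue hC (Or.inr hfree), MCS.Policy.upperValue_eq hC hfree hkn]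
  rfl
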